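/- Let $n,m\ge 1$, let $F:\mathbb R^m\to\mathbb R$ be a smooth function, $\vec f=(f_1,\dots,f_m)=\nabla F$, let $\Omega\subset\mathbb R^n$ be open, $\delta>0$ and $B_\delta(x_0)\subset\Omega$. Let $\vec u=(u_1,\dots,u_m)$ be a variational solution in $\Omega$ of the system $\Delta u_i+f_i(\vec u)=0$ ($i=1,\dots,m$). This means that: $u_i\in H^1_{loc}(\Omega)$; $f_i(\vec u)$, $u_if_i(\vec u)$ and $F(\vec u)$ belong to $L^1_{loc}(\Omega)$; the system holds in the sense of distributions in $\Omega$; and for every vector field $\phi\in C^1_0(\Omega;\mathbb R^n)$ (that is, $C^1$ with compact support in $\Omega$) $$\int_\Omega\Big[\big(|\nabla\vec u|^2-2F(\vec u)\big)\,\mathrm{div}\,\phi-2\sum_{i=1}^m\nabla u_i\cdot D\phi\,\nabla u_i\Big]\,dx=0 .$$ Let $\beta\in\mathbb R$ be such that $$\int_{B_r(x_0)}\big(2(\beta-1)F(\vec u)-\beta\,\vec u\cdot\vec f(\vec u)\big)\,dx\ge 0\qquad\text{for all }0<r<\delta ,$$ and suppose that $$\sup_{0<r<\delta}\Big(r^{-n-2\beta+1}\int_{\partial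 B_r(x_0)}|\vec u|^2\,d\mathcal H^{n-1}+r^{-n-2\beta+2}\Big|\int_{B_r(x_0)}2F(\vec u)\,dx\Big|\Big)<\infty ,$$ where the values of $\vec u$ on $\partial B_r(x_0)$ are those of its Sobolev trace. For $0<r<\delta$ put $$\Phi(r)=r^{-n-2\beta+2}\int_{B_r(x_0)}\big(|\nabla\vec u|^2-2F(\vec u)\big)\,dx-\beta r^{-n-2\beta+1}\int_{\partial B_r(x_0)}|\vec u|^2\,d\mathcal H^{n-1}.$$ Let $\rho_k>0$ with $\rho_k\to0$, and let $\vec u_k(x)=\rho_k^{-\beta}\vec u(x_0+\rho_kx)$. Then: 1. $\Phi$ is nondecreasing on $(0,\delta)$, and $\Phi(r)$ converges to a finite limit $M(u,x_0)$ as $r\downarrow0$. 2. For every bounded open set $D\subset\mathbb R^n$ there are an index $k(D)$ and a constant $C$ such that for all $k\ge k(D)$ every component of $\vec u_k$ belongs to $H^1(D)$, with squared $H^1(D)$-norm at most $C$. 3. For every bounded open set $D\subset\mathbb R^n$ and every $i$, every weak $H^1(D)$-limit of a subsequence of the $i$-th components $(\vec u_k)_i$ is homogeneous of degree $\beta$,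 that is, it agrees a.e. in $D$ with a function $h$ on $\mathbb R^n$ satisfying $h(\lambda x)=\lambda^\beta h(x)$ for all $\lambda>0$ and $x\in\mathbb R^n$. -/

import Mathlib

open MeasureTheory Filter Topology Metric
open scoped ENNReal ContDiff

namespace BlowUp

/-- A smooth real test function with compact support in `Ω`. -/
structure IsTestFunction {n : ℕ} (Ω : Set (EuclideanSpace ℝ (Fin n)))
    (φ : EuclideanSpace ℝ (Fin n) → ℝ) : Prop where
  smooth : ContDiff ℝ ∞ φ
  compact : HasCompactSupport φ
  supp : tsupport φ ⊆ Ω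

/-- A `C¹` vector field with compact support in `Ω`. -/
structure IsTestField {n : ℕ} (Ω : Set (EuclideanSpace ℝ (Fin n)))
    (φ : EuclideanSpace ℝ (Fin n) → EuclideanSpace ℝ (Fin n)) : Prop where
  smooth : ContDiff ℝ 1 φ
  compact : HasCompactSupport φ
  supp : tsupport φ ⊆ Ω

/-- `g` is the weak gradient of `w` in the open set `Ω`:
`∫ w ∂_v φ = - ∫ (g · v) φ` for all test functions `φ` and all directions `v`. -/
def IsWeakGradient {n : ℕ} (Ω : Set (EuclideanSpace ℝ (Fin n)))
    (w : EuclideanSpace ℝ (Fin n) → ℝ)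
    (g : EuclideanSpace ℝ (Fin n) → EuclideanSpace ℝ (Fin n)) : Prop :=
  ∀ φ : EuclideanSpace ℝ (Fin n) → ℝ, IsTestFunction Ω φ →
    ∀ v : EuclideanSpace ℝ (Fin n),
      ∫ x in Ω, w x * fderiv ℝ φ x v = - ∫ x in Ω, inner ℝ (g x) v * φ x

/-- `w ∈ H¹(Ω)`, with weak gradient `g`. -/
structure MemH1 {n : ℕ} (Ω : Set (EuclideanSpace ℝ (Fin n)))
    (w : EuclideanSpace ℝ (Fin n) → ℝ)
    (g : EuclideanSpace ℝ (Fin n) → EuclideanSpace ℝ (Fin n)) : Prop where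
  memLp : MemLp w 2 (volume.restrict Ω)
  memLp_grad : MemLp g 2 (volume.restrict Ω)
  weakGrad : IsWeakGradient Ω w g

/-- `w ∈ H¹_loc(Ω)`, with weak gradient `g`. -/
structure MemH1Loc {n : ℕ} (Ω : Set (EuclideanSpace ℝ (Fin n)))
    (w : EuclideanSpace ℝ (Fin n) → ℝ)
    (g : EuclideanSpace ℝ (Fin n) → EuclideanSpace ℝ (Fin n)) : Prop where
  memLp : ∀ K ⊆ Ω, IsCompact K → MemLp w 2 (volume.restrict K)
  memLp_grad : ∀ K ⊆ Ω, IsCompact K → MemLp g 2 (volume.restrict K)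
  weakGrad : IsWeakGradient Ω w g

/-- `|∇u|² = ∑ᵢ |∇uᵢ|²`, where `G i` stands for `∇uᵢ`. -/
noncomputable def gradSq {n m : ℕ}
    (G : Fin m → EuclideanSpace ℝ (Fin n) → EuclideanSpace ℝ (Fin n))
    (x : EuclideanSpace ℝ (Fin n)) : ℝ :=
  ∑ i, ‖G i x‖ ^ 2

/-- The divergence `∑ⱼ ∂ⱼφⱼ`. -/
noncomputable def divergence {n : ℕ}
    (φ : EuclideanSpace ℝ (Fin n) → EuclideanSpace ℝ (Fin n))
    (x : EuclideanSpace ℝ (Fin n)) : ℝ :=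
  ∑ j, fderiv ℝ φ x (EuclideanSpace.single j 1) j

/-- `u` (with weak gradients `G i = ∇uᵢ`) is a variational solution in `Ω` of the system
`Δuᵢ + fᵢ(u) = 0`, `f = ∇F`: it lies in `H¹_loc(Ω)`, it solves the system in the sense of
distributions (so that `fᵢ(u)` has to be locally integrable), `uᵢ fᵢ(u)` and `F(u)` are locally
integrable, and the first variation of `∫ (|∇v|² - 2F(v))` with respect to domain variations
vanishes at `v = u`. -/
structure IsVariationalSolution {n m : ℕ} (Ω : Set (EuclideanSpace ℝ (Fin n)))
    (F : EuclideanSpace ℝ (Fin m) → ℝ)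
    (u : EuclideanSpace ℝ (Fin n) → EuclideanSpace ℝ (Fin m))
    (G : Fin m → EuclideanSpace ℝ (Fin n) → EuclideanSpace ℝ (Fin n)) : Prop where
  memH1Loc : ∀ i, MemH1Loc Ω (fun x => u x i) (G i)
  locInt_f : ∀ i, LocallyIntegrableOn (fun x => gradient F (u x) i) Ω
  locInt_uf : ∀ i, LocallyIntegrableOn (fun x => u x i * gradient F (u x) i) Ω
  locInt_F : LocallyIntegrableOn (fun x => F (u x)) Ω
  distributional : ∀ i, ∀ φ : EuclideanSpace ℝ (Fin n) → ℝ, IsTestFunction Ω φ →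
    (∫ x in Ω, u x i * Laplacian.laplacian φ x) + ∫ x in Ω, gradient F (u x) i * φ x = 0
  domainVariation : ∀ φ : EuclideanSpace ℝ (Fin n) → EuclideanSpace ℝ (Fin n),
    IsTestField Ω φ →
    ∫ x in Ω, ((gradSq G x - 2 * F (u x)) * divergence φ x
      - 2 * ∑ i, inner ℝ (G i x) (fderiv ℝ φ x (G i x))) = 0

/-- The surface measure `ℋⁿ⁻¹` (normalised so that it is the usual area) on the sphere
`∂B_r(x₀)`, as a measure on the whole space: the image under `θ ↦ x₀ + rθ` of `rⁿ⁻¹` times the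
surface measure of the unit sphere. For `n = 1` it is the counting measure of two points. -/
noncomputable def surfaceMeasure {n : ℕ} (x₀ : EuclideanSpace ℝ (Fin n)) (r : ℝ) :
    Measure (EuclideanSpace ℝ (Fin n)) :=
  ENNReal.ofReal (r ^ (n - 1)) •
    ((volume : Measure (EuclideanSpace ℝ (Fin n))).toSphere.map
      (fun θ : sphere (0 : EuclideanSpace ℝ (Fin n)) 1 =>
        x₀ + r • (θ : EuclideanSpace ℝ (Fin n))))

/-- `T` is the trace on `∂B_r(x₀)` of the Sobolev function `w ∈ H¹(B_r(x₀))` with weak gradient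
`g`: there are smooth functions converging to `w` in `H¹(B_r(x₀))` whose restrictions to the
sphere converge to `T` in `L²(∂B_r(x₀))`. -/
def IsSphereTrace {n : ℕ} (x₀ : EuclideanSpace ℝ (Fin n)) (r : ℝ)
    (w : EuclideanSpace ℝ (Fin n) → ℝ)
    (g : EuclideanSpace ℝ (Fin n) → EuclideanSpace ℝ (Fin n))
    (T : EuclideanSpace ℝ (Fin n) → ℝ) : Prop :=
  AEStronglyMeasurable T (surfaceMeasure x₀ r) ∧
  ∃ v : ℕ → EuclideanSpace ℝ (Fin n) → ℝ, (∀ k, ContDiff ℝ ∞ (v k)) ∧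
    Tendsto (fun k => eLpNorm (fun x => v k x - w x) 2 (volume.restrict (ball x₀ r)))
      atTop (𝓝 0) ∧
    Tendsto (fun k => eLpNorm (fun x => gradient (v k) x - g x) 2 (volume.restrict (ball x₀ r)))
      atTop (𝓝 0) ∧
    Tendsto (fun k => eLpNorm (fun x => v k x - T x) 2 (surfaceMeasure x₀ r))
      atTop (𝓝 0)

open Classical in
/-- The trace of `w` on `∂B_r(x₀)`; it is unique up to null sets of the surface measure. -/
noncomputable def sphereTrace {n : ℕ} (x₀ : EuclideanSpace ℝ (Fin n)) (r : ℝ)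
    (w : EuclideanSpace ℝ (Fin n) → ℝ)
    (g : EuclideanSpace ℝ (Fin n) → EuclideanSpace ℝ (Fin n)) :
    EuclideanSpace ℝ (Fin n) → ℝ :=
  if h : ∃ T, IsSphereTrace x₀ r w g T then h.choose else 0

/-- `∫_{∂B_r(x₀)} |u|² dℋⁿ⁻¹`, with `u` taken in the sense of traces. -/
noncomputable def boundaryIntegral {n m : ℕ} (x₀ : EuclideanSpace ℝ (Fin n)) (r : ℝ)
    (u : EuclideanSpace ℝ (Fin n) → EuclideanSpace ℝ (Fin m))
    (G : Fin m → EuclideanSpace ℝ (Fin n) → EuclideanSpace ℝ (Fin n)) : ℝ :=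
  ∫ x, ∑ i, (sphereTrace x₀ r (fun y => u y i) (G i) x) ^ 2 ∂(surfaceMeasure x₀ r)

/-- The boundary-adjusted energy
`Φ(r) = r^{-n-2β+2} ∫_{B_r(x₀)} (|∇u|² - 2F(u)) - β r^{-n-2β+1} ∫_{∂B_r(x₀)} |u|² dℋⁿ⁻¹`. -/
noncomputable def Phi {n m : ℕ} (F : EuclideanSpace ℝ (Fin m) → ℝ)
    (u : EuclideanSpace ℝ (Fin n) → EuclideanSpace ℝ (Fin m))
    (G : Fin m → EuclideanSpace ℝ (Fin n) → EuclideanSpace ℝ (Fin n))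
    (x₀ : EuclideanSpace ℝ (Fin n)) (β r : ℝ) : ℝ :=
  r ^ (-(n : ℝ) - 2 * β + 2) * (∫ x in ball x₀ r, (gradSq G x - 2 * F (u x)))
    - β * r ^ (-(n : ℝ) - 2 * β + 1) * boundaryIntegral x₀ r u G

/-- The growth condition
`sup_{0<r<δ} (r^{-n-2β+1} ∫_{∂B_r(x₀)} |u|² dℋⁿ⁻¹ + r^{-n-2β+2} |∫_{B_r(x₀)} 2F(u)|) < ∞`. -/
def GrowthCondition {n m : ℕ} (F : EuclideanSpace ℝ (Fin m) → ℝ)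
    (u : EuclideanSpace ℝ (Fin n) → EuclideanSpace ℝ (Fin m))
    (G : Fin m → EuclideanSpace ℝ (Fin n) → EuclideanSpace ℝ (Fin n))
    (x₀ : EuclideanSpace ℝ (Fin n)) (β δ : ℝ) : Prop :=
  BddAbove ((fun r : ℝ =>
    r ^ (-(n : ℝ) - 2 * β + 1) * boundaryIntegral x₀ r u G
      + r ^ (-(n : ℝ) - 2 * β + 2) * |∫ x in ball x₀ r, 2 * F (u x)|) '' Set.Ioo 0 δ)

/-- The rescaled function `x ↦ ρ^{-β} w(x₀ + ρx)`. -/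
noncomputable def rescale {n : ℕ} (x₀ : EuclideanSpace ℝ (Fin n)) (β ρ : ℝ)
    (w : EuclideanSpace ℝ (Fin n) → ℝ) : EuclideanSpace ℝ (Fin n) → ℝ :=
  fun x => ρ ^ (-β) * w (x₀ + ρ • x)

/-- The gradient `x ↦ ρ^{1-β} ∇w(x₀ + ρx)` of the rescaled function, where `g = ∇w`. -/
noncomputable def rescaleGrad {n : ℕ} (x₀ : EuclideanSpace ℝ (Fin n)) (β ρ : ℝ)
    (g : EuclideanSpace ℝ (Fin n) → EuclideanSpace ℝ (Fin n)) :
    EuclideanSpace ℝ (Fin n) → EuclideanSpace ℝ (Fin n) :=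
  fun x => ρ ^ (1 - β) • g (x₀ + ρ • x)

/-- Weak convergence in `H¹(D)` of `w k` (with gradients `g k`, in `H¹(D)` for large `k`) to
`w₀` (with gradient `g₀`): weak convergence in `L²(D)` of the functions and of the gradients. -/
structure WeakH1Tendsto {n : ℕ} (D : Set (EuclideanSpace ℝ (Fin n)))
    (w : ℕ → EuclideanSpace ℝ (Fin n) → ℝ)
    (g : ℕ → EuclideanSpace ℝ (Fin n) → EuclideanSpace ℝ (Fin n))
    (w₀ : EuclideanSpace ℝ (Fin n) → ℝ)
    (g₀ : EuclideanSpace ℝ (Fin n) → EuclideanSpace ℝ (Fin n)) : Prop where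
  eventually_mem : ∀ᶠ k in atTop, MemH1 D (w k) (g k)
  limit_mem : MemH1 D w₀ g₀
  tendsto_fun : ∀ ψ : EuclideanSpace ℝ (Fin n) → ℝ, MemLp ψ 2 (volume.restrict D) →
    Tendsto (fun k => ∫ x in D, w k x * ψ x) atTop (𝓝 (∫ x in D, w₀ x * ψ x))
  tendsto_grad : ∀ Ψ : EuclideanSpace ℝ (Fin n) → EuclideanSpace ℝ (Fin n),
    MemLp Ψ 2 (volume.restrict D) →
    Tendsto (fun k => ∫ x in D, inner ℝ (g k x) (Ψ x)) atTop
      (𝓝 (∫ x in D, inner ℝ (g₀ x) (Ψ x)))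

/-- `h(λx) = λ^β h(x)` for all `λ > 0` and all `x`. -/
def IsHomogeneous {n : ℕ} (β : ℝ) (h : EuclideanSpace ℝ (Fin n) → ℝ) : Prop :=
  ∀ t : ℝ, 0 < t → ∀ x : EuclideanSpace ℝ (Fin n), h (t • x) = t ^ β * h x

end BlowUp

/-! Everything rests on Weiss' monotonicity formula (`IsVariationalSolution.Phi_sub`). The increment
of `Φ` over `(r₁, r₂)` is twice an annulus integral of `|x - x₀|^(-n-2β+2) |∂_ν u - β u/|x - x₀||²`
plus twice a positively weighted integral over `t` of `∫_{B_t} (2(β-1)F(u) - β u·f(u))`. The second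
term is nonnegative by hypothesis, so `Φ` is monotone and its increments control how far `u` is from
satisfying Euler's relation for homogeneity of degree `β`.

The formula combines three identities. The domain variation with a radial field `η(x)(x - x₀)`
yields a Pohozaev identity. Testing the equation with `η u` relates the Dirichlet integral to
`u·f(u)` and `u ∂_ν u`. The divergence theorem for `|u|² η (x - x₀)` handles the boundary term.
Differentiating `Φ` directly would bring in sphere integrals of `|∇u|²`, which make sense only for
almost every radius. To avoid them, `η` is taken as the primitive of a smooth weight `χ` of the
radius. Fubini turns each identity into one between `∫ χ(t) ∫_{B_t} … dt` and an annulus integral,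
and `intervalIntegral_eq_setIntegral_annulus` replaces `χ` by powers of `t`. The exponents are
chosen so that the annulus terms complete a square. The trace enters `Φ` only through its `L²` norm,
which `mul_boundaryIntegral` rewrites as a ball integral.

The growth condition bounds the difference between `Φ(r)` and the scaled Dirichlet integral.
Nonnegativity of the latter bounds `Φ` from below, so the limit is finite; monotonicity bounds
`Φ(r)` from above, hence the Dirichlet integral on small balls. With the bound on the boundary
integral this controls the `L²` norm too, and rescaling gives the `H¹` bounds.

For homogeneity, the weighted integral of the squared Euler defect `x·∇u_k - β u_k` over a fixed
annulus is scale invariant. It is bounded by an increment of `Φ` between two radii that both tend to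
`0`, so it vanishes in the limit. For a Sobolev function, the defect paired with a dilated test
function is, up to a power of `t`, the derivative in `t` of `∫ t^(-β) w(t x) ψ(x) dx`. The mean
value inequality therefore shows that the pairings of `u_k` with `ψ` and with its dilate become
equal. This uses only weak convergence of the functions themselves and gives `w(l x) = l^β w(x)`
almost everywhere for each `l` (`ae_eq_of_tendsto_eulerDefect`). Averaging along rays then produces
a representative that is homogeneous everywhere (`exists_isHomogeneous_of_ae_eq`). -/

namespace BlowUp

/-! ### Mollification in `L²` and smooth approximation of Sobolev functions. -/

-- Jensen's inequality for the probability density `φ`, then Tonelli and translation invariance. The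
-- pointwise inequality is Cauchy–Schwarz with `φ = φ^(1/2) φ^(1/2)`. Lower integrals make
-- integrability of `f` unnecessary.
open ContinuousLinearMap in
theorem lintegral_enorm_sq_convolution_le {n : ℕ} {V : Type*} [NormedAddCommGroup V]
    [NormedSpace ℝ V] {φ : EuclideanSpace ℝ (Fin n) → ℝ} (hφc : Continuous φ)
    (hφ0 : ∀ x, 0 ≤ φ x) (hφi : Integrable φ) (hφ1 : ∫ x, φ x = 1)
    {f : EuclideanSpace ℝ (Fin n) → V} (hf : AEStronglyMeasurable f) :
    ∫⁻ x, ‖(convolution φ f (lsmul ℝ ℝ) volume) x‖ₑ ^ 2 ≤ ∫⁻ x, ‖f x‖ₑ ^ 2 := by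
  have hφl : ∫⁻ y, ‖φ y‖ₑ = 1 := by
    have := ofReal_integral_eq_lintegral_ofReal hφi (ae_of_all _ hφ0)
    rw [hφ1] at this
    rw [← ENNReal.ofReal_one, this]
    exact lintegral_congr fun y => Real.enorm_of_nonneg (hφ0 y)
  have key : ∀ x, ‖(convolution φ f (lsmul ℝ ℝ) volume) x‖ₑ ^ 2
      ≤ ∫⁻ y, ‖φ y‖ₑ * ‖f (x - y)‖ₑ ^ 2 := by
    intro x
    have hfx : AEStronglyMeasurable (fun y => f (x - y)) volume :=
      hf.comp_quasiMeasurePreserving (quasiMeasurePreserving_sub_left volume x)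
    have h1 : ‖(convolution φ f (lsmul ℝ ℝ) volume) x‖ₑ ≤ ∫⁻ y, ‖φ y‖ₑ * ‖f (x - y)‖ₑ := by
      refine (enorm_integral_le_lintegral_enorm _).trans (le_of_eq ?_)
      refine lintegral_congr fun y => ?_
      simp [enorm_smul]
    have h2 : ∫⁻ y, ‖φ y‖ₑ * ‖f (x - y)‖ₑ
        = ∫⁻ y, ‖φ y‖ₑ ^ (1/2 : ℝ) * (‖φ y‖ₑ ^ (1/2 : ℝ) * ‖f (x - y)‖ₑ) := by
      refine lintegral_congr fun y => ?_
      rw [← mul_assoc, ← ENNReal.rpow_add_of_nonneg _ _ (by norm_num) (by norm_num)]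
      norm_num
    have h3 := ENNReal.lintegral_mul_le_Lp_mul_Lq volume Real.HolderConjugate.two_two
      (f := fun y => ‖φ y‖ₑ ^ (1/2 : ℝ)) (g := fun y => ‖φ y‖ₑ ^ (1/2 : ℝ) * ‖f (x - y)‖ₑ)
      (hφc.aestronglyMeasurable.enorm.pow_const _)
      ((hφc.aestronglyMeasurable.enorm.pow_const _).mul hfx.enorm)
    have h4 : ∀ a : ℝ≥0∞, (a ^ (1/2 : ℝ)) ^ (2:ℝ) = a := by
      intro a; rw [← ENNReal.rpow_mul]; norm_num
    have h5 : ∀ a : ℝ≥0∞, (a ^ (1/2 : ℝ)) ^ 2 = a := by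
      intro a; rw [← ENNReal.rpow_natCast, ← ENNReal.rpow_mul]; norm_num
    simp only [Pi.mul_apply, h4, hφl, ENNReal.one_rpow, one_mul,
      ENNReal.mul_rpow_of_nonneg _ _ (show (0:ℝ) ≤ 2 by norm_num)] at h3
    calc _ ≤ (∫⁻ y, ‖φ y‖ₑ * ‖f (x - y)‖ₑ) ^ 2 := by gcongr
      _ ≤ ((∫⁻ y, ‖φ y‖ₑ * ‖f (x - y)‖ₑ ^ (2:ℝ)) ^ (1/2 : ℝ)) ^ 2 := by
          rw [h2]; gcongr
      _ = _ := by rw [h5]; simp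
  have hm : AEMeasurable (fun p : EuclideanSpace ℝ (Fin n) × EuclideanSpace ℝ (Fin n) =>
      ‖φ p.2‖ₑ * ‖f (p.1 - p.2)‖ₑ ^ 2) (volume.prod volume) := by
    have h1 : AEMeasurable (fun p : EuclideanSpace ℝ (Fin n) × EuclideanSpace ℝ (Fin n) =>
        ‖φ p.2‖ₑ) (volume.prod volume) :=
      (by fun_prop : Continuous fun p : EuclideanSpace ℝ (Fin n) × EuclideanSpace ℝ (Fin n) =>
        φ p.2).aestronglyMeasurable.enorm
    have h2 : AEMeasurable (fun p : EuclideanSpace ℝ (Fin n) × EuclideanSpace ℝ (Fin n) =>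
        ‖f (p.1 - p.2)‖ₑ ^ 2) (volume.prod volume) :=
      (hf.comp_quasiMeasurePreserving
        (quasiMeasurePreserving_sub volume volume)).enorm.pow_const _
    exact h1.mul h2
  calc _ ≤ ∫⁻ x, ∫⁻ y, ‖φ y‖ₑ * ‖f (x - y)‖ₑ ^ 2 := lintegral_mono key
    _ = ∫⁻ y, ∫⁻ x, ‖φ y‖ₑ * ‖f (x - y)‖ₑ ^ 2 := lintegral_lintegral_swap hm
    _ = ∫⁻ y, ‖φ y‖ₑ * ∫⁻ x, ‖f x‖ₑ ^ 2 := by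
      refine lintegral_congr fun y => ?_
      rw [lintegral_const_mul' _ _ (by simp), lintegral_sub_right_eq_self (fun x => ‖f x‖ₑ ^ 2) y]
    _ = _ := by
      rw [lintegral_mul_const'' _ hφc.aestronglyMeasurable.enorm, hφl, one_mul]

theorem eLpNorm_two_eq {X V : Type*} [MeasurableSpace X] [NormedAddCommGroup V] (μ : Measure X)
    (f : X → V) : eLpNorm f 2 μ = (∫⁻ x, ‖f x‖ₑ ^ 2 ∂μ) ^ (1/2 : ℝ) := by
  rw [eLpNorm_eq_lintegral_rpow_enorm_toReal (by norm_num) (by norm_num)]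
  simp

open ContinuousLinearMap in
theorem eLpNorm_convolution_le {n : ℕ} {V : Type*} [NormedAddCommGroup V]
    [NormedSpace ℝ V] {φ : EuclideanSpace ℝ (Fin n) → ℝ} (hφc : Continuous φ)
    (hφ0 : ∀ x, 0 ≤ φ x) (hφi : Integrable φ) (hφ1 : ∫ x, φ x = 1)
    {f : EuclideanSpace ℝ (Fin n) → V} (hf : AEStronglyMeasurable f) :
    eLpNorm (convolution φ f (lsmul ℝ ℝ) volume) 2 volume ≤ eLpNorm f 2 volume := by
  rw [eLpNorm_two_eq, eLpNorm_two_eq]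
  exact ENNReal.rpow_le_rpow (lintegral_enorm_sq_convolution_le hφc hφ0 hφi hφ1 hf) (by norm_num)

-- Uniform continuity makes the mollification error uniformly small, and the errors eventually live
-- in one compact set, so smallness in the sup norm gives smallness in `L²`.
open ContinuousLinearMap in
theorem tendsto_eLpNorm_convolution_sub_of_continuous {n : ℕ} {V : Type*} [NormedAddCommGroup V]
    [NormedSpace ℝ V] [CompleteSpace V] {φ : ℕ → ContDiffBump (0 : EuclideanSpace ℝ (Fin n))}
    (hφ : Tendsto (fun k => (φ k).rOut) atTop (𝓝 0)) {f : EuclideanSpace ℝ (Fin n) → V}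
    (hf : Continuous f) (hfc : HasCompactSupport f) :
    Tendsto (fun k => eLpNorm (convolution ((φ k).normed volume) f (lsmul ℝ ℝ) volume - f) 2 volume)
      atTop (𝓝 0) := by
  set K := cthickening 1 (tsupport f) with hK
  have hKc : IsCompact K := hfc.isCompact.cthickening
  have hKm : MeasurableSet K := isClosed_cthickening.measurableSet
  have hKv : volume K ≠ ⊤ := hKc.measure_ne_top
  have hzero : ∀ᶠ k in atTop, ∀ x ∉ K,
      (convolution ((φ k).normed volume) f (lsmul ℝ ℝ) volume - f) x = 0 := by
    filter_upwards [hφ.eventually (gt_mem_nhds one_pos)] with k hk x hx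
    have h0 : ∀ y ∈ ball x (φ k).rOut, f y = 0 := by
      intro y hy
      by_contra hne
      apply hx
      refine mem_cthickening_of_dist_le x y 1 _ (subset_tsupport _ hne) ?_
      rw [dist_comm]
      exact (mem_ball.1 hy).le.trans hk.le
    have hx0 : f x = 0 := h0 x (mem_ball_self (φ k).rOut_pos)
    rw [Pi.sub_apply, (φ k).normed_convolution_eq_right (fun y hy => by rw [h0 y hy, hx0]), sub_self]
  have huc := hfc.uniformContinuous_of_continuous hf
  have hle : ∀ ε : ℝ, 0 < ε → ∀ᶠ k in atTop,
      eLpNorm (convolution ((φ k).normed volume) f (lsmul ℝ ℝ) volume - f) 2 volume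
        ≤ volume K ^ (1/2 : ℝ) * ENNReal.ofReal ε := by
    intro ε hε
    obtain ⟨d, hd, hfd⟩ := Metric.uniformContinuous_iff.1 huc ε hε
    filter_upwards [hzero, hφ.eventually (gt_mem_nhds hd)] with k hk hkd
    set g := convolution ((φ k).normed volume) f (lsmul ℝ ℝ) volume - f
    have hg : g = K.indicator g := by
      ext x
      by_cases hx : x ∈ K
      · simp [hx]
      · simp [hx, hk x hx]
    rw [hg, eLpNorm_indicator_eq_eLpNorm_restrict hKm]
    refine (eLpNorm_le_of_ae_bound (C := ε) (ae_of_all _ fun x => ?_)).trans ?_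
    · change ‖convolution ((φ k).normed volume) f (lsmul ℝ ℝ) volume x - f x‖ ≤ ε
      rw [← dist_eq_norm]
      refine (φ k).dist_normed_convolution_le hf.aestronglyMeasurable fun y hy => ?_
      exact (hfd ((mem_ball.1 hy).trans hkd)).le
    · simp
  rw [ENNReal.tendsto_nhds_zero]
  intro ε hε
  have : Tendsto (fun t : ℝ => volume K ^ (1/2 : ℝ) * ENNReal.ofReal t) (𝓝[>] 0) (𝓝 0) := by
    have h1 : Tendsto (fun t : ℝ => ENNReal.ofReal t) (𝓝[>] 0) (𝓝 0) := by
      have := (ENNReal.continuous_ofReal.tendsto 0).mono_left (nhdsWithin_le_nhds (s := Set.Ioi 0))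
      simpa using this
    have := ENNReal.Tendsto.const_mul (a := volume K ^ (1/2 : ℝ)) h1
      (Or.inr (ENNReal.rpow_ne_top_of_nonneg (by norm_num) hKv))
    simpa using this
  obtain ⟨t, ht, ht0⟩ := ((ENNReal.tendsto_nhds_zero.1 this ε hε).and self_mem_nhdsWithin).exists
  filter_upwards [hle t ht0] with k hk using hk.trans ht

-- Density of compactly supported continuous functions: the error for `f` splits into the error for
-- `g`, the difference `f - g`, and the mollified `f - g`, which is no larger in `L²` because
-- mollification is a contraction.
open ContinuousLinearMap in
theorem tendsto_eLpNorm_convolution_sub {n : ℕ} {V : Type*} [NormedAddCommGroup V]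
    [NormedSpace ℝ V] [CompleteSpace V] {φ : ℕ → ContDiffBump (0 : EuclideanSpace ℝ (Fin n))}
    (hφ : Tendsto (fun k => (φ k).rOut) atTop (𝓝 0)) {f : EuclideanSpace ℝ (Fin n) → V}
    (hf : MemLp f 2 volume) :
    Tendsto (fun k => eLpNorm (convolution ((φ k).normed volume) f (lsmul ℝ ℝ) volume - f) 2 volume)
      atTop (𝓝 0) := by
  rw [ENNReal.tendsto_nhds_zero]
  intro ε hε
  have hε3 : ε / 3 ≠ 0 := by simp [hε.ne']
  obtain ⟨g, hgc, hfg, hg, hg2⟩ := hf.exists_hasCompactSupport_eLpNorm_sub_le (by norm_num) hε3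
  filter_upwards [ENNReal.tendsto_nhds_zero.1
    (tendsto_eLpNorm_convolution_sub_of_continuous hφ hg hgc) (ε / 3) (pos_iff_ne_zero.2 hε3)]
    with k hk
  have hc : Continuous ((φ k).normed volume) := (φ k).continuous_normed
  have hcs : HasCompactSupport ((φ k).normed volume) := (φ k).hasCompactSupport_normed
  have hconv : ∀ q : EuclideanSpace ℝ (Fin n) → V, MemLp q 2 volume →
      Continuous (convolution ((φ k).normed volume) q (lsmul ℝ ℝ) volume) ∧
      ConvolutionExists ((φ k).normed volume) q (lsmul ℝ ℝ) volume := fun q hq =>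
    have hl := hq.locallyIntegrable (by norm_num)
    ⟨hcs.continuous_convolution_left _ hc hl, hcs.convolutionExists_left _ hc hl⟩
  have hsub : convolution ((φ k).normed volume) (f - g) (lsmul ℝ ℝ) volume
      = convolution ((φ k).normed volume) f (lsmul ℝ ℝ) volume
        - convolution ((φ k).normed volume) g (lsmul ℝ ℝ) volume := by
    ext x
    simp only [Pi.sub_apply, convolution, map_sub]
    exact integral_sub ((hconv f hf).2 x) ((hconv g hg2).2 x)
  have heq : convolution ((φ k).normed volume) f (lsmul ℝ ℝ) volume - f
      = convolution ((φ k).normed volume) (f - g) (lsmul ℝ ℝ) volume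
        + ((convolution ((φ k).normed volume) g (lsmul ℝ ℝ) volume - g) - (f - g)) := by
    rw [hsub]; abel
  have hfgm := (hf.sub hg2)
  have m1 := (hconv _ hfgm).1.aestronglyMeasurable (μ := volume)
  have m2 := ((hconv _ hg2).1.sub hg).aestronglyMeasurable (μ := volume)
  calc _ ≤ ε / 3 + (ε / 3 + ε / 3) := by
        rw [heq]
        refine (eLpNorm_add_le m1 (m2.sub hfgm.1) (by norm_num)).trans ?_
        refine add_le_add ?_ ((eLpNorm_sub_le m2 hfgm.1 (by norm_num)).trans (add_le_add hk hfg))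
        exact (eLpNorm_convolution_le hc (φ k).nonneg_normed (φ k).integrable_normed
          (φ k).integral_normed hfgm.1).trans hfg
    _ = ε := by rw [← add_assoc, ENNReal.add_thirds]

theorem gradient_eq_of_fderiv {n : ℕ} {v : EuclideanSpace ℝ (Fin n) → ℝ}
    {x a : EuclideanSpace ℝ (Fin n)} (h : ∀ e, fderiv ℝ v x e = inner ℝ a e) :
    gradient v x = a := by
  rw [gradient, LinearIsometryEquiv.symm_apply_eq]
  ext e
  simp [h]

-- The kernel `y ↦ φ(x - y)` is itself an admissible test function: since `φ.rOut < R - r` and `x`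
-- lies in the ball of radius `r`, its support stays in the ball of radius `R`. The truncation of
-- `w` and `g` by the indicator is therefore invisible at `x`.
open ContinuousLinearMap in
theorem gradient_convolution {n : ℕ} {Ω : Set (EuclideanSpace ℝ (Fin n))}
    {w : EuclideanSpace ℝ (Fin n) → ℝ}
    {g : EuclideanSpace ℝ (Fin n) → EuclideanSpace ℝ (Fin n)} (hw : IsWeakGradient Ω w g)
    {x₀ x : EuclideanSpace ℝ (Fin n)} {r R : ℝ} (hR : closedBall x₀ R ⊆ Ω)
    (hx : x ∈ closedBall x₀ r) {φ : ContDiffBump (0 : EuclideanSpace ℝ (Fin n))}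
    (hφ : φ.rOut < R - r)
    (hwi : Integrable ((closedBall x₀ R).indicator w))
    (hgi : Integrable ((closedBall x₀ R).indicator g)) :
    gradient (convolution (φ.normed volume) ((closedBall x₀ R).indicator w) (lsmul ℝ ℝ) volume) x
      = convolution (φ.normed volume) ((closedBall x₀ R).indicator g) (lsmul ℝ ℝ) volume x := by
  have hcs : HasCompactSupport (φ.normed volume) := φ.hasCompactSupport_normed
  have hsm : ContDiff ℝ ∞ (φ.normed volume) := φ.contDiff_normed
  have hd := hcs.hasFDerivAt_convolution_left (lsmul ℝ ℝ) (hsm.of_le (by simp))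
    hwi.locallyIntegrable x
  refine gradient_eq_of_fderiv fun e => ?_
  rw [hd.fderiv]
  have hfc : Continuous (fderiv ℝ (φ.normed volume)) := hsm.continuous_fderiv (by simp)
  have hex : ConvolutionExistsAt (fderiv ℝ (φ.normed volume)) ((closedBall x₀ R).indicator w) x
      (precompL (EuclideanSpace ℝ (Fin n)) (lsmul ℝ ℝ)) volume :=
    (hcs.fderiv ℝ).convolutionExists_left _ hfc hwi.locallyIntegrable x
  have hex2 : ConvolutionExistsAt (φ.normed volume) ((closedBall x₀ R).indicator g) x
      (lsmul ℝ ℝ) volume :=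
    hcs.convolutionExists_left _ hsm.continuous hgi.locallyIntegrable x
  set ψ : EuclideanSpace ℝ (Fin n) → ℝ := fun y => φ.normed volume (x - y) with hψ
  have hψd : ∀ y, fderiv ℝ ψ y e = - fderiv ℝ (φ.normed volume) (x - y) e := by
    intro y
    have h1 : HasFDerivAt (fun y => x - y) (-(ContinuousLinearMap.id ℝ _)) y := by
      simpa using (hasFDerivAt_id y).const_sub x
    have := ((hsm.differentiable (by simp)) (x - y)).hasFDerivAt.comp y h1
    rw [show ψ = (φ.normed volume) ∘ (fun y => x - y) from rfl, this.fderiv]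
    simp
  have hψt : tsupport ψ ⊆ closedBall x φ.rOut := by
    refine closure_minimal (fun y hy => ?_) isClosed_closedBall
    have : x - y ∈ Function.support (φ.normed volume) := hy
    rw [φ.support_normed_eq, mem_ball_zero_iff] at this
    rw [mem_closedBall, dist_comm, dist_eq_norm]
    exact this.le
  have hsub : closedBall x φ.rOut ⊆ closedBall x₀ R := by
    apply closedBall_subset_closedBall'
    have := mem_closedBall.1 hx
    linarith
  have htest : IsTestFunction Ω ψ :=
    ⟨hsm.comp (contDiff_const.sub contDiff_id),
      HasCompactSupport.of_support_subset_isCompact (isCompact_closedBall x φ.rOut)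
        ((subset_tsupport _).trans hψt), (hψt.trans hsub).trans hR⟩
  have hψ0 : ∀ y ∉ closedBall x₀ R, ψ y = 0 := fun y hy =>
    image_eq_zero_of_notMem_tsupport fun h => hy (hsub (hψt h))
  have hψd0 : ∀ y ∉ closedBall x₀ R, fderiv ℝ ψ y e = 0 := fun y hy => by
    have : fderiv ℝ ψ y = 0 := image_eq_zero_of_notMem_tsupport
      fun h => hy (hsub (hψt (tsupport_fderiv_subset ℝ h)))
    simp [this]
  have key := hw ψ htest e
  rw [setIntegral_eq_integral_of_forall_compl_eq_zero
      (fun y hy => by rw [hψd0 y fun h => hy (hR h), mul_zero]),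
    setIntegral_eq_integral_of_forall_compl_eq_zero
      (fun y hy => by rw [hψ0 y fun h => hy (hR h), mul_zero])] at key
  have lhs : (convolution (fderiv ℝ (φ.normed volume)) ((closedBall x₀ R).indicator w)
      (precompL (EuclideanSpace ℝ (Fin n)) (lsmul ℝ ℝ)) volume x) e
      = - ∫ y, w y * fderiv ℝ ψ y e := by
    rw [convolution, ContinuousLinearMap.integral_apply hex, ← integral_neg,
      ← integral_sub_left_eq_self _ volume x]
    refine integral_congr_ae (ae_of_all _ fun y => ?_)
    simp only [precompL_apply, lsmul_apply, sub_sub_cancel, smul_eq_mul]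
    by_cases hy : y ∈ closedBall x₀ R
    · simp [hy, hψd]; ring
    · simp [hy, hψd0 y hy]
  rw [lhs, key, neg_neg]
  rw [convolution_eq_swap, real_inner_comm, ← integral_inner]
  · refine integral_congr_ae (ae_of_all _ fun y => ?_)
    simp only [lsmul_apply]
    by_cases hy : y ∈ closedBall x₀ R
    · simp [hy, real_inner_smul_right, real_inner_comm e]; ring
    · simp [hy, hψ0 y hy]
  · exact hex2.integrable_swap

/-- Local approximation of `H¹` functions by smooth functions. -/
theorem MemH1Loc.exists_smooth_approx {n : ℕ} {Ω : Set (EuclideanSpace ℝ (Fin n))}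
    {w : EuclideanSpace ℝ (Fin n) → ℝ}
    {g : EuclideanSpace ℝ (Fin n) → EuclideanSpace ℝ (Fin n)} (hw : MemH1Loc Ω w g)
    {x₀ : EuclideanSpace ℝ (Fin n)} {r R : ℝ} (hrR : r < R) (hR : closedBall x₀ R ⊆ Ω) :
    ∃ v : ℕ → EuclideanSpace ℝ (Fin n) → ℝ, (∀ k, ContDiff ℝ ∞ (v k)) ∧
      Tendsto (fun k => eLpNorm (fun x => v k x - w x) 2 (volume.restrict (closedBall x₀ r)))
        atTop (𝓝 0) ∧
      Tendsto (fun k => eLpNorm (fun x => gradient (v k) x - g x) 2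
        (volume.restrict (closedBall x₀ r))) atTop (𝓝 0) := by
  set B := closedBall x₀ R with hB
  have hBm : MeasurableSet B := isClosed_closedBall.measurableSet
  have hBc : IsCompact B := isCompact_closedBall _ _
  have : IsFiniteMeasure (volume.restrict B) := ⟨by simpa using hBc.measure_lt_top⟩
  have hw2 : MemLp (B.indicator w) 2 volume :=
    (memLp_indicator_iff_restrict hBm).2 (hw.memLp B hR hBc)
  have hg2 : MemLp (B.indicator g) 2 volume :=
    (memLp_indicator_iff_restrict hBm).2 (hw.memLp_grad B hR hBc)
  have hwi : Integrable (B.indicator w) :=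
    (integrable_indicator_iff hBm).2 ((hw.memLp B hR hBc).integrable (by norm_num))
  have hgi : Integrable (B.indicator g) :=
    (integrable_indicator_iff hBm).2 ((hw.memLp_grad B hR hBc).integrable (by norm_num))
  -- The denominator is `k + 2` rather than `k + 1` so that the radius is strictly less than `R - r`
  -- already at `k = 0`.
  have hε : ∀ k : ℕ, 0 < (R - r) / (k + 2) := fun k => div_pos (by linarith) (by positivity)
  let φ : ℕ → ContDiffBump (0 : EuclideanSpace ℝ (Fin n)) := fun k =>
    ⟨(R - r) / (k + 2) / 2, (R - r) / (k + 2), half_pos (hε k), half_lt_self (hε k)⟩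
  have hφ : Tendsto (fun k => (φ k).rOut) atTop (𝓝 0) := by
    have : Tendsto (fun k : ℕ => (k : ℝ) + 2) atTop atTop :=
      tendsto_atTop_add_const_right _ _ tendsto_natCast_atTop_atTop
    exact tendsto_const_nhds.div_atTop this
  have hφR : ∀ k, (φ k).rOut < R - r := fun k =>
    div_lt_self (by linarith) (by linarith [(Nat.cast_nonneg k : (0:ℝ) ≤ k)])
  have hsub : closedBall x₀ r ⊆ B := closedBall_subset_closedBall hrR.le
  refine ⟨fun k => convolution ((φ k).normed volume) (B.indicator w)
    (ContinuousLinearMap.lsmul ℝ ℝ) volume, fun k => ?_, ?_, ?_⟩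
  · exact (φ k).hasCompactSupport_normed.contDiff_convolution_left _ (φ k).contDiff_normed
      hwi.locallyIntegrable
  · refine tendsto_of_tendsto_of_tendsto_of_le_of_le tendsto_const_nhds
      (tendsto_eLpNorm_convolution_sub hφ hw2) (fun _ => zero_le) fun k => ?_
    refine le_trans (le_of_eq (eLpNorm_congr_ae ?_)) (eLpNorm_mono_measure _ Measure.restrict_le_self)
    filter_upwards [ae_restrict_mem isClosed_closedBall.measurableSet] with x hx
    simp [hsub hx]
  · refine tendsto_of_tendsto_of_tendsto_of_le_of_le tendsto_const_nhds
      (tendsto_eLpNorm_convolution_sub hφ hg2) (fun _ => zero_le) fun k => ?_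
    refine le_trans (le_of_eq (eLpNorm_congr_ae ?_)) (eLpNorm_mono_measure _ Measure.restrict_le_self)
    filter_upwards [ae_restrict_mem isClosed_closedBall.measurableSet] with x hx
    rw [gradient_convolution hw.weakGrad hR hx (hφR k) hwi hgi]
    simp [hsub hx]
    rfl


/-! ### Radial cutoffs and integration over spherical layers. -/

/-- `χ` is smooth and vanishes outside `(r₁, r₂)`. -/
structure IsWeight (r₁ r₂ : ℝ) (χ : ℝ → ℝ) : Prop where
  smooth : ContDiff ℝ ∞ χ
  eq_zero_left : ∀ t ≤ r₁, χ t = 0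
  eq_zero_right : ∀ t, r₂ ≤ t → χ t = 0

/-- The radial cutoff `x ↦ ∫_{|x - x₀|}^{r₂} χ`. -/
noncomputable def radialCutoff {n : ℕ} (x₀ : EuclideanSpace ℝ (Fin n)) (r₂ : ℝ) (χ : ℝ → ℝ)
    (x : EuclideanSpace ℝ (Fin n)) : ℝ :=
  ∫ t in ‖x - x₀‖..r₂, χ t

/-- The annulus `{r₁ ≤ |x - x₀| < r₂}`. -/
def annulus {n : ℕ} (x₀ : EuclideanSpace ℝ (Fin n)) (r₁ r₂ : ℝ) :
    Set (EuclideanSpace ℝ (Fin n)) :=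
  ball x₀ r₂ \ ball x₀ r₁

section
variable {n : ℕ} {x₀ : EuclideanSpace ℝ (Fin n)} {r₁ r₂ : ℝ} {χ : ℝ → ℝ}

theorem measurableSet_annulus : MeasurableSet (annulus x₀ r₁ r₂) :=
  measurableSet_ball.diff measurableSet_ball

theorem mem_annulus {x : EuclideanSpace ℝ (Fin n)} :
    x ∈ annulus x₀ r₁ r₂ ↔ r₁ ≤ ‖x - x₀‖ ∧ ‖x - x₀‖ < r₂ := by
  simp [annulus, dist_eq_norm, and_comm]

theorem IsWeight.radialCutoff_eq_zero (hχ : IsWeight r₁ r₂ χ) {x : EuclideanSpace ℝ (Fin n)}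
    (hx : r₂ ≤ ‖x - x₀‖) : radialCutoff x₀ r₂ χ x = 0 := by
  rw [radialCutoff, intervalIntegral.integral_congr (g := fun _ => 0)]
  · simp
  · intro t ht
    rw [Set.uIcc_of_ge hx] at ht
    exact hχ.eq_zero_right t ht.1

/-- Near the centre the weight vanishes and the cutoff is constant, so the singularity of the norm
does no harm; the formula stays valid at `x₀` because there `χ` is zero. Elsewhere it is the chain
rule. -/
theorem IsWeight.hasFDerivAt_radialCutoff (hχ : IsWeight r₁ r₂ χ) (h₁ : 0 < r₁)
    (x : EuclideanSpace ℝ (Fin n)) :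
    HasFDerivAt (radialCutoff x₀ r₂ χ)
      (-(χ ‖x - x₀‖ / ‖x - x₀‖) • innerSL ℝ (x - x₀)) x := by
  have hc := hχ.smooth.continuous
  have hd : ∀ s, HasDerivAt (fun s => ∫ t in s..r₂, χ t) (-χ s) s := fun s =>
    intervalIntegral.integral_hasDerivAt_left (hc.intervalIntegrable _ _)
      hc.stronglyMeasurable.stronglyMeasurableAtFilter hc.continuousAt
  by_cases hx : x - x₀ = 0
  · have h0 : χ ‖x - x₀‖ = 0 := hχ.eq_zero_left _ (by simp [hx, h₁.le])
    rw [h0]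
    have hev : radialCutoff x₀ r₂ χ =ᶠ[𝓝 x] fun _ => ∫ t in r₁..r₂, χ t := by
      have : ball x₀ r₁ ∈ 𝓝 x := isOpen_ball.mem_nhds (by simp [sub_eq_zero.1 hx, h₁])
      filter_upwards [this] with y hy
      rw [mem_ball, dist_eq_norm] at hy
      rw [radialCutoff, ← intervalIntegral.integral_add_adjacent_intervals
        (hc.intervalIntegrable ‖y - x₀‖ r₁) (hc.intervalIntegrable r₁ r₂),
        intervalIntegral.integral_congr (g := fun _ => 0)]
      · simp
      · intro t ht
        rw [Set.uIcc_of_le hy.le] at ht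
        exact hχ.eq_zero_left t ht.2
    simpa using (hasFDerivAt_const (∫ t in r₁..r₂, χ t) x).congr_of_eventuallyEq hev
  · have hn : HasFDerivAt (fun y => ‖y - x₀‖) (‖x - x₀‖⁻¹ • innerSL ℝ (x - x₀)) x := by
      have h1 : HasFDerivAt (fun y : EuclideanSpace ℝ (Fin n) => y - x₀)
        (ContinuousLinearMap.id ℝ _) x := (hasFDerivAt_id x).sub_const x₀
      have h2 := (h1.norm_sq).sqrt (by simpa using hx)
      simp only [Real.sqrt_sq (norm_nonneg _)] at h2
      refine h2.congr_fderiv ?_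
      ext v
      simp only [smul_apply, ContinuousLinearMap.comp_apply,
        ContinuousLinearMap.id_apply, smul_eq_mul, nsmul_eq_mul]
      push_cast
      field_simp
    have := (hd ‖x - x₀‖).comp_hasFDerivAt x hn
    refine this.congr_fderiv ?_
    ext v
    simp
    ring

theorem IsWeight.fderiv_radialCutoff (hχ : IsWeight r₁ r₂ χ) (h₁ : 0 < r₁)
    (x v : EuclideanSpace ℝ (Fin n)) :
    fderiv ℝ (radialCutoff x₀ r₂ χ) x v = -(χ ‖x - x₀‖ / ‖x - x₀‖ * inner ℝ (x - x₀) v) := by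
  rw [(hχ.hasFDerivAt_radialCutoff h₁ x).fderiv, smul_apply, smul_eq_mul,
    innerSL_apply_apply, neg_mul]

theorem IsWeight.contDiff_radialCutoff (hχ : IsWeight r₁ r₂ χ) (h₁ : 0 < r₁) :
    ContDiff ℝ ∞ (radialCutoff x₀ r₂ χ) := by
  have hη : ContDiff ℝ ∞ (fun s => ∫ t in s..r₂, χ t) := by
    have hc := hχ.smooth.continuous
    have hd : ∀ s, HasDerivAt (fun s => ∫ t in s..r₂, χ t) (-χ s) s := fun s =>
      intervalIntegral.integral_hasDerivAt_left (hc.intervalIntegrable _ _)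
        hc.stronglyMeasurable.stronglyMeasurableAtFilter hc.continuousAt
    rw [contDiff_infty_iff_deriv]
    refine ⟨fun s => (hd s).differentiableAt, ?_⟩
    rw [show deriv (fun s => ∫ t in s..r₂, χ t) = fun s => -χ s from funext fun s => (hd s).deriv]
    exact hχ.smooth.neg
  rw [contDiff_iff_contDiffAt]
  intro x
  by_cases hx : x - x₀ = 0
  · have hev : radialCutoff x₀ r₂ χ =ᶠ[𝓝 x] fun _ => ∫ t in r₁..r₂, χ t := by
      have hc := hχ.smooth.continuous
      have : ball x₀ r₁ ∈ 𝓝 x := isOpen_ball.mem_nhds (by simp [sub_eq_zero.1 hx, h₁])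
      filter_upwards [this] with y hy
      rw [mem_ball, dist_eq_norm] at hy
      rw [radialCutoff, ← intervalIntegral.integral_add_adjacent_intervals
        (hc.intervalIntegrable ‖y - x₀‖ r₁) (hc.intervalIntegrable r₁ r₂),
        intervalIntegral.integral_congr (g := fun _ => 0)]
      · simp
      · intro t ht
        rw [Set.uIcc_of_le hy.le] at ht
        exact hχ.eq_zero_left t ht.2
    exact contDiffAt_const.congr_of_eventuallyEq hev
  · exact hη.contDiffAt.comp x ((contDiffAt_id.sub contDiffAt_const).norm ℝ hx)

theorem IsWeight.tsupport_radialCutoff (hχ : IsWeight r₁ r₂ χ) :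
    tsupport (radialCutoff x₀ r₂ χ) ⊆ closedBall x₀ r₂ := by
  refine closure_minimal (fun x hx => ?_) isClosed_closedBall
  by_contra h
  rw [mem_closedBall, dist_eq_norm, not_le] at h
  exact hx (hχ.radialCutoff_eq_zero h.le)

theorem IsWeight.hasCompactSupport_radialCutoff (hχ : IsWeight r₁ r₂ χ) :
    HasCompactSupport (radialCutoff x₀ r₂ χ) :=
  HasCompactSupport.of_support_subset_isCompact (isCompact_closedBall x₀ r₂)
    ((subset_tsupport _).trans hχ.tsupport_radialCutoff)

/-- Fubini's theorem for radial layers. -/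
theorem intervalIntegral_mul_setIntegral_ball (h : r₁ ≤ r₂)
    (hχ : IntervalIntegrable χ volume r₁ r₂)
    {g : EuclideanSpace ℝ (Fin n) → ℝ} (hg : IntegrableOn g (ball x₀ r₂)) :
    ∫ t in r₁..r₂, χ t * ∫ x in ball x₀ t, g x
      = ∫ x in ball x₀ r₂, (∫ t in (max r₁ ‖x - x₀‖)..r₂, χ t) * g x := by
  have hχi : Integrable χ (volume.restrict (Set.Ioc r₁ r₂)) :=
    (intervalIntegrable_iff_integrableOn_Ioc_of_le h).1 hχ
  set S : Set (ℝ × EuclideanSpace ℝ (Fin n)) := {p | ‖p.2 - x₀‖ < p.1} with hS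
  have hSm : MeasurableSet S := by
    have : IsOpen S := isOpen_lt (by fun_prop) (by fun_prop)
    exact this.measurableSet
  have hint : Integrable (S.indicator fun p => χ p.1 * g p.2)
      ((volume.restrict (Set.Ioc r₁ r₂)).prod (volume.restrict (ball x₀ r₂))) :=
    (hχi.mul_prod hg).indicator hSm
  rw [intervalIntegral.integral_of_le h]
  calc _ = ∫ t in Set.Ioc r₁ r₂, ∫ x in ball x₀ r₂, S.indicator (fun p => χ p.1 * g p.2) (t, x) := by
        refine setIntegral_congr_fun measurableSet_Ioc fun t ht => ?_
        have : (fun x => S.indicator (fun p => χ p.1 * g p.2) (t, x))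
            = (ball x₀ t).indicator fun x => χ t * g x := by
          ext x
          simp only [Set.indicator, hS, Set.mem_ofPred_eq, mem_ball, dist_eq_norm]
        simp only [this]
        rw [setIntegral_indicator measurableSet_ball,
          Set.inter_eq_self_of_subset_right (ball_subset_ball ht.2), integral_const_mul]
    _ = ∫ x in ball x₀ r₂, ∫ t in Set.Ioc r₁ r₂, S.indicator (fun p => χ p.1 * g p.2) (t, x) :=
        integral_integral_swap hint
    _ = _ := by
        refine setIntegral_congr_fun measurableSet_ball fun x hx => ?_
        rw [mem_ball, dist_eq_norm] at hx
        have hm : max r₁ ‖x - x₀‖ ≤ r₂ := max_le h hx.le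
        have : (fun t => S.indicator (fun p => χ p.1 * g p.2) (t, x))
            = (Set.Ioi ‖x - x₀‖).indicator fun t => χ t * g x := by
          ext t
          simp only [Set.indicator, hS, Set.mem_ofPred_eq, Set.mem_Ioi]
        simp only [this]
        rw [setIntegral_indicator measurableSet_Ioi, Set.Ioc_inter_Ioi, integral_mul_const,
          intervalIntegral.integral_of_le hm]

/-- This converts an identity tested with radial cutoffs into one weighted by `χ` over radii. Since
`χ` vanishes below `r₁`, the truncation `max r₁ ‖x - x₀‖` in Fubini's formula changes nothing. -/
theorem IsWeight.setIntegral_radialCutoff_mul (hχ : IsWeight r₁ r₂ χ) (h : r₁ ≤ r₂)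
    {g : EuclideanSpace ℝ (Fin n) → ℝ} (hg : IntegrableOn g (ball x₀ r₂)) :
    ∫ x in ball x₀ r₂, radialCutoff x₀ r₂ χ x * g x
      = ∫ t in r₁..r₂, χ t * ∫ x in ball x₀ t, g x := by
  have hc := hχ.smooth.continuous
  rw [intervalIntegral_mul_setIntegral_ball h (hc.intervalIntegrable _ _) hg]
  refine setIntegral_congr_fun measurableSet_ball fun x hx => ?_
  simp only [radialCutoff]
  congr 1
  rcases le_total r₁ ‖x - x₀‖ with hx | hx
  · rw [max_eq_right hx]
  · rw [max_eq_left hx, ← intervalIntegral.integral_add_adjacent_intervals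
        (hc.intervalIntegrable ‖x - x₀‖ r₁) (hc.intervalIntegrable r₁ r₂),
        intervalIntegral.integral_congr (g := fun _ => 0)]
    · simp
    · intro t ht
      rw [Set.uIcc_of_le hx] at ht
      exact hχ.eq_zero_left t ht.2

theorem integrableOn_annulus_radial_mul {w : ℝ → ℝ} (hw : ContinuousOn w (Set.Icc r₁ r₂))
    {g : EuclideanSpace ℝ (Fin n) → ℝ} (hg : IntegrableOn g (annulus x₀ r₁ r₂)) :
    IntegrableOn (fun x => w ‖x - x₀‖ * g x) (annulus x₀ r₁ r₂) := by
  obtain ⟨C, hC⟩ := isCompact_Icc.exists_bound_of_continuousOn hw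
  refine Integrable.bdd_mul (c := C) hg ?_ ?_
  · have : ContinuousOn (fun x => w ‖x - x₀‖) (annulus x₀ r₁ r₂) :=
      hw.comp (by fun_prop) fun x hx => ⟨(mem_annulus.1 hx).1, (mem_annulus.1 hx).2.le⟩
    exact this.aestronglyMeasurable measurableSet_annulus
  · filter_upwards [ae_restrict_mem measurableSet_annulus] with x hx
    exact hC _ ⟨(mem_annulus.1 hx).1, (mem_annulus.1 hx).2.le⟩

/-- The product rule for `w(r) ∫_{B_r} g` in integrated form. The derivative of `r ↦ ∫_{B_r} g`
would be a sphere integral; it appears only integrated against `w`, as the annulus term, so mere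
integrability of `g` suffices. -/
theorem mul_setIntegral_ball_sub {w w' : ℝ → ℝ} (h : r₁ ≤ r₂)
    (hw : ∀ t ∈ Set.Icc r₁ r₂, HasDerivAt w (w' t) t) (hw' : ContinuousOn w' (Set.Icc r₁ r₂))
    {g : EuclideanSpace ℝ (Fin n) → ℝ} (hg : IntegrableOn g (ball x₀ r₂)) :
    w r₂ * (∫ x in ball x₀ r₂, g x) - w r₁ * (∫ x in ball x₀ r₁, g x)
      = (∫ t in r₁..r₂, w' t * ∫ x in ball x₀ t, g x)
        + ∫ x in annulus x₀ r₁ r₂, w ‖x - x₀‖ * g x := by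
  have hwc : ContinuousOn w (Set.Icc r₁ r₂) := fun t ht => (hw t ht).continuousAt.continuousWithinAt
  have hi : IntervalIntegrable w' volume r₁ r₂ := by
    apply ContinuousOn.intervalIntegrable
    rwa [Set.uIcc_of_le h]
  have hsub : ball x₀ r₁ ⊆ ball x₀ r₂ := ball_subset_ball h
  have hu : ball x₀ r₂ = ball x₀ r₁ ∪ annulus x₀ r₁ r₂ := (Set.union_sdiff_cancel hsub).symm
  have hd : Disjoint (ball x₀ r₁) (annulus x₀ r₁ r₂) := Set.disjoint_sdiff_right
  have hga : IntegrableOn g (annulus x₀ r₁ r₂) := hg.mono_set Set.sdiff_subset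
  have e1 : Set.EqOn (fun x => (∫ t in (max r₁ ‖x - x₀‖)..r₂, w' t) * g x)
      (fun x => (w r₂ - w r₁) * g x) (ball x₀ r₁) := fun x hx => by
    rw [mem_ball, dist_eq_norm] at hx
    simp only
    rw [max_eq_left hx.le, intervalIntegral.integral_eq_sub_of_hasDerivAt _ hi]
    rwa [Set.uIcc_of_le h]
  have e2 : Set.EqOn (fun x => (∫ t in (max r₁ ‖x - x₀‖)..r₂, w' t) * g x)
      (fun x => w r₂ * g x - w ‖x - x₀‖ * g x) (annulus x₀ r₁ r₂) := fun x hx => by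
    obtain ⟨h1, h2⟩ := mem_annulus.1 hx
    simp only
    rw [max_eq_right h1, intervalIntegral.integral_eq_sub_of_hasDerivAt, sub_mul]
    · intro t ht
      rw [Set.uIcc_of_le h2.le] at ht
      exact hw t ⟨h1.trans ht.1, ht.2⟩
    · refine hi.mono_set ?_
      rw [Set.uIcc_of_le h2.le, Set.uIcc_of_le h]
      exact Set.Icc_subset_Icc_left h1
  have hwg := integrableOn_annulus_radial_mul hwc hga
  have i1 : IntegrableOn (fun x => (w r₂ - w r₁) * g x) (ball x₀ r₁) :=
    (hg.mono_set hsub).const_mul _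
  have i2 : IntegrableOn (fun x => w r₂ * g x - w ‖x - x₀‖ * g x) (annulus x₀ r₁ r₂) :=
    (hga.const_mul _).sub hwg
  rw [intervalIntegral_mul_setIntegral_ball h hi hg]
  nth_rw 2 [hu]
  rw [setIntegral_union hd measurableSet_annulus
      (i1.congr_fun e1.symm measurableSet_ball) (i2.congr_fun e2.symm measurableSet_annulus),
    setIntegral_congr_fun measurableSet_ball e1, setIntegral_congr_fun measurableSet_annulus e2,
    integral_const_mul, integral_sub (hga.const_mul _) hwg, integral_const_mul]
  nth_rw 1 [hu]
  rw [setIntegral_union hd measurableSet_annulus (hg.mono_set hsub) hga]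
  ring

theorem ae_norm_sub_ne (x₀ : EuclideanSpace ℝ (Fin n)) (hr : r₁ ≠ 0) :
    ∀ᵐ x : EuclideanSpace ℝ (Fin n), ‖x - x₀‖ ≠ r₁ := by
  have : volume (sphere x₀ r₁) = 0 := Measure.addHaar_sphere_of_ne_zero _ _ hr
  rw [ae_iff]
  convert this using 2
  ext x
  simp

theorem aestronglyMeasurable_setIntegral_ball {a : EuclideanSpace ℝ (Fin n) → ℝ}
    (ha : IntegrableOn a (ball x₀ r₂)) :
    AEStronglyMeasurable (fun t => ∫ x in ball x₀ t, a x) (volume.restrict (Set.Ioc r₁ r₂)) := by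
  set S : Set (ℝ × EuclideanSpace ℝ (Fin n)) := {p | ‖p.2 - x₀‖ < p.1} with hS
  have hSm : MeasurableSet S := by
    have : IsOpen S := isOpen_lt (by fun_prop) (by fun_prop)
    exact this.measurableSet
  have hint : AEStronglyMeasurable (S.indicator fun p => a p.2)
      ((volume.restrict (Set.Ioc r₁ r₂)).prod (volume.restrict (ball x₀ r₂))) :=
    (ha.aestronglyMeasurable.comp_snd).indicator hSm
  refine hint.integral_prod_right'.congr ?_
  filter_upwards [ae_restrict_mem measurableSet_Ioc] with t ht
  have : (fun x => S.indicator (fun p => a p.2) (t, x)) = (ball x₀ t).indicator a := by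
    ext x
    simp only [Set.indicator, hS, Set.mem_ofPred_eq, mem_ball, dist_eq_norm]
  rw [this, setIntegral_indicator measurableSet_ball,
    Set.inter_eq_self_of_subset_right (ball_subset_ball ht.2)]

theorem norm_setIntegral_ball_le {a : EuclideanSpace ℝ (Fin n) → ℝ}
    (ha : IntegrableOn a (ball x₀ r₂)) {t : ℝ} (ht : t ≤ r₂) :
    ‖∫ x in ball x₀ t, a x‖ ≤ ∫ x in ball x₀ r₂, ‖a x‖ :=
  (norm_integral_le_integral_norm _).trans (setIntegral_mono_set ha.norm
    (ae_of_all _ fun _ => norm_nonneg _) (ball_subset_ball ht).eventuallyLE)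

theorem intervalIntegrable_mul_setIntegral_ball (h : r₁ ≤ r₂) {w : ℝ → ℝ}
    (hw : ContinuousOn w (Set.Icc r₁ r₂)) {a : EuclideanSpace ℝ (Fin n) → ℝ}
    (ha : IntegrableOn a (ball x₀ r₂)) :
    IntervalIntegrable (fun t => w t * ∫ x in ball x₀ t, a x) volume r₁ r₂ := by
  rw [intervalIntegrable_iff_integrableOn_Ioc_of_le h]
  have hwi : IntegrableOn w (Set.Ioc r₁ r₂) :=
    (hw.integrableOn_compact isCompact_Icc).mono_set Set.Ioc_subset_Icc_self
  refine Integrable.mul_bdd (c := ∫ x in ball x₀ r₂, ‖a x‖) hwi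
    (aestronglyMeasurable_setIntegral_ball ha) ?_
  filter_upwards [ae_restrict_mem measurableSet_Ioc] with t ht
  exact norm_setIntegral_ball_le ha ht.2

/-- An identity tested with all smooth weights localizes to an annulus. -/
theorem intervalIntegral_eq_setIntegral_annulus (h₁ : 0 < r₁) (h : r₁ ≤ r₂)
    {a c : EuclideanSpace ℝ (Fin n) → ℝ} (ha : IntegrableOn a (ball x₀ r₂))
    (hc : IntegrableOn c (ball x₀ r₂))
    (hac : ∀ χ, IsWeight r₁ r₂ χ →
      ∫ x in ball x₀ r₂, radialCutoff x₀ r₂ χ x * a x = ∫ x in ball x₀ r₂, χ ‖x - x₀‖ * c x)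
    {w : ℝ → ℝ} (hw : ∀ t, 0 < t → ContDiffAt ℝ ∞ w t) :
    ∫ t in r₁..r₂, w t * ∫ x in ball x₀ t, a x
      = ∫ x in annulus x₀ r₁ r₂, w ‖x - x₀‖ * c x := by
  -- Smooth functions with values in `[0, 1]` that vanish outside `(r₁, r₂)` and tend to `1`
  -- pointwise inside. The products `τ j * w` are admissible weights, and dominated convergence
  -- removes `τ` on both sides.
  let τ : ℕ → ℝ → ℝ := fun j t =>
    Real.smoothTransition (j * (t - r₁)) * Real.smoothTransition (j * (r₂ - t))
  have hwc : ContinuousOn w (Set.Icc r₁ r₂) := fun t ht =>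
    (hw t (h₁.trans_le ht.1)).continuousAt.continuousWithinAt
  obtain ⟨C, hC⟩ := isCompact_Icc.exists_bound_of_continuousOn hwc
  have hτ0 : ∀ j t, t ∉ Set.Ioo r₁ r₂ → τ j t = 0 := by
    intro j t ht
    rcases le_or_gt t r₁ with h' | h'
    · have : Real.smoothTransition (j * (t - r₁)) = 0 := Real.smoothTransition.zero_of_nonpos
        (mul_nonpos_of_nonneg_of_nonpos (Nat.cast_nonneg _) (by linarith))
      simp [τ, this]
    · have h'' : r₂ ≤ t := by
        by_contra hh
        exact ht ⟨h', not_le.1 hh⟩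
      have : Real.smoothTransition (j * (r₂ - t)) = 0 := Real.smoothTransition.zero_of_nonpos
        (mul_nonpos_of_nonneg_of_nonpos (Nat.cast_nonneg _) (by linarith))
      simp [τ, this]
  have hτb : ∀ j t, |τ j t| ≤ 1 := by
    intro j t
    rw [abs_of_nonneg (mul_nonneg (Real.smoothTransition.nonneg _) (Real.smoothTransition.nonneg _))]
    exact mul_le_one₀ (Real.smoothTransition.le_one _) (Real.smoothTransition.nonneg _)
      (Real.smoothTransition.le_one _)
  have hτs : ∀ j, ContDiff ℝ ∞ (τ j) := by
    intro j
    refine ContDiff.mul ?_ ?_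
    · exact Real.smoothTransition.contDiff.comp
        (contDiff_const.mul (contDiff_id.sub contDiff_const))
    · exact Real.smoothTransition.contDiff.comp
        (contDiff_const.mul (contDiff_const.sub contDiff_id))
  have hτ1 : ∀ t ∈ Set.Ioo r₁ r₂, ∀ᶠ j in atTop, τ j t = 1 := by
    intro t ht
    have e : ∀ d : ℝ, 0 < d → ∀ᶠ j : ℕ in atTop, Real.smoothTransition (j * d) = 1 := by
      intro d hd
      have : Tendsto (fun j : ℕ => (j : ℝ) * d) atTop atTop :=
        tendsto_natCast_atTop_atTop.atTop_mul_const hd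
      filter_upwards [this.eventually_ge_atTop 1] with j hj
      exact Real.smoothTransition.one_of_one_le hj
    filter_upwards [e _ (sub_pos.2 ht.1), e _ (sub_pos.2 ht.2)] with j h1 h2
    simp [τ, h1, h2]
  have hχs : ∀ j, IsWeight r₁ r₂ fun t => τ j t * w t := by
    intro j
    refine ⟨?_, fun t ht => by simp [hτ0 j t fun h' => not_lt.2 ht h'.1],
      fun t ht => by simp [hτ0 j t fun h' => not_lt.2 ht h'.2]⟩
    rw [contDiff_iff_contDiffAt]
    intro t
    rcases lt_or_ge 0 t with ht | ht
    · exact (hτs j).contDiffAt.mul (hw t ht)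
    · have : (fun t => τ j t * w t) =ᶠ[𝓝 t] fun _ => 0 := by
        filter_upwards [Iio_mem_nhds (ht.trans_lt h₁)] with s hs
        simp [hτ0 j s fun h' => lt_asymm hs h'.1]
      exact contDiffAt_const.congr_of_eventuallyEq this
  have hχb : ∀ j t, ‖τ j t * w t‖ ≤ max C 0 := by
    intro j t
    by_cases ht : t ∈ Set.Ioo r₁ r₂
    · rw [norm_mul]
      calc _ ≤ 1 * C := mul_le_mul (hτb j t) (hC t ⟨ht.1.le, ht.2.le⟩) (norm_nonneg _) zero_le_one
        _ ≤ _ := by rw [one_mul]; exact le_max_left _ _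
    · simp [hτ0 j t ht]
  set I : ℝ → ℝ := fun t => ∫ x in ball x₀ t, a x
  have hIb : ∀ t ∈ Set.Icc r₁ r₂, ‖I t‖ ≤ ∫ x in ball x₀ r₂, ‖a x‖ := fun t ht =>
    norm_setIntegral_ball_le ha ht.2
  have hIm : AEStronglyMeasurable I (volume.restrict (Set.Ioc r₁ r₂)) :=
    aestronglyMeasurable_setIntegral_ball ha
  have heq : ∀ j, ∫ t in r₁..r₂, (τ j t * w t) * I t
      = ∫ x in ball x₀ r₂, (τ j ‖x - x₀‖ * w ‖x - x₀‖) * c x := fun j => by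
    rw [← hac _ (hχs j), (hχs j).setIntegral_radialCutoff_mul h ha]
  have hlim1 : Tendsto (fun j => ∫ t in r₁..r₂, (τ j t * w t) * I t) atTop
      (𝓝 (∫ t in r₁..r₂, w t * I t)) := by
    simp only [intervalIntegral.integral_of_le h]
    refine tendsto_integral_of_dominated_convergence
      (fun _ => max C 0 * ∫ x in ball x₀ r₂, ‖a x‖) (fun j => ?_) ?_ (fun j => ?_) ?_
    · exact (hχs j).smooth.continuous.aestronglyMeasurable.mul hIm
    · exact integrable_const _
    · filter_upwards [ae_restrict_mem measurableSet_Ioc] with t ht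
      rw [norm_mul]
      exact mul_le_mul (hχb j t) (hIb t ⟨ht.1.le, ht.2⟩) (norm_nonneg _) (le_max_right _ _)
    · have hne : ∀ᵐ t : ℝ, t ≠ r₂ := by simp [ae_iff]
      filter_upwards [ae_restrict_mem measurableSet_Ioc, ae_restrict_of_ae hne] with t ht hne
      refine tendsto_const_nhds.congr' ?_
      filter_upwards [hτ1 t ⟨ht.1, lt_of_le_of_ne ht.2 hne⟩] with j hj
      rw [hj, one_mul]
  have hlim2 : Tendsto (fun j => ∫ x in ball x₀ r₂, (τ j ‖x - x₀‖ * w ‖x - x₀‖) * c x) atTop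
      (𝓝 (∫ x in ball x₀ r₂, (annulus x₀ r₁ r₂).indicator (fun x => w ‖x - x₀‖ * c x) x)) := by
    refine tendsto_integral_of_dominated_convergence
      (fun x => max C 0 * ‖c x‖) (fun j => ?_) ?_ (fun j => ?_) ?_
    · have : Continuous fun x : EuclideanSpace ℝ (Fin n) => τ j ‖x - x₀‖ * w ‖x - x₀‖ :=
        (hχs j).smooth.continuous.comp (by fun_prop)
      exact this.aestronglyMeasurable.mul hc.aestronglyMeasurable
    · exact hc.norm.const_mul _
    · refine ae_of_all _ fun x => ?_
      rw [norm_mul]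
      exact mul_le_mul_of_nonneg_right (hχb j _) (norm_nonneg _)
    -- The sphere of radius `r₁` must be discarded: it belongs to the annulus, while `τ j` vanishes
    -- on it for every `j`.
    · filter_upwards [ae_restrict_mem measurableSet_ball, ae_restrict_of_ae (ae_norm_sub_ne x₀ h₁.ne')]
        with x hx hne
      rw [mem_ball, dist_eq_norm] at hx
      rcases lt_or_ge ‖x - x₀‖ r₁ with hx1 | hx1
      · rw [Set.indicator_of_notMem (fun h' => not_le.2 hx1 (mem_annulus.1 h').1)]
        refine tendsto_const_nhds.congr fun j => ?_
        rw [hτ0 j _ fun h' => lt_asymm hx1 h'.1, zero_mul, zero_mul]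
      · rw [Set.indicator_of_mem (mem_annulus.2 ⟨hx1, hx⟩)]
        refine tendsto_const_nhds.congr' ?_
        filter_upwards [hτ1 _ ⟨lt_of_le_of_ne hx1 hne.symm, hx⟩] with j hj
        rw [hj, one_mul]
  have := tendsto_nhds_unique hlim1 (hlim2.congr fun j => (heq j).symm)
  rw [this, setIntegral_indicator measurableSet_annulus,
    Set.inter_eq_self_of_subset_right (show annulus x₀ r₁ r₂ ⊆ ball x₀ r₂ from Set.sdiff_subset)]

end


/-! ### Radial derivatives and the radial domain variation. -/

/-- The radial derivative `∂_ν w = ∇w · (x - x₀) / |x - x₀|`, where `g = ∇w`. -/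
noncomputable def radialDeriv {n : ℕ} (x₀ : EuclideanSpace ℝ (Fin n))
    (g : EuclideanSpace ℝ (Fin n) → EuclideanSpace ℝ (Fin n)) (x : EuclideanSpace ℝ (Fin n)) : ℝ :=
  inner ℝ (x - x₀) (g x) / ‖x - x₀‖

theorem norm_mul_radialDeriv {n : ℕ} (x₀ : EuclideanSpace ℝ (Fin n))
    (g : EuclideanSpace ℝ (Fin n) → EuclideanSpace ℝ (Fin n)) (x : EuclideanSpace ℝ (Fin n)) :
    ‖x - x₀‖ * radialDeriv x₀ g x = inner ℝ (x - x₀) (g x) := by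
  rw [radialDeriv]
  by_cases h : x - x₀ = 0
  · simp [h]
  · field_simp

theorem MemLp.radialDeriv {n : ℕ} {x₀ : EuclideanSpace ℝ (Fin n)}
    {g : EuclideanSpace ℝ (Fin n) → EuclideanSpace ℝ (Fin n)}
    {μ : Measure (EuclideanSpace ℝ (Fin n))} (hg : MemLp g 2 μ) :
    MemLp (radialDeriv x₀ g) 2 μ := by
  refine hg.mono ?_ (ae_of_all _ fun x => ?_)
  · have h1 : AEStronglyMeasurable (fun x => inner ℝ (x - x₀) (g x)) μ :=
      (by fun_prop : Continuous fun x : EuclideanSpace ℝ (Fin n) =>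
        x - x₀).aestronglyMeasurable.inner hg.1
    have h2 : AEStronglyMeasurable (fun x : EuclideanSpace ℝ (Fin n) => ‖x - x₀‖) μ :=
      (by fun_prop : Continuous fun x : EuclideanSpace ℝ (Fin n) => ‖x - x₀‖).aestronglyMeasurable
    exact h1.div₀ h2
  · rw [BlowUp.radialDeriv, norm_div, norm_norm]
    exact div_le_of_le_mul₀ (norm_nonneg _) (norm_nonneg _)
      ((norm_inner_le_norm _ _).trans (le_of_eq (mul_comm _ _)))

theorem MemH1Loc.memLp_ball {n : ℕ} {Ω : Set (EuclideanSpace ℝ (Fin n))}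
    {w : EuclideanSpace ℝ (Fin n) → ℝ}
    {g : EuclideanSpace ℝ (Fin n) → EuclideanSpace ℝ (Fin n)} (hw : MemH1Loc Ω w g)
    {x₀ : EuclideanSpace ℝ (Fin n)} {r : ℝ} (hr : closedBall x₀ r ⊆ Ω) :
    MemLp w 2 (volume.restrict (ball x₀ r)) ∧ MemLp g 2 (volume.restrict (ball x₀ r)) :=
  ⟨(hw.memLp _ hr (isCompact_closedBall _ _)).mono_measure
    (Measure.restrict_mono ball_subset_closedBall le_rfl),
   (hw.memLp_grad _ hr (isCompact_closedBall _ _)).mono_measure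
    (Measure.restrict_mono ball_subset_closedBall le_rfl)⟩

/-- A continuous factor preserves integrability on balls. -/
theorem integrableOn_ball_continuous_mul {n : ℕ} {x₀ : EuclideanSpace ℝ (Fin n)} {r : ℝ}
    {η g : EuclideanSpace ℝ (Fin n) → ℝ} (hη : Continuous η) (hg : IntegrableOn g (ball x₀ r)) :
    IntegrableOn (fun x => η x * g x) (ball x₀ r) := by
  obtain ⟨C, hC⟩ := (isCompact_closedBall x₀ r).exists_bound_of_continuousOn hη.continuousOn
  refine Integrable.bdd_mul (c := C) hg hη.aestronglyMeasurable ?_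
  filter_upwards [ae_restrict_mem measurableSet_ball] with x hx
  exact hC x (ball_subset_closedBall hx)

theorem memLp_ball_continuous_mul {n : ℕ} {x₀ : EuclideanSpace ℝ (Fin n)} {r : ℝ}
    {η g : EuclideanSpace ℝ (Fin n) → ℝ} (hη : Continuous η)
    (hg : MemLp g 2 (volume.restrict (ball x₀ r))) :
    MemLp (fun x => η x * g x) 2 (volume.restrict (ball x₀ r)) := by
  obtain ⟨C, hC⟩ := (isCompact_closedBall x₀ r).exists_bound_of_continuousOn hη.continuousOn
  refine hg.of_le_mul (c := C) (hη.aestronglyMeasurable.mul hg.1) ?_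
  filter_upwards [ae_restrict_mem measurableSet_ball] with x hx
  rw [norm_mul]
  gcongr
  exact hC x (ball_subset_closedBall hx)

theorem LocallyIntegrableOn.integrableOn_ball {n : ℕ} {Ω : Set (EuclideanSpace ℝ (Fin n))}
    {f : EuclideanSpace ℝ (Fin n) → ℝ} (hf : LocallyIntegrableOn f Ω)
    {x₀ : EuclideanSpace ℝ (Fin n)} {r : ℝ} (hr : closedBall x₀ r ⊆ Ω) :
    IntegrableOn f (ball x₀ r) :=
  (hf.integrableOn_compact_subset hr (isCompact_closedBall _ _)).mono_set ball_subset_closedBall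

section
variable {n m : ℕ} {Ω : Set (EuclideanSpace ℝ (Fin n))} {F : EuclideanSpace ℝ (Fin m) → ℝ}
  {u : EuclideanSpace ℝ (Fin n) → EuclideanSpace ℝ (Fin m)}
  {G : Fin m → EuclideanSpace ℝ (Fin n) → EuclideanSpace ℝ (Fin n)}
  {x₀ : EuclideanSpace ℝ (Fin n)} {r r₁ r₂ : ℝ} {χ : ℝ → ℝ}

theorem IsVariationalSolution.integrableOn_gradSq (hu : IsVariationalSolution Ω F u G)
    (hr : closedBall x₀ r ⊆ Ω) : IntegrableOn (gradSq G) (ball x₀ r) :=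
  integrable_finsetSum _ fun i _ => ((hu.memH1Loc i).memLp_ball hr).2.integrable_norm_pow (by simp)

/-- The domain variation formula with a radial vector field. -/
theorem IsVariationalSolution.radial_domainVariation (hu : IsVariationalSolution Ω F u G)
    (h₁ : 0 < r₁) (hr : closedBall x₀ r₂ ⊆ Ω) (hχ : IsWeight r₁ r₂ χ) :
    ∫ x in ball x₀ r₂, radialCutoff x₀ r₂ χ x
        * (n * (gradSq G x - 2 * F (u x)) - 2 * gradSq G x)
      = ∫ x in ball x₀ r₂, χ ‖x - x₀‖ * (‖x - x₀‖ * ((gradSq G x - 2 * F (u x))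
        - 2 * ∑ i, radialDeriv x₀ (G i) x ^ 2)) := by
  set η := radialCutoff x₀ r₂ χ with hη
  have hηs : ContDiff ℝ ∞ η := hχ.contDiff_radialCutoff h₁
  have hχn : Continuous fun x : EuclideanSpace ℝ (Fin n) => χ ‖x - x₀‖ :=
    hχ.smooth.continuous.comp (by fun_prop)
  -- With `y = x - x₀`, the derivative of this field is `η Id - (χ(|y|)/|y|) y ⊗ y`. The trace gives
  -- the divergence `nη - χ|y|`, and the quadratic form splits into the full gradient weighted by
  -- `η` and the radial derivative weighted by `χ|y|`.
  set φ : EuclideanSpace ℝ (Fin n) → EuclideanSpace ℝ (Fin n) := fun x => η x • (x - x₀) with hφ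
  have hsupp : tsupport φ ⊆ tsupport η :=
    closure_mono fun x hx h0 => hx (by simp [hφ, h0])
  have htest : IsTestField Ω φ :=
    ⟨(hηs.of_le (by simp)).smul (contDiff_id.sub contDiff_const),
      hχ.hasCompactSupport_radialCutoff.mono' (subset_closure.trans hsupp),
      (hsupp.trans hχ.tsupport_radialCutoff).trans hr⟩
  have hfd : ∀ x v, fderiv ℝ φ x v = η x • v
      - (χ ‖x - x₀‖ / ‖x - x₀‖ * inner ℝ (x - x₀) v) • (x - x₀) := by
    intro x v
    have h1 : HasFDerivAt (fun y : EuclideanSpace ℝ (Fin n) => y - x₀)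
        (ContinuousLinearMap.id ℝ _) x := (hasFDerivAt_id x).sub_const x₀
    have h3 : HasFDerivAt φ _ x := (hχ.hasFDerivAt_radialCutoff (x₀ := x₀) h₁ x).smul h1
    rw [h3.fderiv]
    simp only [add_apply, neg_apply, smul_apply, ContinuousLinearMap.id_apply,
      ContinuousLinearMap.smulRight_apply, innerSL_apply_apply, smul_eq_mul, neg_smul]
    rw [← sub_eq_add_neg]
  have hdiv : ∀ x, divergence φ x = n * η x - χ ‖x - x₀‖ * ‖x - x₀‖ := by
    intro x
    have : ∀ j, (fderiv ℝ φ x (EuclideanSpace.single j 1)) j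
        = η x - χ ‖x - x₀‖ / ‖x - x₀‖ * ((x - x₀) j) ^ 2 := by
      intro j
      rw [hfd]
      simp [EuclideanSpace.inner_single_right]
      ring
    simp only [divergence, this]
    rw [Finset.sum_sub_distrib, ← Finset.mul_sum, ← EuclideanSpace.real_norm_sq_eq]
    by_cases h : ‖x - x₀‖ = 0
    · simp [h]
    · simp
      field_simp
  have hin : ∀ x i, inner ℝ (G i x) (fderiv ℝ φ x (G i x))
      = η x * ‖G i x‖ ^ 2 - χ ‖x - x₀‖ * ‖x - x₀‖ * radialDeriv x₀ (G i) x ^ 2 := by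
    intro x i
    rw [hfd, inner_sub_right, real_inner_smul_right, real_inner_smul_right,
      real_inner_self_eq_norm_sq, real_inner_comm (x - x₀), ← norm_mul_radialDeriv]
    by_cases h : ‖x - x₀‖ = 0
    · simp [h]
    · field_simp
  have hkey : ∀ x, (gradSq G x - 2 * F (u x)) * divergence φ x
      - 2 * ∑ i, inner ℝ (G i x) (fderiv ℝ φ x (G i x))
      = η x * (n * (gradSq G x - 2 * F (u x)) - 2 * gradSq G x)
        - χ ‖x - x₀‖ * (‖x - x₀‖ * ((gradSq G x - 2 * F (u x))
          - 2 * ∑ i, radialDeriv x₀ (G i) x ^ 2)) := by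
    intro x
    simp only [hdiv, hin, Finset.sum_sub_distrib, ← Finset.mul_sum]
    rw [gradSq]
    ring
  have hvan : ∀ x ∉ ball x₀ r₂, η x = 0 ∧ χ ‖x - x₀‖ = 0 := fun x hx => by
    rw [mem_ball, dist_eq_norm, not_lt] at hx
    exact ⟨hχ.radialCutoff_eq_zero hx, hχ.eq_zero_right _ hx⟩
  have hsub : ball x₀ r₂ ⊆ Ω := ball_subset_closedBall.trans hr
  have h0 := hu.domainVariation φ htest
  simp only [hkey] at h0
  rw [setIntegral_eq_integral_of_forall_compl_eq_zero (fun x hx => by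
      rw [(hvan x fun h => hx (hsub h)).1, (hvan x fun h => hx (hsub h)).2]; ring),
    ← setIntegral_eq_integral_of_forall_compl_eq_zero (s := ball x₀ r₂) (fun x hx => by
      rw [(hvan x hx).1, (hvan x hx).2]; ring)] at h0
  have hGi := hu.integrableOn_gradSq hr
  have hFi := LocallyIntegrableOn.integrableOn_ball hu.locInt_F hr
  have hei : IntegrableOn (fun x => gradSq G x - 2 * F (u x)) (ball x₀ r₂) :=
    hGi.sub (hFi.const_mul 2)
  have hN : IntegrableOn (fun x => ∑ i, radialDeriv x₀ (G i) x ^ 2) (ball x₀ r₂) :=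
    integrable_finsetSum _ fun i _ =>
      (MemLp.radialDeriv ((hu.memH1Loc i).memLp_ball hr).2).integrable_sq
  rw [integral_sub, sub_eq_zero] at h0
  · exact h0
  · exact integrableOn_ball_continuous_mul hηs.continuous ((hei.const_mul _).sub (hGi.const_mul 2))
  · exact integrableOn_ball_continuous_mul hχn
      (integrableOn_ball_continuous_mul (by fun_prop) (hei.sub (hN.const_mul 2)))

end

/-! ### Limits of `L²` pairings and the radial divergence theorem. -/

theorem tendsto_integral_norm_mul_norm {X V W : Type*} [MeasurableSpace X] {μ : Measure X}
    [NormedAddCommGroup V] [NormedAddCommGroup W] {f : ℕ → X → V} {h : X → W}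
    (hf : ∀ k, MemLp (f k) 2 μ) (hf0 : Tendsto (fun k => eLpNorm (f k) 2 μ) atTop (𝓝 0))
    (hh : MemLp h 2 μ) :
    Tendsto (fun k => ∫ x, ‖f k x‖ * ‖h x‖ ∂μ) atTop (𝓝 0) := by
  have hle : ∀ k, ∫ x, ‖f k x‖ * ‖h x‖ ∂μ ≤ (eLpNorm (f k) 2 μ).toReal * (eLpNorm h 2 μ).toReal := by
    intro k
    have := integral_mul_norm_le_Lp_mul_Lq (μ := μ) Real.HolderConjugate.two_two
      (f := fun x => ‖f k x‖) (g := fun x => ‖h x‖) (by simpa using (hf k).norm)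
      (by simpa using hh.norm)
    simp only [norm_norm] at this
    refine this.trans (le_of_eq ?_)
    rw [(hf k).eLpNorm_eq_integral_rpow_norm (by norm_num) (by norm_num),
      hh.eLpNorm_eq_integral_rpow_norm (by norm_num) (by norm_num),
      ENNReal.toReal_ofReal (by positivity), ENNReal.toReal_ofReal (by positivity)]
    norm_num
  refine squeeze_zero (fun k => by positivity) hle ?_
  have := ((ENNReal.tendsto_toReal ENNReal.zero_ne_top).comp hf0).mul_const (eLpNorm h 2 μ).toReal
  simpa using this

theorem tendsto_integral_inner {X V : Type*} [MeasurableSpace X] {μ : Measure X}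
    [NormedAddCommGroup V] [InnerProductSpace ℝ V] {f : ℕ → X → V} {f₀ h : X → V}
    (hf : ∀ k, MemLp (f k) 2 μ) (hf₀ : MemLp f₀ 2 μ)
    (hlim : Tendsto (fun k => eLpNorm (fun x => f k x - f₀ x) 2 μ) atTop (𝓝 0))
    (hh : MemLp h 2 μ) :
    Tendsto (fun k => ∫ x, inner ℝ (h x) (f k x) ∂μ) atTop (𝓝 (∫ x, inner ℝ (h x) (f₀ x) ∂μ)) := by
  rw [tendsto_iff_norm_sub_tendsto_zero]
  have h0 := tendsto_integral_norm_mul_norm (fun k => (hf k).sub hf₀) hlim hh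
  have hint : ∀ q : X → V, MemLp q 2 μ → Integrable (fun x => inner ℝ (h x) (q x)) μ := fun q hq =>
    ((hh.norm.integrable_mul hq.norm).mono (hh.1.inner hq.1) (ae_of_all _ fun x => by
      simpa using abs_real_inner_le_norm (h x) (q x)))
  refine squeeze_zero (fun k => norm_nonneg _) (fun k => ?_) h0
  rw [← integral_sub (hint _ (hf k)) (hint _ hf₀)]
  refine norm_integral_le_of_norm_le ?_ (ae_of_all _ fun x => ?_)
  · exact ((hf k).sub hf₀).norm.integrable_mul hh.norm
  · rw [← inner_sub_right, mul_comm]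
    exact abs_real_inner_le_norm _ _


theorem restrict_closedBall_eq {n : ℕ} (x₀ : EuclideanSpace ℝ (Fin n)) {r : ℝ} (hr : r ≠ 0) :
    volume.restrict (closedBall x₀ r) = volume.restrict (ball x₀ r) := by
  refine Measure.restrict_congr_set ?_
  filter_upwards [ae_norm_sub_ne x₀ hr] with x hx
  rw [← dist_eq_norm] at hx
  refine propext ⟨fun h => lt_of_le_of_ne h hx, fun h => le_of_lt h⟩

theorem memLp_ball_of_continuous {n : ℕ} {V : Type*} [NormedAddCommGroup V]
    {f : EuclideanSpace ℝ (Fin n) → V} (hf : Continuous f) (p : ℝ≥0∞)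
    (x₀ : EuclideanSpace ℝ (Fin n)) (r : ℝ) : MemLp f p (volume.restrict (ball x₀ r)) := by
  obtain ⟨C, hC⟩ := (isCompact_closedBall x₀ r).exists_bound_of_continuousOn hf.continuousOn
  have : IsFiniteMeasure (volume.restrict (ball x₀ r)) := ⟨by simpa using measure_ball_lt_top⟩
  refine MemLp.of_bound hf.aestronglyMeasurable C ?_
  filter_upwards [ae_restrict_mem measurableSet_ball] with x hx
  exact hC x (ball_subset_closedBall hx)

theorem inner_gradient {n : ℕ} (v : EuclideanSpace ℝ (Fin n) → ℝ) (x e : EuclideanSpace ℝ (Fin n)) :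
    inner ℝ (gradient v x) e = fderiv ℝ v x e := by
  simp [gradient]

theorem continuous_gradient {n : ℕ} {v : EuclideanSpace ℝ (Fin n) → ℝ} (hv : ContDiff ℝ ∞ v) :
    Continuous (gradient v) := by
  have := hv.continuous_fderiv (by simp)
  exact (InnerProductSpace.toDual ℝ (EuclideanSpace ℝ (Fin n))).symm.continuous.comp this

theorem integrable_mul_of_hasCompactSupport {n : ℕ} {w q : EuclideanSpace ℝ (Fin n) → ℝ}
    (hq : Continuous q) (hqc : HasCompactSupport q) (hw : IntegrableOn w (tsupport q)) :
    Integrable fun x => w x * q x := by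
  obtain ⟨C, hC⟩ := hqc.isCompact.exists_bound_of_continuousOn hq.continuousOn
  have h1 : IntegrableOn (fun x => w x * q x) (tsupport q) := by
    refine Integrable.mul_bdd (c := C) hw hq.aestronglyMeasurable ?_
    filter_upwards [ae_restrict_mem (isClosed_tsupport q).measurableSet] with x hx
    exact hC x hx
  rw [← integrableOn_univ]
  refine h1.of_forall_sdiff_eq_zero MeasurableSet.univ fun x hx => ?_
  rw [image_eq_zero_of_notMem_tsupport hx.2, mul_zero]

theorem MemH1Loc.integrableOn {n : ℕ} {Ω : Set (EuclideanSpace ℝ (Fin n))}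
    {w : EuclideanSpace ℝ (Fin n) → ℝ}
    {g : EuclideanSpace ℝ (Fin n) → EuclideanSpace ℝ (Fin n)} (hw : MemH1Loc Ω w g)
    {K : Set (EuclideanSpace ℝ (Fin n))} (hK : IsCompact K) (hKΩ : K ⊆ Ω) :
    IntegrableOn w K ∧ IntegrableOn g K := by
  have : IsFiniteMeasure (volume.restrict K) := ⟨by simpa using hK.measure_lt_top⟩
  exact ⟨(hw.memLp K hKΩ hK).integrable (by norm_num),
    (hw.memLp_grad K hKΩ hK).integrable (by norm_num)⟩

/-- The weak gradient tested with the vector field `p(x) (x - x₀)`. -/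
theorem MemH1Loc.integral_radial_test {n : ℕ} {Ω : Set (EuclideanSpace ℝ (Fin n))}
    {w : EuclideanSpace ℝ (Fin n) → ℝ}
    {g : EuclideanSpace ℝ (Fin n) → EuclideanSpace ℝ (Fin n)} (hw : MemH1Loc Ω w g)
    (x₀ : EuclideanSpace ℝ (Fin n)) {p : EuclideanSpace ℝ (Fin n) → ℝ} (hp : IsTestFunction Ω p) :
    ∫ x, w x * (fderiv ℝ p x (x - x₀) + n * p x) = - ∫ x, inner ℝ (x - x₀) (g x) * p x := by
  -- The weak gradient is tested one fixed direction at a time, so the field is split into its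
  -- coordinates `p(x) (x - x₀)_j` and the resulting identities are summed.
  let e : Fin n → EuclideanSpace ℝ (Fin n) := fun j => EuclideanSpace.single j 1
  let φ : Fin n → EuclideanSpace ℝ (Fin n) → ℝ := fun j x => p x * (x - x₀) j
  have hφs : ∀ j, ContDiff ℝ ∞ (φ j) := fun j => hp.smooth.mul (by fun_prop)
  have hsupp : ∀ j, tsupport (φ j) ⊆ tsupport p := fun j =>
    closure_mono fun x hx h0 => hx (by simp [φ, h0])
  have hφc : ∀ j, HasCompactSupport (φ j) := fun j =>
    hp.compact.mono' (subset_closure.trans (hsupp j))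
  have hφt : ∀ j, IsTestFunction Ω (φ j) := fun j => ⟨hφs j, hφc j, (hsupp j).trans hp.supp⟩
  have hsd : ∀ j, tsupport (fun x => fderiv ℝ (φ j) x (e j)) ⊆ tsupport (φ j) := fun j =>
    tsupport_fderiv_apply_subset ℝ (e j)
  have hfd : ∀ j x, fderiv ℝ (φ j) x (e j) = fderiv ℝ p x ((x - x₀) j • e j) + p x := by
    intro j x
    have h1 : HasFDerivAt (fun y : EuclideanSpace ℝ (Fin n) => (y - x₀) j)
        (EuclideanSpace.proj j : EuclideanSpace ℝ (Fin n) →L[ℝ] ℝ) x := by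
      have := (EuclideanSpace.proj (𝕜 := ℝ) j :
        EuclideanSpace ℝ (Fin n) →L[ℝ] ℝ).hasFDerivAt.comp x ((hasFDerivAt_id x).sub_const x₀)
      refine this.congr_fderiv ?_
      ext
      simp
    have h2 : HasFDerivAt (φ j) _ x := ((hp.smooth.differentiable (by simp)) x).hasFDerivAt.mul h1
    rw [h2.fderiv]
    simp [e]
    ring
  have hsum : ∀ x : EuclideanSpace ℝ (Fin n), ∑ j, (x - x₀) j • e j = x - x₀ := by
    intro x
    ext i
    simp [e, Pi.single_apply]
  have key : ∀ j, ∫ x, w x * fderiv ℝ (φ j) x (e j) = - ∫ x, inner ℝ (g x) (e j) * φ j x := by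
    intro j
    have := hw.weakGrad (φ j) (hφt j) (e j)
    rwa [setIntegral_eq_integral_of_forall_compl_eq_zero (fun x hx => by
        rw [image_eq_zero_of_notMem_tsupport (f := fun x => fderiv ℝ (φ j) x (e j))
          fun h => hx ((hφt j).supp (hsd j h)), mul_zero]),
      setIntegral_eq_integral_of_forall_compl_eq_zero (fun x hx => by
        rw [image_eq_zero_of_notMem_tsupport fun h => hx ((hφt j).supp h), mul_zero])] at this
  have hgj : ∀ j, IntegrableOn (fun x => inner ℝ (g x) (e j)) (tsupport (φ j)) := fun j =>
    (hw.integrableOn (hφc j).isCompact (hφt j).supp).2.inner_const (e j)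
  calc _ = ∫ x, ∑ j, w x * fderiv ℝ (φ j) x (e j) := by
        refine integral_congr_ae (ae_of_all _ fun x => ?_)
        simp only [hfd]
        rw [← Finset.mul_sum, Finset.sum_add_distrib, ← map_sum, hsum]
        simp
    _ = ∑ j, ∫ x, w x * fderiv ℝ (φ j) x (e j) := by
        refine integral_finsetSum _ fun j _ => ?_
        have hc : HasCompactSupport (fun x => fderiv ℝ (φ j) x (e j)) :=
          (hφc j).mono' (subset_closure.trans (hsd j))
        exact integrable_mul_of_hasCompactSupport
          (((hφs j).continuous_fderiv (by simp)).clm_apply continuous_const) hc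
          (hw.integrableOn hc.isCompact ((hsd j).trans (hφt j).supp)).1
    _ = - ∑ j, ∫ x, inner ℝ (g x) (e j) * φ j x := by
        rw [← Finset.sum_neg_distrib]
        exact Finset.sum_congr rfl fun j _ => key j
    _ = - ∫ x, ∑ j, inner ℝ (g x) (e j) * φ j x := by
        rw [integral_finsetSum]
        intro j _
        exact integrable_mul_of_hasCompactSupport (hφs j).continuous (hφc j) (hgj j)
    _ = _ := by
        congr 1
        refine integral_congr_ae (ae_of_all _ fun x => ?_)
        simp only [φ]
        rw [real_inner_comm]
        nth_rw 2 [← hsum x]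
        rw [inner_sum, Finset.sum_mul]
        refine Finset.sum_congr rfl fun j _ => ?_
        rw [real_inner_smul_right]
        ring

/-- The divergence theorem for `w² η(|x - x₀|) (x - x₀)`. -/
theorem MemH1Loc.radial_divergence {n : ℕ} {Ω : Set (EuclideanSpace ℝ (Fin n))}
    {w : EuclideanSpace ℝ (Fin n) → ℝ}
    {g : EuclideanSpace ℝ (Fin n) → EuclideanSpace ℝ (Fin n)} (hw : MemH1Loc Ω w g)
    {x₀ : EuclideanSpace ℝ (Fin n)} {r₁ r₂ R : ℝ} (h₁ : 0 < r₁) (h : r₁ ≤ r₂) (hrR : r₂ < R)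
    (hR : closedBall x₀ R ⊆ Ω) {χ : ℝ → ℝ} (hχ : IsWeight r₁ r₂ χ) :
    ∫ x in ball x₀ r₂, radialCutoff x₀ r₂ χ x
        * (n * w x ^ 2 + 2 * (‖x - x₀‖ * (w x * radialDeriv x₀ g x)))
      = ∫ x in ball x₀ r₂, χ ‖x - x₀‖ * (‖x - x₀‖ * w x ^ 2) := by
  obtain ⟨v, hvs, hv, hvg⟩ := hw.exists_smooth_approx hrR hR
  rw [restrict_closedBall_eq x₀ (h₁.trans_le h).ne'] at hv hvg
  set η := radialCutoff x₀ r₂ χ with hη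
  have hηs : ContDiff ℝ ∞ η := hχ.contDiff_radialCutoff h₁
  have hχn : Continuous fun x : EuclideanSpace ℝ (Fin n) => χ ‖x - x₀‖ :=
    hχ.smooth.continuous.comp (by fun_prop)
  have hsubΩ : closedBall x₀ r₂ ⊆ Ω := (closedBall_subset_closedBall hrR.le).trans hR
  obtain ⟨hw2, hg2⟩ := hw.memLp_ball hsubΩ
  set μ := volume.restrict (ball x₀ r₂) with hμ
  have hη2 : MemLp (fun x => η x * (‖x - x₀‖ * radialDeriv x₀ g x)) 2 μ :=
    memLp_ball_continuous_mul hηs.continuous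
      (memLp_ball_continuous_mul (by fun_prop) (MemLp.radialDeriv hg2))
  have hq2 : MemLp (fun x => (n * η x - χ ‖x - x₀‖ * ‖x - x₀‖) * w x) 2 μ :=
    memLp_ball_continuous_mul ((continuous_const.mul hηs.continuous).sub
      (hχn.mul (by fun_prop))) hw2
  have hgrad : MemLp (fun x => (η x * w x) • (x - x₀)) 2 μ := by
    have h1 : MemLp (fun x => ‖x - x₀‖ * (η x * w x)) 2 μ :=
      memLp_ball_continuous_mul (by fun_prop) (memLp_ball_continuous_mul hηs.continuous hw2)
    refine h1.mono ?_ (ae_of_all _ fun x => by simp [norm_smul]; rw [mul_comm])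
    exact (memLp_ball_continuous_mul hηs.continuous hw2).1.smul
      (by fun_prop : Continuous fun x : EuclideanSpace ℝ (Fin n) => x - x₀).aestronglyMeasurable
  have hvk : ∀ k, MemLp (v k) 2 μ := fun k => memLp_ball_of_continuous (hvs k).continuous 2 _ _
  have hvgk : ∀ k, MemLp (gradient (v k)) 2 μ := fun k =>
    memLp_ball_of_continuous (continuous_gradient (hvs k)) 2 _ _
  -- The test function is `v k * η`: only one of the two factors of `w²` is smoothed. Every term is
  -- then a fixed `L²` function paired with an `L²`-convergent sequence, and no convergence of
  -- products is needed.
  have eq : ∀ k, (∫ x, inner ℝ ((n * η x - χ ‖x - x₀‖ * ‖x - x₀‖) * w x) (v k x) ∂μ)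
      + ∫ x, inner ℝ ((η x * w x) • (x - x₀)) (gradient (v k) x) ∂μ
      = - ∫ x, inner ℝ (η x * (‖x - x₀‖ * radialDeriv x₀ g x)) (v k x) ∂μ := by
    intro k
    have hsupp : tsupport (fun x => v k x * η x) ⊆ closedBall x₀ r₂ :=
      (closure_mono (show Function.support (fun x => v k x * η x) ⊆ Function.support η from
        fun x hx h0 => hx (by simp [h0]))).trans hχ.tsupport_radialCutoff
    have htest : IsTestFunction Ω (fun x => v k x * η x) :=
      ⟨(hvs k).mul hηs, HasCompactSupport.of_support_subset_isCompact (isCompact_closedBall x₀ r₂)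
        (subset_closure.trans hsupp), hsupp.trans hsubΩ⟩
    have h0 := hw.integral_radial_test x₀ htest
    have hfd : ∀ x, fderiv ℝ (fun x => v k x * η x) x (x - x₀)
        = η x * inner ℝ (x - x₀) (gradient (v k) x) - χ ‖x - x₀‖ * ‖x - x₀‖ * v k x := by
      intro x
      have h2 : HasFDerivAt (fun x => v k x * η x) _ x :=
        (((hvs k).differentiable (by simp)) x).hasFDerivAt.mul (hχ.hasFDerivAt_radialCutoff h₁ x)
      rw [h2.fderiv, real_inner_comm, inner_gradient]
      simp only [add_apply, smul_apply, smul_eq_mul, innerSL_apply_apply, neg_apply,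
        neg_smul, real_inner_self_eq_norm_sq]
      by_cases hx : ‖x - x₀‖ = 0
      · simp [hx, hη]
      · field_simp
        ring
    have hvan : ∀ x ∉ ball x₀ r₂, η x = 0 ∧ χ ‖x - x₀‖ = 0 := fun x hx => by
      rw [mem_ball, dist_eq_norm, not_lt] at hx
      exact ⟨hχ.radialCutoff_eq_zero hx, hχ.eq_zero_right _ hx⟩
    simp only [hfd] at h0
    rw [← setIntegral_eq_integral_of_forall_compl_eq_zero (μ := volume) (s := ball x₀ r₂) (fun x hx => by
        rw [(hvan x hx).1, (hvan x hx).2]; ring),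
      ← setIntegral_eq_integral_of_forall_compl_eq_zero (μ := volume) (s := ball x₀ r₂) (fun x hx => by
        rw [(hvan x hx).1]; ring)] at h0
    rw [← integral_add]
    · rw [← hμ] at h0
      refine Eq.trans (integral_congr_ae (ae_of_all _ fun x => ?_))
        (h0.trans (congrArg Neg.neg (integral_congr_ae (ae_of_all _ fun x => ?_))))
      · simp only [real_inner_smul_left, RCLike.inner_apply, conj_trivial]
        ring
      · simp only [RCLike.inner_apply, conj_trivial, norm_mul_radialDeriv]
        ring
    · exact (hq2.integrable_mul (hvk k)).congr (ae_of_all _ fun x => by simp [mul_comm])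
    · refine ((hgrad.norm.integrable_mul (hvgk k).norm).mono (hgrad.1.inner (hvgk k).1)
        (ae_of_all _ fun x => ?_))
      simpa using abs_real_inner_le_norm ((η x * w x) • (x - x₀)) (gradient (v k) x)
  -- In the limit, `η w (x - x₀)·∇w` occurs on both sides, once from the gradient of `v k` and once
  -- from `g`; together these give the factor `2` in the divergence of `w² η (x - x₀)`.
  have l1 := (tendsto_integral_inner hvk hw2 hv hq2).add (tendsto_integral_inner hvgk hg2 hvg hgrad)
  have l2 := (tendsto_integral_inner hvk hw2 hv hη2).neg
  have := tendsto_nhds_unique l1 (l2.congr fun k => (eq k).symm)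
  have i0 : Integrable (fun x => η x * (‖x - x₀‖ * (w x * radialDeriv x₀ g x))) μ :=
    integrableOn_ball_continuous_mul hηs.continuous
      (integrableOn_ball_continuous_mul (by fun_prop) (hw2.integrable_mul (MemLp.radialDeriv hg2)))
  have i1 : Integrable (fun x => n * (η x * w x ^ 2)) μ :=
    (integrableOn_ball_continuous_mul hηs.continuous hw2.integrable_sq).const_mul _
  have i2 : Integrable (fun x => χ ‖x - x₀‖ * (‖x - x₀‖ * w x ^ 2)) μ :=
    integrableOn_ball_continuous_mul hχn
      (integrableOn_ball_continuous_mul (by fun_prop) hw2.integrable_sq)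
  have e1 : ∫ x, inner ℝ ((n * η x - χ ‖x - x₀‖ * ‖x - x₀‖) * w x) (w x) ∂μ
      = (∫ x, n * (η x * w x ^ 2) ∂μ) - ∫ x, χ ‖x - x₀‖ * (‖x - x₀‖ * w x ^ 2) ∂μ := by
    rw [← integral_sub i1 i2]
    refine integral_congr_ae (ae_of_all _ fun x => ?_)
    simp only [RCLike.inner_apply, conj_trivial]
    ring
  have e2 : ∫ x, inner ℝ ((η x * w x) • (x - x₀)) (g x) ∂μ
      = ∫ x, η x * (‖x - x₀‖ * (w x * radialDeriv x₀ g x)) ∂μ := by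
    refine integral_congr_ae (ae_of_all _ fun x => ?_)
    simp only [real_inner_smul_left, ← norm_mul_radialDeriv]
    ring
  have e3 : ∫ x, inner ℝ (η x * (‖x - x₀‖ * radialDeriv x₀ g x)) (w x) ∂μ
      = ∫ x, η x * (‖x - x₀‖ * (w x * radialDeriv x₀ g x)) ∂μ := by
    refine integral_congr_ae (ae_of_all _ fun x => ?_)
    simp only [RCLike.inner_apply, conj_trivial]
    ring
  rw [e1, e2, e3] at this
  have e4 : ∫ x, η x * (n * w x ^ 2 + 2 * (‖x - x₀‖ * (w x * radialDeriv x₀ g x))) ∂μ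
      = (∫ x, n * (η x * w x ^ 2) ∂μ)
        + 2 * ∫ x, η x * (‖x - x₀‖ * (w x * radialDeriv x₀ g x)) ∂μ := by
    rw [← integral_const_mul, ← integral_add i1 (i0.const_mul 2)]
    refine integral_congr_ae (ae_of_all _ fun x => ?_)
    ring
  rw [e4]
  linarith


/-! ### The equation tested with a cutoff times the solution. -/

section
variable {n : ℕ} {Ω : Set (EuclideanSpace ℝ (Fin n))} {w f : EuclideanSpace ℝ (Fin n) → ℝ}
  {g : EuclideanSpace ℝ (Fin n) → EuclideanSpace ℝ (Fin n)}

/-- The distributional equation `Δw + f = 0` in gradient form. -/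
theorem MemH1Loc.integral_inner_gradient (hw : MemH1Loc Ω w g)
    (heq : ∀ φ : EuclideanSpace ℝ (Fin n) → ℝ, IsTestFunction Ω φ →
      (∫ x in Ω, w x * Laplacian.laplacian φ x) + ∫ x in Ω, f x * φ x = 0)
    {φ : EuclideanSpace ℝ (Fin n) → ℝ} (hφ : IsTestFunction Ω φ) :
    ∫ x, inner ℝ (g x) (gradient φ x) = ∫ x, f x * φ x := by
  let e : Fin n → EuclideanSpace ℝ (Fin n) := fun j => EuclideanSpace.single j 1
  let ψ : Fin n → EuclideanSpace ℝ (Fin n) → ℝ := fun j x => fderiv ℝ φ x (e j)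
  have hψs : ∀ j, ContDiff ℝ ∞ (ψ j) := fun j =>
    (hφ.smooth.fderiv_right (m := ∞) (by simp)).clm_apply contDiff_const
  have hsupp : ∀ j, tsupport (ψ j) ⊆ tsupport φ := fun j => tsupport_fderiv_apply_subset ℝ (e j)
  have hψc : ∀ j, HasCompactSupport (ψ j) := fun j =>
    hφ.compact.mono' (subset_closure.trans (hsupp j))
  have hψt : ∀ j, IsTestFunction Ω (ψ j) := fun j => ⟨hψs j, hψc j, (hsupp j).trans hφ.supp⟩
  have hsd : ∀ j, tsupport (fun x => fderiv ℝ (ψ j) x (e j)) ⊆ tsupport (ψ j) := fun j =>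
    tsupport_fderiv_apply_subset ℝ (e j)
  have hlap : ∀ x, Laplacian.laplacian φ x = ∑ j, fderiv ℝ (ψ j) x (e j) := by
    intro x
    rw [InnerProductSpace.laplacian_eq_iteratedFDeriv_orthonormalBasis φ
      (EuclideanSpace.basisFun (Fin n) ℝ)]
    refine Finset.sum_congr rfl fun j _ => ?_
    rw [iteratedFDeriv_two_apply]
    simp only [EuclideanSpace.basisFun_apply, Matrix.cons_val_zero, Matrix.cons_val_one]
    have hd : DifferentiableAt ℝ (fderiv ℝ φ) x :=
      (hφ.smooth.fderiv_right (m := ∞) (by simp)).differentiable (by simp) x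
    have h2 : HasFDerivAt (ψ j) _ x := hd.hasFDerivAt.clm_apply (hasFDerivAt_const (e j) x)
    rw [h2.fderiv]
    simp [e]
  have key : ∀ j, ∫ x, w x * fderiv ℝ (ψ j) x (e j) = - ∫ x, inner ℝ (g x) (e j) * ψ j x := by
    intro j
    have := hw.weakGrad (ψ j) (hψt j) (e j)
    rwa [setIntegral_eq_integral_of_forall_compl_eq_zero (fun x hx => by
        rw [image_eq_zero_of_notMem_tsupport (f := fun x => fderiv ℝ (ψ j) x (e j))
          fun h => hx ((hψt j).supp (hsd j h)), mul_zero]),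
      setIntegral_eq_integral_of_forall_compl_eq_zero (fun x hx => by
        rw [image_eq_zero_of_notMem_tsupport fun h => hx ((hψt j).supp h), mul_zero])] at this
  have h0 := heq φ hφ
  have hl0 : ∀ x ∉ Ω, Laplacian.laplacian φ x = 0 := fun x hx => by
    rw [hlap]
    refine Finset.sum_eq_zero fun j _ => ?_
    exact image_eq_zero_of_notMem_tsupport (f := fun x => fderiv ℝ (ψ j) x (e j))
          fun h => hx ((hψt j).supp (hsd j h))
  rw [setIntegral_eq_integral_of_forall_compl_eq_zero (fun x hx => by rw [hl0 x hx, mul_zero]),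
    setIntegral_eq_integral_of_forall_compl_eq_zero (fun x hx => by
      rw [image_eq_zero_of_notMem_tsupport fun h => hx (hφ.supp h), mul_zero])] at h0
  have e1 : ∫ x, w x * Laplacian.laplacian φ x = - ∫ x, inner ℝ (g x) (gradient φ x) := by
    calc _ = ∫ x, ∑ j, w x * fderiv ℝ (ψ j) x (e j) := by
          refine integral_congr_ae (ae_of_all _ fun x => ?_)
          simp only [hlap]
          rw [Finset.mul_sum]
      _ = ∑ j, ∫ x, w x * fderiv ℝ (ψ j) x (e j) := by
          refine integral_finsetSum _ fun j _ => ?_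
          have hc : HasCompactSupport (fun x => fderiv ℝ (ψ j) x (e j)) :=
            (hψc j).mono' (subset_closure.trans (hsd j))
          exact integrable_mul_of_hasCompactSupport
            (((hψs j).continuous_fderiv (by simp)).clm_apply continuous_const) hc
            (hw.integrableOn hc.isCompact ((hsd j).trans (hψt j).supp)).1
      _ = - ∑ j, ∫ x, inner ℝ (g x) (e j) * ψ j x := by
          rw [← Finset.sum_neg_distrib]
          exact Finset.sum_congr rfl fun j _ => key j
      _ = - ∫ x, ∑ j, inner ℝ (g x) (e j) * ψ j x := by
          rw [integral_finsetSum]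
          intro j _
          exact integrable_mul_of_hasCompactSupport (hψs j).continuous (hψc j)
            ((hw.integrableOn (hψc j).isCompact (hψt j).supp).2.inner_const (e j))
      _ = _ := by
          congr 1
          refine integral_congr_ae (ae_of_all _ fun x => ?_)
          simp only
          rw [← (EuclideanSpace.basisFun (Fin n) ℝ).sum_inner_mul_inner]
          refine Finset.sum_congr rfl fun j _ => ?_
          rw [real_inner_comm (gradient φ x), inner_gradient]
          simp [ψ, e]
  rw [e1] at h0
  linarith

/-- The equation tested with `η T(w)`, where `T` is bounded and smooth. -/
theorem MemH1Loc.integral_test_comp (hw : MemH1Loc Ω w g)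
    (hf : LocallyIntegrableOn f Ω)
    (heq : ∀ φ : EuclideanSpace ℝ (Fin n) → ℝ, IsTestFunction Ω φ →
      (∫ x in Ω, w x * Laplacian.laplacian φ x) + ∫ x in Ω, f x * φ x = 0)
    {x₀ : EuclideanSpace ℝ (Fin n)} {r R : ℝ} (hr : 0 < r) (hrR : r < R)
    (hR : closedBall x₀ R ⊆ Ω) {η : EuclideanSpace ℝ (Fin n) → ℝ} (hη : ContDiff ℝ ∞ η)
    (hηr : tsupport η ⊆ closedBall x₀ r) {T : ℝ → ℝ} (hT : ContDiff ℝ ∞ T) {C : ℝ}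
    (hTC : ∀ s, |T s| ≤ C) (hTC' : ∀ s, |deriv T s| ≤ C) :
    ∫ x in ball x₀ r, (η x * deriv T (w x) * ‖g x‖ ^ 2 + T (w x) * inner ℝ (g x) (gradient η x))
      = ∫ x in ball x₀ r, f x * η x * T (w x) := by
  obtain ⟨v₀, hvs₀, hv₀, hvg₀⟩ := hw.exists_smooth_approx hrR hR
  rw [restrict_closedBall_eq x₀ hr.ne'] at hv₀ hvg₀
  have hsubΩ : closedBall x₀ r ⊆ Ω := (closedBall_subset_closedBall hrR.le).trans hR
  obtain ⟨hw2, hg2⟩ := hw.memLp_ball hsubΩ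
  have hfi : IntegrableOn f (ball x₀ r) := LocallyIntegrableOn.integrableOn_ball hf hsubΩ
  set μ := volume.restrict (ball x₀ r) with hμ
  -- An almost everywhere convergent subsequence is needed: `T` and its derivative are evaluated at
  -- `v k`, and the limits are taken by dominated convergence using their uniform bounds.
  have hmeas : TendstoInMeasure μ v₀ atTop w := by
    refine tendstoInMeasure_of_tendsto_eLpNorm (p := 2) (by norm_num)
      (fun k => (hvs₀ k).continuous.aestronglyMeasurable) hw2.1 hv₀
  obtain ⟨ns, hns, hae⟩ := hmeas.exists_seq_tendsto_ae
  let v : ℕ → EuclideanSpace ℝ (Fin n) → ℝ := fun k => v₀ (ns k)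
  have hvs : ∀ k, ContDiff ℝ ∞ (v k) := fun k => hvs₀ (ns k)
  have hvg : Tendsto (fun k => eLpNorm (fun x => gradient (v k) x - g x) 2 μ) atTop (𝓝 0) :=
    hvg₀.comp hns.tendsto_atTop
  have hvgk : ∀ k, MemLp (gradient (v k)) 2 μ := fun k =>
    memLp_ball_of_continuous (continuous_gradient (hvs k)) 2 _ _
  have hT'c : Continuous (deriv T) := hT.continuous_deriv (by simp)
  have hC0 : 0 ≤ C := (abs_nonneg _).trans (hTC 0)
  obtain ⟨A, hA⟩ := (isCompact_closedBall x₀ r).exists_bound_of_continuousOn hη.continuous.continuousOn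
  obtain ⟨A', hA'⟩ := (isCompact_closedBall x₀ r).exists_bound_of_continuousOn
    (continuous_gradient hη).continuousOn
  have hgη : ∀ x ∉ tsupport η, gradient η x = 0 := fun x hx => by
    rw [gradient, image_eq_zero_of_notMem_tsupport (f := fderiv ℝ η)
      fun h => hx (tsupport_fderiv_subset ℝ h), map_zero]
  have eqk : ∀ k, (∫ x, η x * deriv T (v k x) * inner ℝ (g x) (gradient (v k) x) ∂μ)
      + (∫ x, T (v k x) * inner ℝ (g x) (gradient η x) ∂μ) = ∫ x, f x * η x * T (v k x) ∂μ := by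
    intro k
    have hsupp : tsupport (fun x => η x * T (v k x)) ⊆ closedBall x₀ r :=
      (closure_mono (show Function.support (fun x => η x * T (v k x)) ⊆ Function.support η from
        fun x hx h0 => hx (by simp [h0]))).trans hηr
    have htest : IsTestFunction Ω (fun x => η x * T (v k x)) :=
      ⟨hη.mul (hT.comp (hvs k)),
        HasCompactSupport.of_support_subset_isCompact (isCompact_closedBall x₀ r)
        (subset_closure.trans hsupp), hsupp.trans hsubΩ⟩
    have hgrad : ∀ x, inner ℝ (g x) (gradient (fun x => η x * T (v k x)) x)
        = η x * deriv T (v k x) * inner ℝ (g x) (gradient (v k) x)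
          + T (v k x) * inner ℝ (g x) (gradient η x) := by
      intro x
      have h1 : HasFDerivAt (fun x => T (v k x)) _ x :=
        ((hT.differentiable (by simp) (v k x)).hasDerivAt).comp_hasFDerivAt x
          ((hvs k).differentiable (by simp) x).hasFDerivAt
      have h2 : HasFDerivAt (fun x => η x * T (v k x)) _ x :=
        (hη.differentiable (by simp) x).hasFDerivAt.mul h1
      rw [real_inner_comm, inner_gradient, h2.fderiv, real_inner_comm (gradient (v k) x),
        real_inner_comm (gradient η x), inner_gradient, inner_gradient]
      simp
      ring
    have h0 := hw.integral_inner_gradient heq htest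
    simp only [hgrad] at h0
    rw [← setIntegral_eq_integral_of_forall_compl_eq_zero (μ := volume) (s := closedBall x₀ r)
        (fun x hx => by
          rw [image_eq_zero_of_notMem_tsupport fun h => hx (hηr h), hgη x fun h => hx (hηr h)]
          simp),
      ← setIntegral_eq_integral_of_forall_compl_eq_zero (μ := volume) (s := closedBall x₀ r)
        (fun x hx => by rw [image_eq_zero_of_notMem_tsupport fun h => hx (hηr h)]; simp),
      restrict_closedBall_eq x₀ hr.ne', ← hμ, integral_add] at h0
    · rw [h0]
      refine integral_congr_ae (ae_of_all _ fun x => ?_)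
      ring
    · have hi : Integrable (fun x => inner ℝ (g x) (gradient (v k) x)) μ := by
        refine ((hg2.norm.integrable_mul (hvgk k).norm).mono (hg2.1.inner (hvgk k).1)
          (ae_of_all _ fun x => ?_))
        simpa using abs_real_inner_le_norm (g x) (gradient (v k) x)
      exact integrableOn_ball_continuous_mul
        (hη.continuous.mul (hT'c.comp (hvs k).continuous)) hi
    · have hi : Integrable (fun x => inner ℝ (g x) (gradient η x)) μ := by
        have hq := memLp_ball_of_continuous (continuous_gradient hη) 2 x₀ r
        refine ((hg2.norm.integrable_mul hq.norm).mono (hg2.1.inner hq.1)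
          (ae_of_all _ fun x => ?_))
        simpa using abs_real_inner_le_norm (g x) (gradient η x)
      exact integrableOn_ball_continuous_mul (hT.continuous.comp (hvs k).continuous) hi
  have hηm : AEStronglyMeasurable η μ := hη.continuous.aestronglyMeasurable
  have hTm : ∀ k, AEStronglyMeasurable (fun x => T (v k x)) μ := fun k =>
    (hT.continuous.comp (hvs k).continuous).aestronglyMeasurable
  have hT'm : ∀ k, AEStronglyMeasurable (fun x => deriv T (v k x)) μ := fun k =>
    (hT'c.comp (hvs k).continuous).aestronglyMeasurable
  have hgnm : AEStronglyMeasurable (fun x => inner ℝ (g x) (gradient η x)) μ :=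
    hg2.1.inner (continuous_gradient hη).aestronglyMeasurable
  have hball : ∀ᵐ x ∂μ, x ∈ ball x₀ r := ae_restrict_mem measurableSet_ball
  have hgi : Integrable (fun x => ‖g x‖) μ := by
    have : IsFiniteMeasure μ := ⟨by simpa [hμ] using measure_ball_lt_top⟩
    exact (hg2.integrable (by norm_num)).norm
  have l1a : Tendsto (fun k => ∫ x, η x * deriv T (v k x) * ‖g x‖ ^ 2 ∂μ) atTop
      (𝓝 (∫ x, η x * deriv T (w x) * ‖g x‖ ^ 2 ∂μ)) := by
    refine tendsto_integral_of_dominated_convergence (fun x => A * C * ‖g x‖ ^ 2)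
      (fun k => (hηm.mul (hT'm k)).mul (hg2.1.norm.pow 2))
      ((hg2.integrable_norm_pow (by simp)).const_mul _) (fun k => ?_) ?_
    · filter_upwards [hball] with x hx
      rw [norm_mul, norm_mul, norm_pow, norm_norm]
      gcongr
      · exact (norm_nonneg _).trans (hA x (ball_subset_closedBall hx))
      · exact hA x (ball_subset_closedBall hx)
      · exact hTC' _
    · filter_upwards [hae] with x hx
      exact ((tendsto_const_nhds).mul ((hT'c.tendsto _).comp hx)).mul tendsto_const_nhds
  -- The gradient of `v k` is replaced by `g` plus a remainder tending to zero in `L²`. The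
  -- remainder is harmless because its coefficient is bounded uniformly in `k`.
  have l1b : Tendsto (fun k => ∫ x, η x * deriv T (v k x) * inner ℝ (g x) (gradient (v k) x - g x) ∂μ)
      atTop (𝓝 0) := by
    have h0 := (tendsto_integral_norm_mul_norm (fun k => (hvgk k).sub hg2) hvg hg2).const_mul (A * C)
    rw [mul_zero] at h0
    refine squeeze_zero_norm (fun k => ?_) h0
    rw [← integral_const_mul]
    refine norm_integral_le_of_norm_le ?_ ?_
    · exact (((hvgk k).sub hg2).norm.integrable_mul hg2.norm).const_mul _
    · filter_upwards [hball] with x hx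
      rw [norm_mul, norm_mul, mul_comm ‖(gradient (v k) - g) x‖]
      have h1 := hA x (ball_subset_closedBall hx)
      exact mul_le_mul (mul_le_mul h1 (hTC' _) (norm_nonneg _) ((norm_nonneg _).trans h1))
        (norm_inner_le_norm _ _) (norm_nonneg _)
        (mul_nonneg ((norm_nonneg _).trans h1) hC0)
  have l1 : Tendsto (fun k => ∫ x, η x * deriv T (v k x) * inner ℝ (g x) (gradient (v k) x) ∂μ) atTop
      (𝓝 (∫ x, η x * deriv T (w x) * ‖g x‖ ^ 2 ∂μ)) := by
    have := l1a.add l1b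
    rw [add_zero] at this
    refine this.congr fun k => ?_
    rw [← integral_add]
    · refine integral_congr_ae (ae_of_all _ fun x => ?_)
      simp only [inner_sub_right, real_inner_self_eq_norm_sq]
      ring
    · exact integrableOn_ball_continuous_mul
        (hη.continuous.mul (hT'c.comp (hvs k).continuous)) (hg2.integrable_norm_pow (by simp))
    · have hq := (hvgk k).sub hg2
      have hi : Integrable (fun x => inner ℝ (g x) (gradient (v k) x - g x)) μ := by
        refine ((hg2.norm.integrable_mul hq.norm).mono (hg2.1.inner hq.1)
          (ae_of_all _ fun x => ?_))
        simpa using abs_real_inner_le_norm (g x) (gradient (v k) x - g x)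
      exact integrableOn_ball_continuous_mul
        (hη.continuous.mul (hT'c.comp (hvs k).continuous)) hi
  have hgA' : ∀ x ∈ ball x₀ r, ‖inner ℝ (g x) (gradient η x)‖ ≤ ‖g x‖ * A' := fun x hx =>
    (norm_inner_le_norm _ _).trans
      (mul_le_mul_of_nonneg_left (hA' x (ball_subset_closedBall hx)) (norm_nonneg _))
  have l2 : Tendsto (fun k => ∫ x, T (v k x) * inner ℝ (g x) (gradient η x) ∂μ) atTop
      (𝓝 (∫ x, T (w x) * inner ℝ (g x) (gradient η x) ∂μ)) := by
    refine tendsto_integral_of_dominated_convergence (fun x => C * (‖g x‖ * A'))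
      (fun k => (hTm k).mul hgnm) ((hgi.mul_const _).const_mul _) (fun k => ?_) ?_
    · filter_upwards [hball] with x hx
      rw [norm_mul]
      exact mul_le_mul (hTC _) (hgA' x hx) (norm_nonneg _) hC0
    · filter_upwards [hae] with x hx
      exact ((hT.continuous.tendsto _).comp hx).mul tendsto_const_nhds
  have l3 : Tendsto (fun k => ∫ x, f x * η x * T (v k x) ∂μ) atTop
      (𝓝 (∫ x, f x * η x * T (w x) ∂μ)) := by
    refine tendsto_integral_of_dominated_convergence (fun x => ‖f x‖ * A * C)
      (fun k => (hfi.aestronglyMeasurable.mul hηm).mul (hTm k))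
      ((hfi.norm.mul_const _).mul_const _) (fun k => ?_) ?_
    · filter_upwards [hball] with x hx
      rw [norm_mul, norm_mul]
      have h1 := hA x (ball_subset_closedBall hx)
      exact mul_le_mul (mul_le_mul_of_nonneg_left h1 (norm_nonneg _)) (hTC _) (norm_nonneg _)
        (mul_nonneg (norm_nonneg _) ((norm_nonneg _).trans h1))
    · filter_upwards [hae] with x hx
      exact tendsto_const_nhds.mul ((hT.continuous.tendsto _).comp hx)
  have hfin := tendsto_nhds_unique (l1.add l2) (l3.congr fun k => (eqk k).symm)
  have hTwm : AEStronglyMeasurable (fun x => T (w x)) μ :=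
    hT.continuous.comp_aestronglyMeasurable hw2.1
  have hT'wm : AEStronglyMeasurable (fun x => deriv T (w x)) μ :=
    hT'c.comp_aestronglyMeasurable hw2.1
  rw [← hfin, integral_add]
  · refine Integrable.mono' ((hg2.integrable_norm_pow (p := 2) (by simp)).const_mul (A * C))
      ((hηm.mul hT'wm).mul (hg2.1.norm.pow 2)) ?_
    filter_upwards [hball] with x hx
    rw [norm_mul, norm_mul, norm_pow, norm_norm]
    gcongr
    · exact (norm_nonneg _).trans (hA x (ball_subset_closedBall hx))
    · exact hA x (ball_subset_closedBall hx)
    · exact hTC' _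
  · refine Integrable.mono' ((hgi.mul_const A').const_mul C) (hTwm.mul hgnm) ?_
    filter_upwards [hball] with x hx
    rw [norm_mul]
    exact mul_le_mul (hTC _) (hgA' x hx) (norm_nonneg _) hC0

end


section
variable {n : ℕ} {Ω : Set (EuclideanSpace ℝ (Fin n))} {w f : EuclideanSpace ℝ (Fin n) → ℝ}
  {g : EuclideanSpace ℝ (Fin n) → EuclideanSpace ℝ (Fin n)}

theorem hasDerivAt_truncation {ε : ℝ} (hε : 0 ≤ ε) (s : ℝ) :
    HasDerivAt (fun s => s / (1 + ε * s ^ 2)) ((1 - ε * s ^ 2) / (1 + ε * s ^ 2) ^ 2) s := by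
  have hpos : (1 + ε * s ^ 2) ≠ 0 := by positivity
  have h1 : HasDerivAt (fun s => 1 + ε * s ^ 2) (ε * (2 * s)) s := by
    simpa using ((hasDerivAt_pow 2 s).const_mul ε).const_add 1
  refine ((hasDerivAt_id s).div h1 hpos).congr_deriv ?_
  simp only [id]
  congr 1
  ring

/-- The equation tested with `η w`. -/
theorem MemH1Loc.integral_test_self (hw : MemH1Loc Ω w g)
    (hf : LocallyIntegrableOn f Ω) (hwf : LocallyIntegrableOn (fun x => w x * f x) Ω)
    (heq : ∀ φ : EuclideanSpace ℝ (Fin n) → ℝ, IsTestFunction Ω φ →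
      (∫ x in Ω, w x * Laplacian.laplacian φ x) + ∫ x in Ω, f x * φ x = 0)
    {x₀ : EuclideanSpace ℝ (Fin n)} {r R : ℝ} (hr : 0 < r) (hrR : r < R)
    (hR : closedBall x₀ R ⊆ Ω) {η : EuclideanSpace ℝ (Fin n) → ℝ} (hη : ContDiff ℝ ∞ η)
    (hηr : tsupport η ⊆ closedBall x₀ r) :
    ∫ x in ball x₀ r, (η x * ‖g x‖ ^ 2 + w x * inner ℝ (g x) (gradient η x))
      = ∫ x in ball x₀ r, η x * (w x * f x) := by
  have hsubΩ : closedBall x₀ r ⊆ Ω := (closedBall_subset_closedBall hrR.le).trans hR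
  obtain ⟨hw2, hg2⟩ := hw.memLp_ball hsubΩ
  have hfi : IntegrableOn f (ball x₀ r) := LocallyIntegrableOn.integrableOn_ball hf hsubΩ
  have hwfi : IntegrableOn (fun x => w x * f x) (ball x₀ r) :=
    LocallyIntegrableOn.integrableOn_ball hwf hsubΩ
  set μ := volume.restrict (ball x₀ r) with hμ
  -- As `f` is only locally integrable, `η w` is not directly admissible, so `w` is truncated to
  -- `w/(1 + εw²)`. Boundedness by `1/ε` (where `ε ≤ 1` enters) permits the test; `|T s| ≤ |s|` and
  -- `|T' s| ≤ 1` then give majorants independent of `ε`, built from `|w f|`, `|g|²` and `|w||g|`.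
  let ε : ℕ → ℝ := fun l => 1 / ((l : ℝ) + 1)
  have hε : ∀ l, 0 < ε l := fun l => by positivity
  have hε1 : ∀ l, ε l ≤ 1 := fun l => by
    rw [div_le_one (by positivity)]
    linarith [(Nat.cast_nonneg l : (0:ℝ) ≤ l)]
  have hε0 : Tendsto ε atTop (𝓝 0) := tendsto_one_div_add_atTop_nhds_zero_nat
  let T : ℕ → ℝ → ℝ := fun l s => s / (1 + ε l * s ^ 2)
  have hpos : ∀ l s, 1 ≤ 1 + ε l * s ^ 2 := fun l s => by nlinarith [mul_nonneg (hε l).le (sq_nonneg s)]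
  have hT : ∀ l, ContDiff ℝ ∞ (T l) := fun l =>
    ContDiff.div (by fun_prop) (by fun_prop) fun s => (zero_lt_one.trans_le (hpos l s)).ne'
  have hT' : ∀ l s, deriv (T l) s = (1 - ε l * s ^ 2) / (1 + ε l * s ^ 2) ^ 2 := fun l s =>
    (hasDerivAt_truncation (hε l).le s).deriv
  have hTs : ∀ l s, |T l s| ≤ |s| := fun l s => by
    simp only [T]
    rw [abs_div, abs_of_nonneg (zero_le_one.trans (hpos l s))]
    exact div_le_self (abs_nonneg _) (hpos l s)
  have hTb : ∀ l s, |T l s| ≤ 1 / ε l := fun l s => by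
    simp only [T]
    rw [abs_div, abs_of_nonneg (zero_le_one.trans (hpos l s)), div_le_div_iff₀
      (zero_lt_one.trans_le (hpos l s)) (hε l), ← sq_abs s]
    nlinarith [sq_nonneg (|s| - 1), abs_nonneg s, hε l, hε1 l,
      mul_nonneg (hε l).le (sq_nonneg (|s| - 1)), mul_nonneg (hε l).le (abs_nonneg s)]
  have hT1 : ∀ l s, |deriv (T l) s| ≤ 1 := fun l s => by
    rw [hT', abs_div, abs_of_nonneg (a := (1 + ε l * s ^ 2) ^ 2) (sq_nonneg _),
      div_le_one (by have := hpos l s; positivity), abs_le]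
    have := mul_nonneg (hε l).le (sq_nonneg s)
    constructor <;> nlinarith
  have hTC : ∀ l s, |T l s| ≤ max (1 / ε l) 1 := fun l s => (hTb l s).trans (le_max_left _ _)
  have hTC' : ∀ l s, |deriv (T l) s| ≤ max (1 / ε l) 1 := fun l s =>
    (hT1 l s).trans (le_max_right _ _)
  have hTlim : ∀ s, Tendsto (fun l => T l s) atTop (𝓝 s) := fun s => by
    have h1 : Tendsto (fun l => 1 + ε l * s ^ 2) atTop (𝓝 (1 + 0 * s ^ 2)) :=
      tendsto_const_nhds.add (hε0.mul_const _)
    have h2 := (tendsto_const_nhds (x := s)).div h1 (by simp)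
    simp only [zero_mul, add_zero, div_one] at h2
    exact h2
  have hT'lim : ∀ s, Tendsto (fun l => deriv (T l) s) atTop (𝓝 1) := fun s => by
    simp only [hT']
    have h1 : Tendsto (fun l => 1 + ε l * s ^ 2) atTop (𝓝 (1 + 0 * s ^ 2)) :=
      tendsto_const_nhds.add (hε0.mul_const _)
    have h3 : Tendsto (fun l => 1 - ε l * s ^ 2) atTop (𝓝 (1 - 0 * s ^ 2)) :=
      tendsto_const_nhds.sub (hε0.mul_const _)
    have h2 := h3.div (h1.pow 2) (by simp)
    simp only [zero_mul, add_zero, sub_zero, one_pow, div_one] at h2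
    exact h2
  have eql := fun l => hw.integral_test_comp hf heq hr hrR hR hη hηr (hT l) (hTC l) (hTC' l)
  obtain ⟨A, hA⟩ := (isCompact_closedBall x₀ r).exists_bound_of_continuousOn hη.continuous.continuousOn
  obtain ⟨A', hA'⟩ := (isCompact_closedBall x₀ r).exists_bound_of_continuousOn
    (continuous_gradient hη).continuousOn
  have hball : ∀ᵐ x ∂μ, x ∈ ball x₀ r := ae_restrict_mem measurableSet_ball
  have hηm : AEStronglyMeasurable η μ := hη.continuous.aestronglyMeasurable
  have hTwm : ∀ l, AEStronglyMeasurable (fun x => T l (w x)) μ := fun l =>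
    (hT l).continuous.comp_aestronglyMeasurable hw2.1
  have hT'wm : ∀ l, AEStronglyMeasurable (fun x => deriv (T l) (w x)) μ := fun l =>
    ((hT l).continuous_deriv (by simp)).comp_aestronglyMeasurable hw2.1
  have hgnm : AEStronglyMeasurable (fun x => inner ℝ (g x) (gradient η x)) μ :=
    hg2.1.inner (continuous_gradient hη).aestronglyMeasurable
  have l1 : Tendsto (fun l => ∫ x, (η x * deriv (T l) (w x) * ‖g x‖ ^ 2
      + T l (w x) * inner ℝ (g x) (gradient η x)) ∂μ) atTop
      (𝓝 (∫ x, (η x * ‖g x‖ ^ 2 + w x * inner ℝ (g x) (gradient η x)) ∂μ)) := by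
    refine tendsto_integral_of_dominated_convergence
      (fun x => A * ‖g x‖ ^ 2 + A' * (‖w x‖ * ‖g x‖))
      (fun l => ((hηm.mul (hT'wm l)).mul (hg2.1.norm.pow 2)).add ((hTwm l).mul hgnm))
      (((hg2.integrable_norm_pow (by simp)).const_mul _).add
        ((hw2.norm.integrable_mul hg2.norm).const_mul _)) (fun l => ?_) ?_
    · filter_upwards [hball] with x hx
      have h1 := hA x (ball_subset_closedBall hx)
      have h2 := hA' x (ball_subset_closedBall hx)
      refine (norm_add_le _ _).trans (add_le_add ?_ ?_)
      · rw [norm_mul, norm_mul, norm_pow, norm_norm]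
        refine mul_le_mul_of_nonneg_right ?_ (sq_nonneg _)
        calc _ ≤ A * 1 := mul_le_mul h1 (hT1 l _) (abs_nonneg _) ((norm_nonneg _).trans h1)
          _ = A := mul_one A
      · rw [norm_mul]
        calc _ ≤ ‖w x‖ * (‖g x‖ * A') := mul_le_mul (hTs l _)
              ((norm_inner_le_norm _ _).trans (mul_le_mul_of_nonneg_left h2 (norm_nonneg _)))
              (norm_nonneg _) (abs_nonneg _)
          _ = _ := by ring
    · refine ae_of_all _ fun x => ?_
      have := ((tendsto_const_nhds (x := η x)).mul (hT'lim (w x))).mul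
        (tendsto_const_nhds (x := ‖g x‖ ^ 2))
      rw [mul_one] at this
      exact this.add ((hTlim (w x)).mul tendsto_const_nhds)
  have l2 : Tendsto (fun l => ∫ x, f x * η x * T l (w x) ∂μ) atTop
      (𝓝 (∫ x, η x * (w x * f x) ∂μ)) := by
    refine tendsto_integral_of_dominated_convergence
      (fun x => A * ‖w x * f x‖)
      (fun l => (hfi.aestronglyMeasurable.mul hηm).mul (hTwm l))
      (hwfi.norm.const_mul _) (fun l => ?_) ?_
    · filter_upwards [hball] with x hx
      have h1 := hA x (ball_subset_closedBall hx)
      rw [norm_mul, norm_mul, norm_mul]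
      calc _ ≤ ‖f x‖ * A * ‖w x‖ := mul_le_mul (mul_le_mul_of_nonneg_left h1 (norm_nonneg _))
            (hTs l _) (abs_nonneg _) (mul_nonneg (norm_nonneg _) ((norm_nonneg _).trans h1))
        _ = _ := by ring
    · refine ae_of_all _ fun x => ?_
      have := (tendsto_const_nhds (x := f x * η x)).mul (hTlim (w x))
      convert this using 2
      ring
  exact tendsto_nhds_unique l1 (l2.congr fun l => (eql l).symm)

/-- The equation tested with `w η(|x - x₀|)`. -/
theorem MemH1Loc.radial_test_self (hw : MemH1Loc Ω w g)
    (hf : LocallyIntegrableOn f Ω) (hwf : LocallyIntegrableOn (fun x => w x * f x) Ω)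
    (heq : ∀ φ : EuclideanSpace ℝ (Fin n) → ℝ, IsTestFunction Ω φ →
      (∫ x in Ω, w x * Laplacian.laplacian φ x) + ∫ x in Ω, f x * φ x = 0)
    {x₀ : EuclideanSpace ℝ (Fin n)} {r₁ r₂ R : ℝ} (h₁ : 0 < r₁) (h : r₁ ≤ r₂) (hrR : r₂ < R)
    (hR : closedBall x₀ R ⊆ Ω) {χ : ℝ → ℝ} (hχ : IsWeight r₁ r₂ χ) :
    ∫ x in ball x₀ r₂, radialCutoff x₀ r₂ χ x * (‖g x‖ ^ 2 - w x * f x)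
      = ∫ x in ball x₀ r₂, χ ‖x - x₀‖ * (w x * radialDeriv x₀ g x) := by
  have hηs : ContDiff ℝ ∞ (radialCutoff x₀ r₂ χ) := hχ.contDiff_radialCutoff h₁
  have hχn : Continuous fun x : EuclideanSpace ℝ (Fin n) => χ ‖x - x₀‖ :=
    hχ.smooth.continuous.comp (by fun_prop)
  have hsubΩ : closedBall x₀ r₂ ⊆ Ω := (closedBall_subset_closedBall hrR.le).trans hR
  obtain ⟨hw2, hg2⟩ := hw.memLp_ball hsubΩ
  have h0 := hw.integral_test_self hf hwf heq (h₁.trans_le h) hrR hR hηs hχ.tsupport_radialCutoff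
  have hgr : ∀ x, inner ℝ (g x) (gradient (radialCutoff x₀ r₂ χ) x)
      = -(χ ‖x - x₀‖ * radialDeriv x₀ g x) := fun x => by
    rw [real_inner_comm, inner_gradient, hχ.fderiv_radialCutoff h₁, radialDeriv]
    ring
  simp only [hgr] at h0
  have hgs : IntegrableOn (fun x => ‖g x‖ ^ 2) (ball x₀ r₂) := hg2.integrable_norm_pow (by simp)
  have i1 := integrableOn_ball_continuous_mul hηs.continuous hgs
  have i2 := integrableOn_ball_continuous_mul (x₀ := x₀) (r := r₂) hηs.continuous
    (LocallyIntegrableOn.integrableOn_ball hwf hsubΩ)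
  have i3 := integrableOn_ball_continuous_mul (x₀ := x₀) (r := r₂) hχn
    (g := fun x => w x * radialDeriv x₀ g x) (hw2.integrable_mul (MemLp.radialDeriv hg2))
  have e1 : ∫ x in ball x₀ r₂, (radialCutoff x₀ r₂ χ x * ‖g x‖ ^ 2
      + w x * -(χ ‖x - x₀‖ * radialDeriv x₀ g x))
      = (∫ x in ball x₀ r₂, radialCutoff x₀ r₂ χ x * ‖g x‖ ^ 2)
        - ∫ x in ball x₀ r₂, χ ‖x - x₀‖ * (w x * radialDeriv x₀ g x) := by
    rw [← integral_sub i1 i3]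
    refine integral_congr_ae (ae_of_all _ fun x => ?_)
    ring
  rw [e1] at h0
  simp only [mul_sub]
  rw [integral_sub i1 i2]
  linarith

end

/-! ### Polar coordinates, the trace inequality and the norm of sphere traces. -/

/-- Polar coordinates. -/
theorem integral_eq_integral_sphere {n : ℕ} (hn : 0 < n) {p : EuclideanSpace ℝ (Fin n) → ℝ}
    (hp : Integrable p) :
    ∫ x, p x = ∫ θ : sphere (0 : EuclideanSpace ℝ (Fin n)) 1,
      (∫ s in Set.Ioi (0:ℝ), s ^ (n - 1) * p (s • (θ : EuclideanSpace ℝ (Fin n))))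
        ∂(volume : Measure (EuclideanSpace ℝ (Fin n))).toSphere := by
  have : NeZero n := ⟨hn.ne'⟩
  have hnt : Nontrivial (EuclideanSpace ℝ (Fin n)) :=
    Module.nontrivial_of_finrank_pos (R := ℝ) (by simpa using hn)
  set H := homeomorphUnitSphereProd (EuclideanSpace ℝ (Fin n))
  have hmp := (volume : Measure (EuclideanSpace ℝ (Fin n))).measurePreserving_homeomorphUnitSphereProd
  rw [show Module.finrank ℝ (EuclideanSpace ℝ (Fin n)) = n by simp] at hmp
  let q : sphere (0 : EuclideanSpace ℝ (Fin n)) 1 × Set.Ioi (0:ℝ) → ℝ := fun z => p (z.2.1 • z.1.1)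
  have hq : ∀ y : ({0}ᶜ : Set (EuclideanSpace ℝ (Fin n))), q (H y) = p y := fun y => by
    have hy : ‖(y : EuclideanSpace ℝ (Fin n))‖ ≠ 0 := norm_ne_zero_iff.2 y.2
    simp [q, H, smul_smul, hy]
  have hemb : MeasurableEmbedding H := H.measurableEmbedding
  have hcomap : Integrable (fun y : ({0}ᶜ : Set (EuclideanSpace ℝ (Fin n))) => p y)
      (Measure.comap (↑) (volume : Measure (EuclideanSpace ℝ (Fin n)))) := by
    exact (integrableOn_iff_comap_subtypeVal (measurableSet_singleton _).compl).1 hp.integrableOn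
  have hqi : Integrable q ((volume : Measure (EuclideanSpace ℝ (Fin n))).toSphere.prod
      (Measure.volumeIoiPow (n - 1))) := by
    rw [← hmp.integrable_comp_emb hemb]
    exact hcomap.congr (ae_of_all _ fun y => (hq y).symm)
  calc ∫ x, p x = ∫ y : ({0}ᶜ : Set (EuclideanSpace ℝ (Fin n))), p y
        ∂(Measure.comap (↑) (volume : Measure (EuclideanSpace ℝ (Fin n)))) := by
        rw [integral_subtype_comap (measurableSet_singleton _).compl p, restrict_compl_singleton]
    _ = ∫ z, q z ∂((volume : Measure (EuclideanSpace ℝ (Fin n))).toSphere.prod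
      (Measure.volumeIoiPow (n - 1))) := by
        rw [← hmp.integral_comp hemb]
        exact integral_congr_ae (ae_of_all _ fun y => (hq y).symm)
    _ = _ := by
        rw [integral_prod _ hqi]
        refine integral_congr_ae (ae_of_all _ fun θ => ?_)
        simp only [q, Measure.volumeIoiPow]
        rw [integral_withDensity_eq_integral_toReal_smul (by fun_prop) (ae_of_all _ fun _ => by simp)]
        have := integral_subtype_comap (μ := volume) (measurableSet_Ioi (a := (0:ℝ)))
          (fun s : ℝ => s ^ (n - 1) * p (s • (θ : EuclideanSpace ℝ (Fin n))))
        rw [← this]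
        refine integral_congr_ae (ae_of_all _ fun s => ?_)
        have hs : (0:ℝ) ≤ s := le_of_lt s.2
        simp [ENNReal.toReal_ofReal, pow_nonneg hs]


theorem integral_surfaceMeasure {n : ℕ} (x₀ : EuclideanSpace ℝ (Fin n)) {r : ℝ} (hr : 0 ≤ r)
    {q : EuclideanSpace ℝ (Fin n) → ℝ} (hq : Continuous q) :
    ∫ x, q x ∂(surfaceMeasure x₀ r) = r ^ (n - 1)
      * ∫ θ : sphere (0 : EuclideanSpace ℝ (Fin n)) 1, q (x₀ + r • (θ : EuclideanSpace ℝ (Fin n)))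
        ∂(volume : Measure (EuclideanSpace ℝ (Fin n))).toSphere := by
  rw [surfaceMeasure, integral_smul_measure, integral_map]
  · rw [ENNReal.toReal_ofReal (pow_nonneg hr _), smul_eq_mul]
  · exact (by fun_prop : Continuous fun θ : sphere (0 : EuclideanSpace ℝ (Fin n)) 1 =>
      x₀ + r • (θ : EuclideanSpace ℝ (Fin n))).aemeasurable
  · exact hq.aestronglyMeasurable

instance {n : ℕ} (x₀ : EuclideanSpace ℝ (Fin n)) (r : ℝ) : IsFiniteMeasure (surfaceMeasure x₀ r) := by
  unfold surfaceMeasure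
  exact Measure.smul_finite _ ENNReal.ofReal_ne_top

theorem memLp_surfaceMeasure_of_continuous {n : ℕ} (x₀ : EuclideanSpace ℝ (Fin n)) (r : ℝ)
    {v : EuclideanSpace ℝ (Fin n) → ℝ} (hv : Continuous v) (p : ℝ≥0∞) :
    MemLp v p (surfaceMeasure x₀ r) := by
  obtain ⟨C, hC⟩ := (isCompact_closedBall x₀ |r|).exists_bound_of_continuousOn hv.continuousOn
  refine MemLp.of_bound hv.aestronglyMeasurable C ?_
  refine Measure.ae_smul_measure ?_ _
  have hc : Continuous fun θ : sphere (0 : EuclideanSpace ℝ (Fin n)) 1 =>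
      x₀ + r • (θ : EuclideanSpace ℝ (Fin n)) := by fun_prop
  rw [ae_map_iff hc.aemeasurable (isClosed_le hv.norm continuous_const).measurableSet]
  refine ae_of_all _ fun θ => hC _ ?_
  simp [norm_smul]

/-- The divergence theorem for `v² (x - x₀)` on a ball. -/
theorem setIntegral_ball_eq_surface {n : ℕ} (hn : 0 < n) (x₀ : EuclideanSpace ℝ (Fin n)) {r : ℝ}
    (hr : 0 < r) {v : EuclideanSpace ℝ (Fin n) → ℝ} (hv : ContDiff ℝ ∞ v) :
    ∫ x in ball x₀ r, (n * v x ^ 2 + 2 * (v x * inner ℝ (x - x₀) (gradient v x)))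
      = r * ∫ x, v x ^ 2 ∂(surfaceMeasure x₀ r) := by
  have hvc := hv.continuous
  set p : EuclideanSpace ℝ (Fin n) → ℝ := fun x =>
    n * v x ^ 2 + 2 * (v x * inner ℝ (x - x₀) (gradient v x)) with hp
  have hpc : Continuous p := by
    have := continuous_gradient hv
    fun_prop
  have hpi : IntegrableOn p (ball x₀ r) :=
    (hpc.continuousOn.integrableOn_compact (isCompact_closedBall x₀ r)).mono_set
      ball_subset_closedBall
  have h1 : ∫ x in ball x₀ r, p x = ∫ y, (ball (0 : EuclideanSpace ℝ (Fin n)) r).indicator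
      (fun y => p (x₀ + y)) y := by
    rw [← integral_indicator measurableSet_ball, ← integral_add_left_eq_self _ x₀]
    refine integral_congr_ae (ae_of_all _ fun y => ?_)
    simp [Set.indicator, dist_eq_norm]
  have hi : Integrable ((ball (0 : EuclideanSpace ℝ (Fin n)) r).indicator
      (fun y => p (x₀ + y))) := by
    rw [integrable_indicator_iff measurableSet_ball]
    have : Continuous fun y => p (x₀ + y) := by fun_prop
    exact (this.continuousOn.integrableOn_compact (isCompact_closedBall 0 r)).mono_set
      ball_subset_closedBall
  rw [h1, integral_eq_integral_sphere hn hi, integral_surfaceMeasure x₀ hr.le (by fun_prop),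
    ← mul_assoc, mul_pow_sub_one hn.ne', ← integral_const_mul]
  refine integral_congr_ae (ae_of_all _ fun θ => ?_)
  have hθ : ‖(θ : EuclideanSpace ℝ (Fin n))‖ = 1 := by simp
  have e1 : Set.EqOn (fun s : ℝ => s ^ (n - 1) * (ball (0 : EuclideanSpace ℝ (Fin n)) r).indicator
      (fun y => p (x₀ + y)) (s • (θ : EuclideanSpace ℝ (Fin n))))
      ((Set.Iio r).indicator fun s => s ^ (n - 1) * p (x₀ + s • (θ : EuclideanSpace ℝ (Fin n))))
      (Set.Ioi 0) := by
    intro s hs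
    have hs' : ‖s • (θ : EuclideanSpace ℝ (Fin n))‖ = s := by
      rw [norm_smul, hθ, mul_one, Real.norm_of_nonneg (le_of_lt hs)]
    by_cases hsr : s < r
    · simp [hsr, hs']
    · simp [hsr, hs']
  beta_reduce
  rw [setIntegral_congr_fun measurableSet_Ioi e1, setIntegral_indicator measurableSet_Iio,
    Set.Ioi_inter_Iio, ← integral_Ioc_eq_integral_Ioo, ← intervalIntegral.integral_of_le hr.le]
  -- Along each ray the integrand is the exact derivative of `sⁿ v²`. The contribution at `s = 0`
  -- vanishes because `n > 0`.
  have hd : ∀ s : ℝ, HasDerivAt (fun s : ℝ => s ^ n * v (x₀ + s • (θ : EuclideanSpace ℝ (Fin n))) ^ 2)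
      (s ^ (n - 1) * p (x₀ + s • (θ : EuclideanSpace ℝ (Fin n)))) s := by
    intro s
    have hl : HasDerivAt (fun s : ℝ => x₀ + s • (θ : EuclideanSpace ℝ (Fin n)))
        (θ : EuclideanSpace ℝ (Fin n)) s := by
      simpa using ((hasDerivAt_id s).smul_const (θ : EuclideanSpace ℝ (Fin n))).const_add x₀
    have h2 := ((hv.differentiable (by simp)
      (x₀ + s • (θ : EuclideanSpace ℝ (Fin n)))).hasFDerivAt.comp_hasDerivAt s hl).pow 2
    refine ((hasDerivAt_pow n s).mul h2).congr_deriv ?_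
    simp only [hp, Function.comp, add_sub_cancel_left, real_inner_smul_left, Pi.pow_apply]
    rw [real_inner_comm, inner_gradient]
    rw [← mul_pow_sub_one hn.ne' s]
    push_cast
    ring
  rw [intervalIntegral.integral_eq_sub_of_hasDerivAt (fun s _ => hd s)]
  · simp [hn.ne']
  · apply Continuous.intervalIntegrable
    fun_prop

theorem tendsto_integral_inner_inner {X V : Type*} [MeasurableSpace X] {μ : Measure X}
    [NormedAddCommGroup V] [InnerProductSpace ℝ V] {ι : Type*} {l : Filter ι}
    {f h : ι → X → V} {f₀ h₀ : X → V}
    (hf : ∀ k, MemLp (f k) 2 μ) (hf₀ : MemLp f₀ 2 μ) (hh : ∀ k, MemLp (h k) 2 μ) (hh₀ : MemLp h₀ 2 μ)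
    (hlf : Tendsto (fun k => eLpNorm (fun x => f k x - f₀ x) 2 μ) l (𝓝 0))
    (hlh : Tendsto (fun k => eLpNorm (fun x => h k x - h₀ x) 2 μ) l (𝓝 0)) :
    Tendsto (fun k => ∫ x, inner ℝ (f k x) (h k x) ∂μ) l (𝓝 (∫ x, inner ℝ (f₀ x) (h₀ x) ∂μ)) := by
  have h1 := (Lp.tendsto_Lp_iff_tendsto_eLpNorm'' f hf f₀ hf₀).2 hlf
  have h2 := (Lp.tendsto_Lp_iff_tendsto_eLpNorm'' h hh h₀ hh₀).2 hlh
  have key : ∀ (a b : X → V) (ha : MemLp a 2 μ) (hb : MemLp b 2 μ),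
      inner ℝ (ha.toLp a) (hb.toLp b) = ∫ x, inner ℝ (a x) (b x) ∂μ := by
    intro a b ha hb
    rw [L2.inner_def]
    refine integral_congr_ae ?_
    filter_upwards [ha.coeFn_toLp, hb.coeFn_toLp] with x h1 h2
    rw [h1, h2]
  have := h1.inner (𝕜 := ℝ) h2
  simpa only [key] using this

theorem eLpNorm_two_sq {X V : Type*} [MeasurableSpace X] [NormedAddCommGroup V] {μ : Measure X}
    {f : X → V} (hf : MemLp f 2 μ) : eLpNorm f 2 μ ^ 2 = ENNReal.ofReal (∫ x, ‖f x‖ ^ 2 ∂μ) := by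
  rw [eLpNorm_two_eq, ← ENNReal.rpow_natCast, ← ENNReal.rpow_mul]
  rw [ofReal_integral_eq_lintegral_ofReal (hf.integrable_norm_pow (by simp))
    (ae_of_all _ fun _ => sq_nonneg _)]
  simp [ENNReal.ofReal_pow]

section
variable {n : ℕ} {x₀ : EuclideanSpace ℝ (Fin n)} {r : ℝ} {w : EuclideanSpace ℝ (Fin n) → ℝ}
  {g : EuclideanSpace ℝ (Fin n) → EuclideanSpace ℝ (Fin n)}

/-- The trace inequality for smooth functions on a ball. -/
theorem eLpNorm_surface_sq_le (hn : 0 < n) (hr : 0 < r)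
    {v : EuclideanSpace ℝ (Fin n) → ℝ} (hv : ContDiff ℝ ∞ v) :
    eLpNorm v 2 (surfaceMeasure x₀ r) ^ 2 ≤ ENNReal.ofReal ((n + r) / r)
      * (eLpNorm v 2 (volume.restrict (ball x₀ r)) ^ 2
        + eLpNorm (gradient v) 2 (volume.restrict (ball x₀ r)) ^ 2) * ENNReal.ofReal (1 + r) := by
  have h1 := memLp_surfaceMeasure_of_continuous x₀ r hv.continuous 2
  have h2 := memLp_ball_of_continuous hv.continuous 2 x₀ r
  have h3 := memLp_ball_of_continuous (continuous_gradient hv) 2 x₀ r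
  have i2 : Integrable (fun x => ‖v x‖ ^ 2) (volume.restrict (ball x₀ r)) :=
    h2.integrable_norm_pow (by simp)
  have i3 : Integrable (fun x => ‖gradient v x‖ ^ 2) (volume.restrict (ball x₀ r)) :=
    h3.integrable_norm_pow (by simp)
  rw [eLpNorm_two_sq h1, eLpNorm_two_sq h2, eLpNorm_two_sq h3,
    ← ENNReal.ofReal_add (by positivity) (by positivity), ← ENNReal.ofReal_mul (by positivity),
    ← ENNReal.ofReal_mul (by positivity)]
  apply ENNReal.ofReal_le_ofReal
  have hs := setIntegral_ball_eq_surface hn x₀ hr hv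
  simp only [Real.norm_eq_abs, sq_abs] at i2 ⊢
  rw [← integral_add i2 i3, div_mul_eq_mul_div, div_mul_eq_mul_div, le_div_iff₀ hr, mul_comm, ← hs,
    mul_assoc, mul_comm _ (1 + r), ← mul_assoc, ← integral_const_mul]
  have hgc := continuous_gradient hv
  have hvc := hv.continuous
  have hint : ∀ p : EuclideanSpace ℝ (Fin n) → ℝ, Continuous p →
      Integrable p (volume.restrict (ball x₀ r)) := fun p hp =>
    (hp.continuousOn.integrableOn_compact (isCompact_closedBall x₀ r)).mono_set ball_subset_closedBall
  refine integral_mono_ae (hint _ (by fun_prop)) (hint _ (by fun_prop)) ?_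
  filter_upwards [ae_restrict_mem measurableSet_ball] with x hx
  rw [mem_ball, dist_eq_norm] at hx
  have hin : inner ℝ (x - x₀) (gradient v x) ≤ ‖x - x₀‖ * ‖gradient v x‖ := real_inner_le_norm _ _
  have hin' : |inner ℝ (x - x₀) (gradient v x)| ≤ ‖x - x₀‖ * ‖gradient v x‖ :=
    abs_real_inner_le_norm _ _
  have h4 : v x * inner ℝ (x - x₀) (gradient v x) ≤ |v x| * (r * ‖gradient v x‖) := by
    refine (le_abs_self _).trans ?_
    rw [abs_mul]
    exact mul_le_mul_of_nonneg_left
      (hin'.trans (mul_le_mul_of_nonneg_right hx.le (norm_nonneg _))) (abs_nonneg _)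
  have h5 : 2 * (|v x| * ‖gradient v x‖) ≤ v x ^ 2 + ‖gradient v x‖ ^ 2 := by
    rw [← sq_abs (v x)]
    nlinarith [sq_nonneg (|v x| - ‖gradient v x‖)]
  have h6 : (0:ℝ) ≤ n := Nat.cast_nonneg n
  have h7 : (1:ℝ) ≤ n := by exact_mod_cast hn
  have h8 : 0 ≤ v x ^ 2 := sq_nonneg _
  have h9 : 0 ≤ ‖gradient v x‖ ^ 2 := sq_nonneg _
  have h10 : 2 * (v x * inner ℝ (x - x₀) (gradient v x)) ≤ r * (v x ^ 2 + ‖gradient v x‖ ^ 2) := by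
    nlinarith
  have h11 : (n : ℝ) * v x ^ 2 ≤ n * (v x ^ 2 + ‖gradient v x‖ ^ 2) :=
    mul_le_mul_of_nonneg_left (by linarith) h6
  -- The factor `1 + r` in the constant is slack: the preceding bounds already give the inequality
  -- with `n + r` alone.
  have h12 : (n + r) * (v x ^ 2 + ‖gradient v x‖ ^ 2)
      ≤ (1 + r) * (n + r) * (v x ^ 2 + ‖gradient v x‖ ^ 2) := by
    refine mul_le_mul_of_nonneg_right ?_ (by positivity)
    nlinarith
  linarith

/-- Existence of the trace on a sphere inside the domain. -/
theorem MemH1Loc.exists_isSphereTrace {Ω : Set (EuclideanSpace ℝ (Fin n))} (hn : 0 < n)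
    (hw : MemH1Loc Ω w g) (hr : 0 < r) {R : ℝ} (hrR : r < R) (hR : closedBall x₀ R ⊆ Ω) :
    ∃ T, IsSphereTrace x₀ r w g T := by
  obtain ⟨v, hvs, hv, hvg⟩ := hw.exists_smooth_approx hrR hR
  rw [restrict_closedBall_eq x₀ hr.ne'] at hv hvg
  have hsubΩ : closedBall x₀ r ⊆ Ω := (closedBall_subset_closedBall hrR.le).trans hR
  obtain ⟨hw2, hg2⟩ := hw.memLp_ball hsubΩ
  set μ := volume.restrict (ball x₀ r) with hμ
  set σ := surfaceMeasure x₀ r with hσ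
  have hvσ : ∀ k, MemLp (v k) 2 σ := fun k =>
    memLp_surfaceMeasure_of_continuous x₀ r (hvs k).continuous 2
  have cauchy : ∀ {V : Type} [NormedAddCommGroup V] (q : ℕ → EuclideanSpace ℝ (Fin n) → V)
      (q₀ : EuclideanSpace ℝ (Fin n) → V), (∀ k, AEStronglyMeasurable (q k) μ) →
      AEStronglyMeasurable q₀ μ →
      Tendsto (fun k => eLpNorm (fun x => q k x - q₀ x) 2 μ) atTop (𝓝 0) →
      Tendsto (fun k : ℕ × ℕ => eLpNorm (fun x => q k.1 x - q k.2 x) 2 μ) atTop (𝓝 0) := by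
    intro V _ q q₀ hq hq₀ hlim
    have h1 : Tendsto (fun k : ℕ × ℕ => eLpNorm (fun x => q k.1 x - q₀ x) 2 μ
        + eLpNorm (fun x => q k.2 x - q₀ x) 2 μ) atTop (𝓝 0) := by
      rw [← prod_atTop_atTop_eq]
      simpa using (hlim.comp tendsto_fst).add (hlim.comp tendsto_snd)
    refine tendsto_of_tendsto_of_tendsto_of_le_of_le tendsto_const_nhds h1 (fun _ => zero_le)
      fun k => ?_
    have := eLpNorm_sub_le ((hq k.1).sub hq₀) ((hq k.2).sub hq₀) (p := 2) (by norm_num)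
    refine le_trans (le_of_eq (eLpNorm_congr_ae (ae_of_all _ fun x => ?_))) this
    simp
  have c1 := cauchy v w (fun k => (hvs k).continuous.aestronglyMeasurable) hw2.1 hv
  have c2 := cauchy (fun k => gradient (v k)) g
    (fun k => (continuous_gradient (hvs k)).aestronglyMeasurable) hg2.1 hvg
  -- The trace inequality applied to differences of the approximants makes their restrictions Cauchy
  -- in `L²` of the sphere; completeness supplies the trace.
  have c3 : Tendsto (fun k : ℕ × ℕ => eLpNorm (fun x => v k.1 x - v k.2 x) 2 σ ^ 2) atTop (𝓝 0) := by
    have h0 : Tendsto (fun k : ℕ × ℕ => ENNReal.ofReal ((n + r) / r)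
        * (eLpNorm (fun x => v k.1 x - v k.2 x) 2 μ ^ 2
        + eLpNorm (fun x => gradient (v k.1) x - gradient (v k.2) x) 2 μ ^ 2)
        * ENNReal.ofReal (1 + r)) atTop (𝓝 0) := by
      have e1 := (ENNReal.Tendsto.pow (n := 2) c1).add (ENNReal.Tendsto.pow (n := 2) c2)
      have e2 := ENNReal.Tendsto.mul_const (ENNReal.Tendsto.const_mul e1
        (Or.inr (ENNReal.ofReal_ne_top (r := (n + r) / r))))
        (Or.inr (ENNReal.ofReal_ne_top (r := 1 + r)))
      simpa using e2
    refine tendsto_of_tendsto_of_tendsto_of_le_of_le tendsto_const_nhds h0 (fun _ => zero_le)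
      fun k => ?_
    refine (eLpNorm_surface_sq_le hn hr ((hvs k.1).sub (hvs k.2))).trans (le_of_eq ?_)
    have : (gradient fun x => v k.1 x - v k.2 x) = fun x => gradient (v k.1) x - gradient (v k.2) x := by
      ext1 x
      refine gradient_eq_of_fderiv fun e => ?_
      rw [fderiv_fun_sub ((hvs k.1).differentiable (by simp) x) ((hvs k.2).differentiable (by simp) x),
        inner_sub_left, inner_gradient, inner_gradient]
      rfl
    rw [this]
  have c4 : Tendsto (fun k : ℕ × ℕ => eLpNorm (v k.1 - v k.2) 2 σ) atTop (𝓝 0) := by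
    have := (ENNReal.continuous_rpow_const (y := 1/2)).tendsto 0 |>.comp c3
    have h2 : ∀ a : ℝ≥0∞, (a ^ 2) ^ (1/2 : ℝ) = a := fun a => by
      rw [← ENNReal.rpow_natCast, ← ENNReal.rpow_mul]; norm_num
    simp only [Function.comp_def, h2] at this
    rw [ENNReal.zero_rpow_of_pos (by norm_num)] at this
    exact this
  have hcs : CauchySeq fun k => (hvσ k).toLp (v k) := by
    rw [Lp.cauchySeq_Lp_iff_cauchySeq_eLpNorm]
    refine c4.congr fun k => eLpNorm_congr_ae ?_
    filter_upwards [(hvσ k.1).coeFn_toLp, (hvσ k.2).coeFn_toLp] with x h1 h2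
    simp [h1, h2]
  obtain ⟨T, hT⟩ := cauchySeq_tendsto_of_complete hcs
  refine ⟨T, Lp.aestronglyMeasurable T, v, hvs, hv, hvg, ?_⟩
  have := (Lp.tendsto_Lp_iff_tendsto_eLpNorm' _ _).1 hT
  refine this.congr fun k => eLpNorm_congr_ae ?_
  filter_upwards [(hvσ k).coeFn_toLp] with x h1
  simp [h1]

/-- The `L²` norm of a trace, expressed by integrals over the ball. -/
theorem IsSphereTrace.integral_sq (hn : 0 < n) (hr : 0 < r)
    (hw2 : MemLp w 2 (volume.restrict (ball x₀ r))) (hg2 : MemLp g 2 (volume.restrict (ball x₀ r)))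
    {T : EuclideanSpace ℝ (Fin n) → ℝ} (hT : IsSphereTrace x₀ r w g T) :
    MemLp T 2 (surfaceMeasure x₀ r) ∧ r * ∫ x, T x ^ 2 ∂(surfaceMeasure x₀ r)
      = ∫ x in ball x₀ r, (n * w x ^ 2 + 2 * (‖x - x₀‖ * (w x * radialDeriv x₀ g x))) := by
  obtain ⟨hTm, v, hvs, hv, hvg, hvT⟩ := hT
  set μ := volume.restrict (ball x₀ r) with hμ
  set σ := surfaceMeasure x₀ r with hσ
  have hvσ : ∀ k, MemLp (v k) 2 σ := fun k =>
    memLp_surfaceMeasure_of_continuous x₀ r (hvs k).continuous 2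
  have hvμ : ∀ k, MemLp (v k) 2 μ := fun k => memLp_ball_of_continuous (hvs k).continuous 2 _ _
  have hgμ : ∀ k, MemLp (gradient (v k)) 2 μ := fun k =>
    memLp_ball_of_continuous (continuous_gradient (hvs k)) 2 _ _
  have hT2 : MemLp T 2 σ := by
    obtain ⟨k, hk⟩ := (hvT.eventually (gt_mem_nhds ENNReal.zero_lt_top)).exists
    have h1 : MemLp (fun x => v k x - T x) 2 σ := ⟨(hvσ k).1.sub hTm, hk⟩
    have h2 := (hvσ k).sub h1
    refine h2.ae_eq (ae_of_all _ fun x => ?_)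
    simp
  refine ⟨hT2, ?_⟩
  have smulMem : ∀ (q : EuclideanSpace ℝ (Fin n) → ℝ), MemLp q 2 μ →
      MemLp (fun x => q x • (x - x₀)) 2 μ := fun q hq => by
    have h1 : MemLp (fun x => ‖x - x₀‖ * q x) 2 μ := memLp_ball_continuous_mul (by fun_prop) hq
    refine h1.mono ?_ (ae_of_all _ fun x => by simp [norm_smul, mul_comm])
    exact hq.1.smul
      (by fun_prop : Continuous fun x : EuclideanSpace ℝ (Fin n) => x - x₀).aestronglyMeasurable
  have l1 := tendsto_integral_inner_inner hvσ hT2 hvσ hT2 hvT hvT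
  have l2 := tendsto_integral_inner_inner hvμ hw2 hvμ hw2 hv hv
  have hvs' : Tendsto (fun k => eLpNorm (fun x => v k x • (x - x₀) - w x • (x - x₀)) 2 μ)
      atTop (𝓝 0) := by
    have h0 := ENNReal.Tendsto.const_mul hv (Or.inr (ENNReal.ofReal_ne_top (r := r)))
    rw [mul_zero] at h0
    refine tendsto_of_tendsto_of_tendsto_of_le_of_le tendsto_const_nhds h0 (fun _ => zero_le)
      fun k => ?_
    refine eLpNorm_le_mul_eLpNorm_of_ae_le_mul ?_ 2
    filter_upwards [ae_restrict_mem measurableSet_ball] with x hx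
    rw [mem_ball, dist_eq_norm] at hx
    rw [← sub_smul, norm_smul, mul_comm]
    gcongr
  have l3 := tendsto_integral_inner_inner (fun k => smulMem _ (hvμ k)) (smulMem _ hw2) hgμ hg2 hvs' hvg
  have e : ∀ (a : EuclideanSpace ℝ (Fin n) → ℝ)
      (b : EuclideanSpace ℝ (Fin n) → EuclideanSpace ℝ (Fin n)), MemLp a 2 μ → MemLp b 2 μ →
      ∫ x, (n * a x ^ 2 + 2 * (a x * inner ℝ (x - x₀) (b x))) ∂μ
      = n * (∫ x, inner ℝ (a x) (a x) ∂μ) + 2 * ∫ x, inner ℝ (a x • (x - x₀)) (b x) ∂μ := by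
    intro a b ha hb
    rw [← integral_const_mul, ← integral_const_mul, ← integral_add]
    · refine integral_congr_ae (ae_of_all _ fun x => ?_)
      simp only [real_inner_smul_left, RCLike.inner_apply, conj_trivial]
      ring
    · refine Integrable.const_mul ?_ _
      refine ha.integrable_sq.congr (ae_of_all _ fun x => ?_)
      simp
    · refine Integrable.const_mul ?_ _
      have hq := smulMem a ha
      refine ((hq.norm.integrable_mul hb.norm).mono (hq.1.inner hb.1) (ae_of_all _ fun x => ?_))
      simpa using abs_real_inner_le_norm (a x • (x - x₀)) (b x)
  have l4 := (l2.const_mul (n : ℝ)).add (l3.const_mul 2)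
  have l5 := l1.const_mul r
  have hk : ∀ k, r * ∫ x, inner ℝ (v k x) (v k x) ∂σ = n * (∫ x, inner ℝ (v k x) (v k x) ∂μ)
      + 2 * ∫ x, inner ℝ (v k x • (x - x₀)) (gradient (v k) x) ∂μ := fun k => by
    rw [← e _ _ (hvμ k) (hgμ k), hμ, setIntegral_ball_eq_surface hn x₀ hr (hvs k)]
    congr 1
    refine integral_congr_ae (ae_of_all _ fun x => ?_)
    simp
  have := tendsto_nhds_unique l5 (l4.congr fun k => (hk k).symm)
  rw [← e _ _ hw2 hg2] at this
  convert this using 2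
  · refine integral_congr_ae (ae_of_all _ fun x => ?_)
    simp
  · ext x
    rw [← norm_mul_radialDeriv]
    ring

/-- The ball formula holds for every trace, so the choice made in `sphereTrace` does not matter. It
lets the boundary term of `Φ` be treated by the same integration over layers as the energy; the room
between `r` and `R` guarantees that a trace exists. -/
theorem mul_boundaryIntegral {m : ℕ} {Ω : Set (EuclideanSpace ℝ (Fin n))} (hn : 0 < n)
    {u : EuclideanSpace ℝ (Fin n) → EuclideanSpace ℝ (Fin m)}
    {G : Fin m → EuclideanSpace ℝ (Fin n) → EuclideanSpace ℝ (Fin n)}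
    (hu : ∀ i, MemH1Loc Ω (fun x => u x i) (G i)) (hr : 0 < r) {R : ℝ} (hrR : r < R)
    (hR : closedBall x₀ R ⊆ Ω) :
    r * boundaryIntegral x₀ r u G
      = ∫ x in ball x₀ r, ∑ i, (n * u x i ^ 2 + 2 * (‖x - x₀‖ * (u x i * radialDeriv x₀ (G i) x))) := by
  have hsubΩ : closedBall x₀ r ⊆ Ω := (closedBall_subset_closedBall hrR.le).trans hR
  have hT : ∀ i, IsSphereTrace x₀ r (fun y => u y i) (G i)
      (sphereTrace x₀ r (fun y => u y i) (G i)) := fun i => by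
    have hex := (hu i).exists_isSphereTrace hn hr hrR hR
    rw [sphereTrace, dif_pos hex]
    exact hex.choose_spec
  have hi := fun i => (hT i).integral_sq hn hr ((hu i).memLp_ball hsubΩ).1
    ((hu i).memLp_ball hsubΩ).2
  rw [boundaryIntegral, integral_finsetSum _ fun i _ => (hi i).1.integrable_sq, Finset.mul_sum,
    integral_finsetSum]
  · exact Finset.sum_congr rfl fun i _ => (hi i).2
  · intro i _
    obtain ⟨h1, h2⟩ := (hu i).memLp_ball hsubΩ
    exact (h1.integrable_sq.const_mul _).add ((integrableOn_ball_continuous_mul (by fun_prop)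
      (h1.integrable_mul (MemLp.radialDeriv h2))).const_mul 2)

end


/-! ### The monotonicity formula. -/

section
variable {n m : ℕ} {Ω : Set (EuclideanSpace ℝ (Fin n))} {F : EuclideanSpace ℝ (Fin m) → ℝ}
  {u : EuclideanSpace ℝ (Fin n) → EuclideanSpace ℝ (Fin m)}
  {G : Fin m → EuclideanSpace ℝ (Fin n) → EuclideanSpace ℝ (Fin n)}
  {x₀ : EuclideanSpace ℝ (Fin n)} {r r₁ r₂ R β : ℝ} {χ : ℝ → ℝ}

theorem inner_gradient_eq_sum (F : EuclideanSpace ℝ (Fin m) → ℝ) (y : EuclideanSpace ℝ (Fin m)) :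
    inner ℝ y (gradient F y) = ∑ i, y i * gradient F y i := by
  rw [PiLp.inner_apply]
  exact Finset.sum_congr rfl fun i _ => by simp [mul_comm]

theorem IsVariationalSolution.integrableOn_inner (hu : IsVariationalSolution Ω F u G)
    (hr : closedBall x₀ r ⊆ Ω) :
    IntegrableOn (fun x => inner ℝ (u x) (gradient F (u x))) (ball x₀ r) := by
  simp only [inner_gradient_eq_sum]
  exact integrable_finsetSum _ fun i _ =>
    LocallyIntegrableOn.integrableOn_ball (hu.locInt_uf i) hr

theorem IsVariationalSolution.radial_test_self (hu : IsVariationalSolution Ω F u G)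
    (h₁ : 0 < r₁) (h : r₁ ≤ r₂) (hrR : r₂ < R) (hR : closedBall x₀ R ⊆ Ω) (hχ : IsWeight r₁ r₂ χ) :
    ∫ x in ball x₀ r₂, radialCutoff x₀ r₂ χ x
        * (gradSq G x - inner ℝ (u x) (gradient F (u x)))
      = ∫ x in ball x₀ r₂, χ ‖x - x₀‖ * ∑ i, u x i * radialDeriv x₀ (G i) x := by
  have hsubΩ : closedBall x₀ r₂ ⊆ Ω := (closedBall_subset_closedBall hrR.le).trans hR
  have hηs : ContDiff ℝ ∞ (radialCutoff x₀ r₂ χ) := hχ.contDiff_radialCutoff h₁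
  have hχn : Continuous fun x : EuclideanSpace ℝ (Fin n) => χ ‖x - x₀‖ :=
    hχ.smooth.continuous.comp (by fun_prop)
  simp only [inner_gradient_eq_sum, gradSq, ← Finset.sum_sub_distrib, Finset.mul_sum]
  rw [integral_finsetSum, integral_finsetSum]
  · exact Finset.sum_congr rfl fun i _ => (hu.memH1Loc i).radial_test_self (hu.locInt_f i)
      (hu.locInt_uf i) (hu.distributional i) h₁ h hrR hR hχ
  · intro i _
    obtain ⟨h1, h2⟩ := (hu.memH1Loc i).memLp_ball hsubΩ
    exact integrableOn_ball_continuous_mul hχn (h1.integrable_mul (MemLp.radialDeriv h2))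
  · intro i _
    obtain ⟨h1, h2⟩ := (hu.memH1Loc i).memLp_ball hsubΩ
    have h3 : IntegrableOn (fun x => ‖G i x‖ ^ 2) (ball x₀ r₂) := h2.integrable_norm_pow (by simp)
    exact integrableOn_ball_continuous_mul hηs.continuous
      (h3.sub (LocallyIntegrableOn.integrableOn_ball (hu.locInt_uf i) hsubΩ))

theorem integrableOn_radial_terms (hu : ∀ i, MemH1Loc Ω (fun x => u x i) (G i))
    (hr : closedBall x₀ r ⊆ Ω) :
    IntegrableOn (fun x => ∑ i, radialDeriv x₀ (G i) x ^ 2) (ball x₀ r) ∧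
    IntegrableOn (fun x => ∑ i, u x i * radialDeriv x₀ (G i) x) (ball x₀ r) ∧
    IntegrableOn (fun x => ∑ i, u x i ^ 2) (ball x₀ r) :=
  ⟨integrable_finsetSum _ fun i _ =>
      (MemLp.radialDeriv ((hu i).memLp_ball hr).2).integrable_sq,
    integrable_finsetSum _ fun i _ => ((hu i).memLp_ball hr).1.integrable_mul
      (MemLp.radialDeriv ((hu i).memLp_ball hr).2),
    integrable_finsetSum _ fun i _ => ((hu i).memLp_ball hr).1.integrable_sq⟩

theorem radial_divergence_sum (hu : ∀ i, MemH1Loc Ω (fun x => u x i) (G i))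
    (h₁ : 0 < r₁) (h : r₁ ≤ r₂) (hrR : r₂ < R) (hR : closedBall x₀ R ⊆ Ω) (hχ : IsWeight r₁ r₂ χ) :
    ∫ x in ball x₀ r₂, radialCutoff x₀ r₂ χ x
        * ∑ i, (n * u x i ^ 2 + 2 * (‖x - x₀‖ * (u x i * radialDeriv x₀ (G i) x)))
      = ∫ x in ball x₀ r₂, χ ‖x - x₀‖ * (‖x - x₀‖ * ∑ i, u x i ^ 2) := by
  have hsubΩ : closedBall x₀ r₂ ⊆ Ω := (closedBall_subset_closedBall hrR.le).trans hR
  have hηs : ContDiff ℝ ∞ (radialCutoff x₀ r₂ χ) := hχ.contDiff_radialCutoff h₁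
  have hχn : Continuous fun x : EuclideanSpace ℝ (Fin n) => χ ‖x - x₀‖ :=
    hχ.smooth.continuous.comp (by fun_prop)
  simp only [Finset.mul_sum]
  rw [integral_finsetSum, integral_finsetSum]
  · exact Finset.sum_congr rfl fun i _ => (hu i).radial_divergence h₁ h hrR hR hχ
  · intro i _
    obtain ⟨h1, h2⟩ := (hu i).memLp_ball hsubΩ
    exact integrableOn_ball_continuous_mul hχn
      (integrableOn_ball_continuous_mul (by fun_prop) h1.integrable_sq)
  · intro i _
    obtain ⟨h1, h2⟩ := (hu i).memLp_ball hsubΩ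
    exact integrableOn_ball_continuous_mul hηs.continuous ((h1.integrable_sq.const_mul _).add
      ((integrableOn_ball_continuous_mul (by fun_prop)
        (h1.integrable_mul (MemLp.radialDeriv h2))).const_mul 2))

theorem continuousOn_rpow_Icc (h₁ : 0 < r₁) (a : ℝ) :
    ContinuousOn (fun t : ℝ => t ^ a) (Set.Icc r₁ r₂) := fun t ht =>
  (Real.continuousAt_rpow_const t a (Or.inl (h₁.trans_le ht.1).ne')).continuousWithinAt

/-- Weiss' monotonicity formula. -/
theorem IsVariationalSolution.Phi_sub (hn : 0 < n) (hu : IsVariationalSolution Ω F u G)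
    (h₁ : 0 < r₁) (h : r₁ ≤ r₂) (hrR : r₂ < R) (hR : closedBall x₀ R ⊆ Ω) :
    Phi F u G x₀ β r₂ - Phi F u G x₀ β r₁
      = 2 * (∫ x in annulus x₀ r₁ r₂, ‖x - x₀‖ ^ (-(n : ℝ) - 2 * β + 2)
          * ∑ i, (radialDeriv x₀ (G i) x - β * u x i / ‖x - x₀‖) ^ 2)
        + 2 * ∫ t in r₁..r₂, t ^ (-(n : ℝ) - 2 * β + 1)
          * ∫ x in ball x₀ t, (2 * (β - 1) * F (u x) - β * inner ℝ (u x) (gradient F (u x))) := by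
  set a : ℝ := -(n : ℝ) - 2 * β + 2 with ha
  have ha1 : -(n : ℝ) - 2 * β + 1 = a - 1 := by rw [ha]; ring
  have h2 : 0 < r₂ := h₁.trans_le h
  have hsubΩ : closedBall x₀ r₂ ⊆ Ω := (closedBall_subset_closedBall hrR.le).trans hR
  have hsub1 : closedBall x₀ r₁ ⊆ Ω := (closedBall_subset_closedBall h).trans hsubΩ
  -- integrability on the ball
  obtain ⟨iN, iS, iU⟩ := integrableOn_radial_terms hu.memH1Loc hsubΩ
  have ig := hu.integrableOn_gradSq hsubΩ
  have iF := LocallyIntegrableOn.integrableOn_ball hu.locInt_F hsubΩ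
  have iH := hu.integrableOn_inner hsubΩ
  have ie : IntegrableOn (fun x => gradSq G x - 2 * F (u x)) (ball x₀ r₂) :=
    ig.sub (iF.const_mul 2)
  have hb3 : (fun x => ∑ i, (n * u x i ^ 2 + 2 * (‖x - x₀‖ * (u x i * radialDeriv x₀ (G i) x))))
      = fun x => n * (∑ i, u x i ^ 2)
        + 2 * (‖x - x₀‖ * ∑ i, u x i * radialDeriv x₀ (G i) x) := by
    ext x
    rw [Finset.sum_add_distrib]
    simp only [Finset.mul_sum]
  have iB : IntegrableOn (fun x => ∑ i, (n * u x i ^ 2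
      + 2 * (‖x - x₀‖ * (u x i * radialDeriv x₀ (G i) x)))) (ball x₀ r₂) := by
    rw [hb3]
    exact (iU.const_mul _).add ((integrableOn_ball_continuous_mul (by fun_prop) iS).const_mul 2)
  have hann : annulus x₀ r₁ r₂ ⊆ ball x₀ r₂ := Set.sdiff_subset
  have hpos : ∀ x ∈ annulus x₀ r₁ r₂, 0 < ‖x - x₀‖ := fun x hx => h₁.trans_le (mem_annulus.1 hx).1
  -- integrability of weighted terms on the annulus
  have wN := integrableOn_annulus_radial_mul (continuousOn_rpow_Icc h₁ a) (iN.mono_set hann)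
  have wS := integrableOn_annulus_radial_mul (continuousOn_rpow_Icc h₁ (a - 1)) (iS.mono_set hann)
  have wU := integrableOn_annulus_radial_mul (continuousOn_rpow_Icc h₁ (a - 2)) (iU.mono_set hann)
  have we := integrableOn_annulus_radial_mul (continuousOn_rpow_Icc h₁ a) (ie.mono_set hann)
  have hsm : ∀ b : ℝ, ∀ t : ℝ, 0 < t → ContDiffAt ℝ ∞ (fun t : ℝ => t ^ b) t := fun b t ht =>
    Real.contDiffAt_rpow_const_of_ne ht.ne'
  have hder : ∀ b : ℝ, ∀ t ∈ Set.Icc r₁ r₂, HasDerivAt (fun t : ℝ => t ^ b) (b * t ^ (b - 1)) t :=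
    fun b t ht => Real.hasDerivAt_rpow_const (Or.inl (h₁.trans_le ht.1).ne')
  -- integrated identities
  have iD : IntegrableOn (fun x => n * (gradSq G x - 2 * F (u x)) - 2 * gradSq G x) (ball x₀ r₂) :=
    (ie.const_mul (n : ℝ)).sub (ig.const_mul 2)
  have iD' : IntegrableOn (fun x => (gradSq G x - 2 * F (u x))
      - 2 * ∑ i, radialDeriv x₀ (G i) x ^ 2) (ball x₀ r₂) := ie.sub (iN.const_mul 2)
  have iW : IntegrableOn (fun x => gradSq G x - inner ℝ (u x) (gradient F (u x))) (ball x₀ r₂) :=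
    ig.sub iH
  -- `D`, `W` and `U` are the three test identities. Their weights `t^(a-1)`, `t^(a-1)` and
  -- `t^(a-3)` match the time integrals in the increments `E` and `B` of the two parts of `Φ`, and
  -- leave the annulus powers `a`, `a-1` and `a-2` needed to expand the square.
  have D := intervalIntegral_eq_setIntegral_annulus h₁ h iD
    (integrableOn_ball_continuous_mul (η := fun x => ‖x - x₀‖) (by fun_prop) iD')
    (fun χ hχ => hu.radial_domainVariation h₁ hsubΩ hχ) (hsm (a - 1))
  have W := intervalIntegral_eq_setIntegral_annulus h₁ h iW iS
    (fun χ hχ => hu.radial_test_self h₁ h hrR hR hχ) (hsm (a - 1))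
  have U := intervalIntegral_eq_setIntegral_annulus h₁ h iB
    (integrableOn_ball_continuous_mul (η := fun x => ‖x - x₀‖) (by fun_prop) iU)
    (fun χ hχ => radial_divergence_sum hu.memH1Loc h₁ h hrR hR hχ) (hsm (a - 3))
  have E := mul_setIntegral_ball_sub h (hder a)
    (continuousOn_const.mul (continuousOn_rpow_Icc h₁ (a - 1))) ie
  have B := mul_setIntegral_ball_sub h (hder (a - 2))
    (continuousOn_const.mul (continuousOn_rpow_Icc h₁ (a - 2 - 1))) iB
  -- the energy in terms of ball integrals
  have hPhi : ∀ r, 0 < r → r < R → Phi F u G x₀ β r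
      = r ^ a * (∫ x in ball x₀ r, (gradSq G x - 2 * F (u x)))
        - β * (r ^ (a - 2) * ∫ x in ball x₀ r, ∑ i, (n * u x i ^ 2
          + 2 * (‖x - x₀‖ * (u x i * radialDeriv x₀ (G i) x)))) := by
    intro r hr hrR'
    rw [Phi, ← mul_boundaryIntegral hn hu.memH1Loc hr hrR' hR, ha1, ← ha,
      show a - 1 = (a - 2) + 1 by ring, Real.rpow_add_one hr.ne']
    ring
  rw [hPhi r₂ h2 hrR, hPhi r₁ h₁ (h.trans_lt hrR), ha1]
  -- linearity of the time integrals
  have sub_ball : ∀ t ∈ Set.uIcc r₁ r₂, ball x₀ t ⊆ ball x₀ r₂ := fun t ht => by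
    rw [Set.uIcc_of_le h] at ht
    exact ball_subset_ball ht.2
  have cw := continuousOn_rpow_Icc (r₂ := r₂) h₁ (a - 1)
  have Xg := intervalIntegrable_mul_setIntegral_ball h cw ig
  have XF := intervalIntegrable_mul_setIntegral_ball h cw iF
  have XH := intervalIntegrable_mul_setIntegral_ball h cw iH
  set xg := ∫ t in r₁..r₂, t ^ (a - 1) * ∫ x in ball x₀ t, gradSq G x with hxg
  set xF := ∫ t in r₁..r₂, t ^ (a - 1) * ∫ x in ball x₀ t, F (u x) with hxF
  set xH := ∫ t in r₁..r₂, t ^ (a - 1) * ∫ x in ball x₀ t, inner ℝ (u x) (gradient F (u x)) with hxH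
  have lin : ∀ c₁ c₂ c₃ : ℝ, ∀ p : EuclideanSpace ℝ (Fin n) → ℝ,
      (∀ x, p x = c₁ * gradSq G x + c₂ * F (u x) + c₃ * inner ℝ (u x) (gradient F (u x))) →
      ∀ c : ℝ, ∫ t in r₁..r₂, (c * t ^ (a - 1)) * ∫ x in ball x₀ t, p x
        = c * (c₁ * xg + c₂ * xF + c₃ * xH) := by
    intro c₁ c₂ c₃ p hp c
    rw [hxg, hxF, hxH, ← intervalIntegral.integral_const_mul, ← intervalIntegral.integral_const_mul,
      ← intervalIntegral.integral_const_mul,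
      ← intervalIntegral.integral_add (Xg.const_mul c₁) (XF.const_mul c₂),
      ← intervalIntegral.integral_add ((Xg.const_mul c₁).add (XF.const_mul c₂)) (XH.const_mul c₃),
      ← intervalIntegral.integral_const_mul]
    refine intervalIntegral.integral_congr fun t ht => ?_
    have s := sub_ball t ht
    simp only [hp]
    have i12 : IntegrableOn (fun x => c₁ * gradSq G x + c₂ * F (u x)) (ball x₀ t) :=
      ((ig.mono_set s).const_mul c₁).add ((iF.mono_set s).const_mul c₂)
    rw [integral_add i12
      ((iH.mono_set s).const_mul c₃), integral_add ((ig.mono_set s).const_mul c₁)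
      ((iF.mono_set s).const_mul c₂), integral_const_mul, integral_const_mul, integral_const_mul]
    ring
  have t1 := lin 1 (-2) 0 (fun x => gradSq G x - 2 * F (u x)) (fun x => by ring) a
  have t2 := lin (n - 2) (-2 * n) 0
    (fun x => n * (gradSq G x - 2 * F (u x)) - 2 * gradSq G x) (fun x => by ring) 1
  have t3 := lin 1 0 (-1) (fun x => gradSq G x - inner ℝ (u x) (gradient F (u x)))
    (fun x => by ring) 1
  have t4 := lin 0 (2 * (β - 1)) (-β)
    (fun x => 2 * (β - 1) * F (u x) - β * inner ℝ (u x) (gradient F (u x))) (fun x => by ring) 1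
  simp only [one_mul] at t2 t3 t4
  -- linearity of the annulus integrals
  set yN := ∫ x in annulus x₀ r₁ r₂, ‖x - x₀‖ ^ a * ∑ i, radialDeriv x₀ (G i) x ^ 2 with hyN
  set yS := ∫ x in annulus x₀ r₁ r₂, ‖x - x₀‖ ^ (a - 1) * ∑ i, u x i * radialDeriv x₀ (G i) x
    with hyS
  set yU := ∫ x in annulus x₀ r₁ r₂, ‖x - x₀‖ ^ (a - 2) * ∑ i, u x i ^ 2 with hyU
  set ye := ∫ x in annulus x₀ r₁ r₂, ‖x - x₀‖ ^ a * (gradSq G x - 2 * F (u x)) with hye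
  have p1 : ∀ x ∈ annulus x₀ r₁ r₂, ‖x - x₀‖ ^ a = ‖x - x₀‖ ^ (a - 1) * ‖x - x₀‖ := fun x hx => by
    rw [← Real.rpow_add_one (hpos x hx).ne']
    congr 1
    ring
  have p2 : ∀ x ∈ annulus x₀ r₁ r₂, ‖x - x₀‖ ^ (a - 1) = ‖x - x₀‖ ^ (a - 2) * ‖x - x₀‖ :=
    fun x hx => by
      rw [← Real.rpow_add_one (hpos x hx).ne']
      congr 1
      ring
  have p3 : ∀ x ∈ annulus x₀ r₁ r₂, ‖x - x₀‖ ^ (a - 2) = ‖x - x₀‖ ^ (a - 3) * ‖x - x₀‖ :=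
    fun x hx => by
      rw [← Real.rpow_add_one (hpos x hx).ne']
      congr 1
      ring
  have y1 : ∫ x in annulus x₀ r₁ r₂, ‖x - x₀‖ ^ (a - 1) * (‖x - x₀‖ * ((gradSq G x - 2 * F (u x))
      - 2 * ∑ i, radialDeriv x₀ (G i) x ^ 2)) = ye - 2 * yN := by
    rw [hye, hyN, ← integral_const_mul, ← integral_sub we (wN.const_mul 2)]
    refine setIntegral_congr_fun measurableSet_annulus fun x hx => ?_
    simp only [p1 x hx]
    ring
  have y2 : ∫ x in annulus x₀ r₁ r₂, ‖x - x₀‖ ^ (a - 3) * (‖x - x₀‖ * ∑ i, u x i ^ 2) = yU := by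
    refine setIntegral_congr_fun measurableSet_annulus fun x hx => ?_
    simp only [p3 x hx]
    ring
  have y3 : ∫ x in annulus x₀ r₁ r₂, ‖x - x₀‖ ^ (a - 2) * ∑ i, (n * u x i ^ 2
      + 2 * (‖x - x₀‖ * (u x i * radialDeriv x₀ (G i) x))) = n * yU + 2 * yS := by
    rw [hyU, hyS, ← integral_const_mul, ← integral_const_mul,
      ← integral_add (wU.const_mul _) (wS.const_mul 2)]
    refine setIntegral_congr_fun measurableSet_annulus fun x hx => ?_
    simp only [congrFun hb3 x, p2 x hx]
    ring
  have y4 : ∫ x in annulus x₀ r₁ r₂, ‖x - x₀‖ ^ a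
      * ∑ i, (radialDeriv x₀ (G i) x - β * u x i / ‖x - x₀‖) ^ 2
      = yN - 2 * β * yS + β ^ 2 * yU := by
    have wNS : IntegrableOn (fun x => ‖x - x₀‖ ^ a * ∑ i, radialDeriv x₀ (G i) x ^ 2
        - 2 * β * (‖x - x₀‖ ^ (a - 1) * ∑ i, u x i * radialDeriv x₀ (G i) x))
        (annulus x₀ r₁ r₂) := wN.sub (wS.const_mul (2 * β))
    rw [hyN, hyS, hyU, ← integral_const_mul, ← integral_const_mul,
      ← integral_sub wN (wS.const_mul _), ← integral_add wNS (wU.const_mul _)]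
    refine setIntegral_congr_fun measurableSet_annulus fun x hx => ?_
    simp only [p1 x hx, p2 x hx]
    have hx0 := (hpos x hx).ne'
    have : ∀ i, (radialDeriv x₀ (G i) x - β * u x i / ‖x - x₀‖) ^ 2
        = radialDeriv x₀ (G i) x ^ 2 - 2 * β / ‖x - x₀‖ * (u x i * radialDeriv x₀ (G i) x)
          + β ^ 2 / ‖x - x₀‖ ^ 2 * u x i ^ 2 := fun i => by
      field_simp
      ring
    simp only [this]
    rw [Finset.sum_add_distrib, Finset.sum_sub_distrib, ← Finset.mul_sum, ← Finset.mul_sum]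
    field_simp
  rw [t2, y1] at D
  rw [t3] at W
  rw [y2] at U
  rw [t1] at E
  have B' : (∫ t in r₁..r₂, ((a - 2) * t ^ (a - 2 - 1)) * ∫ x in ball x₀ t, ∑ i, (n * u x i ^ 2
      + 2 * (‖x - x₀‖ * (u x i * radialDeriv x₀ (G i) x)))) = (a - 2) * yU := by
    rw [← U, ← intervalIntegral.integral_const_mul, show a - 2 - 1 = a - 3 by ring]
    refine intervalIntegral.integral_congr fun t _ => ?_
    simp only
    ring
  rw [B', y3] at B
  rw [t4, y4]
  -- The identity `E - βB` is the increment of `Φ`. `D` eliminates the annulus energy, and since `a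
  -- + n = 2 - 2β` the gradient integrals that remain have coefficient `-2β`, which `W` converts to
  -- `u·f(u)`. The annulus terms left over are `2(yN - 2β yS + β² yU)`, the completed square.
  linear_combination E - β * B - D - 2 * β * W + (2 * xF + β * yU - xg) * ha

end


/-! ### The limit of the energy and growth on small balls. -/

section
variable {n m : ℕ} {Ω : Set (EuclideanSpace ℝ (Fin n))} {F : EuclideanSpace ℝ (Fin m) → ℝ}
  {u : EuclideanSpace ℝ (Fin n) → EuclideanSpace ℝ (Fin m)}
  {G : Fin m → EuclideanSpace ℝ (Fin n) → EuclideanSpace ℝ (Fin n)}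
  {x₀ : EuclideanSpace ℝ (Fin n)} {r r₁ r₂ R β δ : ℝ}

/-- The radial part of the monotonicity formula is controlled by the increment of `Φ`. -/
theorem IsVariationalSolution.annulus_le_Phi_sub (hn : 0 < n) (hu : IsVariationalSolution Ω F u G)
    (hball : ball x₀ δ ⊆ Ω)
    (hβ : ∀ r : ℝ, 0 < r → r < δ →
      0 ≤ ∫ x in ball x₀ r, (2 * (β - 1) * F (u x) - β * inner ℝ (u x) (gradient F (u x))))
    (h₁ : 0 < r₁) (h : r₁ ≤ r₂) (hr : r₂ < δ) :
    2 * (∫ x in annulus x₀ r₁ r₂, ‖x - x₀‖ ^ (-(n : ℝ) - 2 * β + 2)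
          * ∑ i, (radialDeriv x₀ (G i) x - β * u x i / ‖x - x₀‖) ^ 2)
      ≤ Phi F u G x₀ β r₂ - Phi F u G x₀ β r₁ := by
  obtain ⟨R, hR1, hR2⟩ := exists_between hr
  rw [hu.Phi_sub hn h₁ h hR1 ((closedBall_subset_ball hR2).trans hball)]
  refine le_add_of_nonneg_right (mul_nonneg zero_le_two ?_)
  refine intervalIntegral.integral_nonneg h fun t ht => ?_
  have ht0 : 0 < t := h₁.trans_le ht.1
  exact mul_nonneg (Real.rpow_nonneg ht0.le _) (hβ t ht0 (ht.2.trans_lt hr))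

theorem IsVariationalSolution.monotoneOn_Phi (hn : 0 < n) (hu : IsVariationalSolution Ω F u G)
    (hball : ball x₀ δ ⊆ Ω)
    (hβ : ∀ r : ℝ, 0 < r → r < δ →
      0 ≤ ∫ x in ball x₀ r, (2 * (β - 1) * F (u x) - β * inner ℝ (u x) (gradient F (u x)))) :
    MonotoneOn (Phi F u G x₀ β) (Set.Ioo 0 δ) := by
  intro r₁ h₁ r₂ h₂ h
  have h0 := hu.annulus_le_Phi_sub hn hball hβ h₁.1 h h₂.2
  have : 0 ≤ ∫ x in annulus x₀ r₁ r₂, ‖x - x₀‖ ^ (-(n : ℝ) - 2 * β + 2)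
      * ∑ i, (radialDeriv x₀ (G i) x - β * u x i / ‖x - x₀‖) ^ 2 :=
    integral_nonneg fun x => by positivity
  linarith

theorem boundaryIntegral_nonneg : 0 ≤ boundaryIntegral x₀ r u G :=
  integral_nonneg fun _ => Finset.sum_nonneg fun _ _ => sq_nonneg _

theorem GrowthCondition.exists_bound (hg : GrowthCondition F u G x₀ β δ) :
    ∃ C : ℝ, 0 ≤ C ∧ ∀ r ∈ Set.Ioo 0 δ,
      r ^ (-(n : ℝ) - 2 * β + 1) * boundaryIntegral x₀ r u G ≤ C ∧
      r ^ (-(n : ℝ) - 2 * β + 2) * |∫ x in ball x₀ r, 2 * F (u x)| ≤ C := by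
  obtain ⟨C, hC⟩ := hg
  refine ⟨max C 0, le_max_right _ _, fun r hr => ?_⟩
  have h0 : r ^ (-(n : ℝ) - 2 * β + 1) * boundaryIntegral x₀ r u G
      + r ^ (-(n : ℝ) - 2 * β + 2) * |∫ x in ball x₀ r, 2 * F (u x)| ≤ C :=
    hC (Set.mem_image_of_mem _ hr)
  have h1 : 0 ≤ r ^ (-(n : ℝ) - 2 * β + 1) * boundaryIntegral x₀ r u G :=
    mul_nonneg (Real.rpow_nonneg hr.1.le _) boundaryIntegral_nonneg
  have h2 : 0 ≤ r ^ (-(n : ℝ) - 2 * β + 2) * |∫ x in ball x₀ r, 2 * F (u x)| :=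
    mul_nonneg (Real.rpow_nonneg hr.1.le _) (abs_nonneg _)
  have := le_max_left C 0
  constructor <;> linarith

/-- The two quantities differ precisely by the terms that the growth condition controls. The
estimate is used in both directions: to bound `Φ` from below, and to bound the Dirichlet integral
from above. -/
theorem IsVariationalSolution.abs_rpow_mul_gradSq_sub_Phi_le (hu : IsVariationalSolution Ω F u G)
    (hr0 : 0 < r) (hr : closedBall x₀ r ⊆ Ω) {C : ℝ}
    (hC1 : r ^ (-(n : ℝ) - 2 * β + 1) * boundaryIntegral x₀ r u G ≤ C)
    (hC2 : r ^ (-(n : ℝ) - 2 * β + 2) * |∫ x in ball x₀ r, 2 * F (u x)| ≤ C) :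
    |r ^ (-(n : ℝ) - 2 * β + 2) * (∫ x in ball x₀ r, gradSq G x) - Phi F u G x₀ β r|
      ≤ C + |β| * C := by
  have ig := hu.integrableOn_gradSq hr
  have iF := LocallyIntegrableOn.integrableOn_ball hu.locInt_F hr
  rw [Phi, integral_sub ig (iF.const_mul 2)]
  set b := boundaryIntegral x₀ r u G
  set c := ∫ x in ball x₀ r, 2 * F (u x)
  have e : r ^ (-(n : ℝ) - 2 * β + 2) * (∫ x in ball x₀ r, gradSq G x)
      - (r ^ (-(n : ℝ) - 2 * β + 2) * ((∫ x in ball x₀ r, gradSq G x) - c)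
        - β * r ^ (-(n : ℝ) - 2 * β + 1) * b)
      = r ^ (-(n : ℝ) - 2 * β + 2) * c + β * (r ^ (-(n : ℝ) - 2 * β + 1) * b) := by ring
  rw [e]
  refine (abs_add_le _ _).trans (add_le_add ?_ ?_)
  · rwa [abs_mul, abs_of_nonneg (Real.rpow_nonneg hr0.le _)]
  · rw [abs_mul, abs_of_nonneg (mul_nonneg (Real.rpow_nonneg hr0.le _) boundaryIntegral_nonneg)]
    exact mul_le_mul_of_nonneg_left hC1 (abs_nonneg _)

/-- A monotone function bounded below has a finite right limit at the left endpoint. The lower bound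
comes from the nonnegativity of the Dirichlet integral. -/
theorem IsVariationalSolution.exists_tendsto_Phi (hn : 0 < n) (hu : IsVariationalSolution Ω F u G)
    (hδ : 0 < δ) (hball : ball x₀ δ ⊆ Ω)
    (hβ : ∀ r : ℝ, 0 < r → r < δ →
      0 ≤ ∫ x in ball x₀ r, (2 * (β - 1) * F (u x) - β * inner ℝ (u x) (gradient F (u x))))
    (hg : GrowthCondition F u G x₀ β δ) :
    ∃ M : ℝ, Tendsto (Phi F u G x₀ β) (𝓝[>] 0) (𝓝 M) := by
  obtain ⟨C, hC0, hC⟩ := hg.exists_bound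
  have hbdd : BddBelow (Phi F u G x₀ β '' Set.Ioo 0 δ) := by
    refine ⟨-(C + |β| * C), ?_⟩
    rintro _ ⟨r, hr, rfl⟩
    have h1 := hu.abs_rpow_mul_gradSq_sub_Phi_le hr.1
      ((closedBall_subset_ball hr.2).trans hball) (hC r hr).1 (hC r hr).2
    have h3 : 0 ≤ ∫ x in ball x₀ r, gradSq G x :=
      integral_nonneg fun x => Finset.sum_nonneg fun _ _ => sq_nonneg _
    have h2 := mul_nonneg (Real.rpow_nonneg hr.1.le (-(n : ℝ) - 2 * β + 2)) h3
    have := (abs_le.1 h1).2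
    linarith
  exact ⟨_, (hu.monotoneOn_Phi hn hball hβ).tendsto_nhdsWithin_Ioo_right
    (Set.nonempty_Ioo.2 hδ) hbdd⟩

/-- Growth of the Dirichlet integral and of the `L²` norm on balls. -/
theorem IsVariationalSolution.exists_ball_bound (hn : 0 < n) (hu : IsVariationalSolution Ω F u G)
    (hδ : 0 < δ) (hball : ball x₀ δ ⊆ Ω)
    (hβ : ∀ r : ℝ, 0 < r → r < δ →
      0 ≤ ∫ x in ball x₀ r, (2 * (β - 1) * F (u x) - β * inner ℝ (u x) (gradient F (u x))))
    (hg : GrowthCondition F u G x₀ β δ) :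
    ∃ C : ℝ, ∀ r, 0 < r → r ≤ δ / 2 →
      ∫ x in ball x₀ r, gradSq G x ≤ C * r ^ ((n : ℝ) + 2 * β - 2) ∧
      ∫ x in ball x₀ r, ∑ i, u x i ^ 2 ≤ C * r ^ ((n : ℝ) + 2 * β) := by
  obtain ⟨C, hC0, hC⟩ := hg.exists_bound
  -- By monotonicity `Φ(δ/2)` bounds `Φ(r)` for all `r ≤ δ/2`; an interior radius is used because
  -- the hypotheses are available only below `δ`.
  set C₁ := |Phi F u G x₀ β (δ / 2)| + (C + |β| * C) with hC₁
  have hC₁0 : 0 ≤ C₁ := by positivity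
  refine ⟨2 * C + 4 * C₁, fun r hr hrδ => ?_⟩
  have hrδ' : r < δ := by linarith
  obtain ⟨R, hR1, hR2⟩ := exists_between hrδ'
  have hRΩ := (closedBall_subset_ball hR2).trans hball
  have hrΩ := (closedBall_subset_ball hrδ').trans hball
  obtain ⟨hb1, hb2⟩ := hC r ⟨hr, hrδ'⟩
  have h1 := (abs_le.1 (hu.abs_rpow_mul_gradSq_sub_Phi_le hr hrΩ hb1 hb2)).2
  have h2 : Phi F u G x₀ β r ≤ Phi F u G x₀ β (δ / 2) :=
    hu.monotoneOn_Phi hn hball hβ ⟨hr, hrδ'⟩ ⟨by linarith, by linarith⟩ hrδ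
  have h3 : r ^ (-(n : ℝ) - 2 * β + 2) * (∫ x in ball x₀ r, gradSq G x) ≤ C₁ := by
    have := le_abs_self (Phi F u G x₀ β (δ / 2))
    linarith
  have hpow : ∀ a b : ℝ, a + b = 0 → ∀ c q : ℝ, r ^ a * q ≤ c → q ≤ c * r ^ b := by
    intro a b hab c q hq
    have hb : b = -a := by linarith
    rw [hb, Real.rpow_neg hr.le, ← div_eq_mul_inv, le_div_iff₀ (Real.rpow_pos_of_pos hr _), mul_comm]
    exact hq
  have hgrad := hpow _ ((n : ℝ) + 2 * β - 2) (by ring) _ _ h3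
  have hbd := hpow _ ((n : ℝ) + 2 * β - 1) (by ring) _ _ hb1
  refine ⟨hgrad.trans (mul_le_mul_of_nonneg_right (by linarith) (Real.rpow_nonneg hr.le _)), ?_⟩
  have hident := mul_boundaryIntegral hn hu.memH1Loc hr hR1 hRΩ
  obtain ⟨-, iS, iU⟩ := integrableOn_radial_terms hu.memH1Loc hrΩ
  have ig := hu.integrableOn_gradSq hrΩ
  have hn1 : (1 : ℝ) ≤ n := by exact_mod_cast hn
  -- Expanding `(u + 2 (x - x₀)·∇u)² ≥ 0` and using `n ≥ 1` bounds the integrand of the boundary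
  -- formula below by `u²/2 - 2r²|∇u|²`. The bounds on the boundary and Dirichlet integrals then
  -- give the constant `2C + 4C₁`.
  have hle : (1 / 2) * (∫ x in ball x₀ r, ∑ i, u x i ^ 2)
      - 2 * r ^ 2 * (∫ x in ball x₀ r, gradSq G x) ≤ r * boundaryIntegral x₀ r u G := by
    rw [hident, ← integral_const_mul, ← integral_const_mul,
      ← integral_sub (iU.const_mul _) (ig.const_mul _)]
    refine setIntegral_mono_on ((iU.const_mul _).sub (ig.const_mul _)) ?_ measurableSet_ball ?_
    · simp only [Finset.sum_add_distrib, ← Finset.mul_sum]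
      exact (iU.const_mul _).add ((integrableOn_ball_continuous_mul (by fun_prop) iS).const_mul 2)
    · intro x hx
      rw [mem_ball, dist_eq_norm] at hx
      rw [gradSq, Finset.mul_sum, Finset.mul_sum, ← Finset.sum_sub_distrib]
      refine Finset.sum_le_sum fun i _ => ?_
      have hd : |‖x - x₀‖ * radialDeriv x₀ (G i) x| ≤ r * ‖G i x‖ := by
        rw [norm_mul_radialDeriv]
        exact (abs_real_inner_le_norm _ _).trans
          (mul_le_mul_of_nonneg_right hx.le (norm_nonneg _))
      have hd2 : (‖x - x₀‖ * radialDeriv x₀ (G i) x) ^ 2 ≤ (r * ‖G i x‖) ^ 2 :=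
        sq_le_sq' (abs_le.1 hd).1 (abs_le.1 hd).2
      nlinarith [sq_nonneg (u x i + 2 * (‖x - x₀‖ * radialDeriv x₀ (G i) x)), sq_nonneg (u x i),
        mul_nonneg (sub_nonneg.2 hn1) (sq_nonneg (u x i))]
  have p1 : r * r ^ ((n : ℝ) + 2 * β - 1) = r ^ ((n : ℝ) + 2 * β) := by
    rw [mul_comm, ← Real.rpow_add_one hr.ne']
    congr 1
    ring
  have p2 : r ^ 2 * r ^ ((n : ℝ) + 2 * β - 2) = r ^ ((n : ℝ) + 2 * β) := by
    rw [← Real.rpow_natCast, ← Real.rpow_add hr]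
    congr 1
    push_cast
    ring
  have q1 : r * boundaryIntegral x₀ r u G ≤ C * r ^ ((n : ℝ) + 2 * β) := by
    rw [← p1]
    calc _ ≤ r * (C * r ^ ((n : ℝ) + 2 * β - 1)) := mul_le_mul_of_nonneg_left hbd hr.le
      _ = _ := by ring
  have q2 : r ^ 2 * (∫ x in ball x₀ r, gradSq G x) ≤ C₁ * r ^ ((n : ℝ) + 2 * β) := by
    rw [← p2]
    calc _ ≤ r ^ 2 * (C₁ * r ^ ((n : ℝ) + 2 * β - 2)) :=
          mul_le_mul_of_nonneg_left hgrad (sq_nonneg r)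
      _ = _ := by ring
  linarith

end

/-! ### Dilations of measures, integrals and Sobolev functions. -/

section
variable {n : ℕ} {x₀ : EuclideanSpace ℝ (Fin n)} {s : ℝ}

/-- The image of Lebesgue measure under the dilation `x ↦ x₀ + s x`. -/
theorem map_dilation (hs : 0 < s) :
    Measure.map (fun x => x₀ + s • x) (volume : Measure (EuclideanSpace ℝ (Fin n)))
      = ENNReal.ofReal ((s ^ n)⁻¹) • volume := by
  have h1 : (fun x : EuclideanSpace ℝ (Fin n) => x₀ + s • x) = (fun y => x₀ + y) ∘ (fun x => s • x) :=
    rfl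
  rw [h1, ← Measure.map_map (by fun_prop) (by fun_prop), Measure.map_addHaar_smul _ hs.ne',
    Measure.map_smul, map_add_left_eq_self]
  simp [abs_of_pos, hs]

theorem measurableEmbedding_dilation (x₀ : EuclideanSpace ℝ (Fin n)) (hs : 0 < s) :
    MeasurableEmbedding (fun x : EuclideanSpace ℝ (Fin n) => x₀ + s • x) :=
  ((Homeomorph.smulOfNeZero s hs.ne').trans (Homeomorph.addLeft x₀)).measurableEmbedding

theorem map_restrict_dilation (hs : 0 < s) (A : Set (EuclideanSpace ℝ (Fin n))) :
    Measure.map (fun x => x₀ + s • x) (volume.restrict ((fun x => x₀ + s • x) ⁻¹' A))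
      = ENNReal.ofReal ((s ^ n)⁻¹) • volume.restrict A := by
  rw [← (measurableEmbedding_dilation x₀ hs).restrict_map, map_dilation hs, Measure.restrict_smul]

theorem setIntegral_comp_dilation {V : Type*} [NormedAddCommGroup V] [NormedSpace ℝ V] (hs : 0 < s)
    (A : Set (EuclideanSpace ℝ (Fin n))) (f : EuclideanSpace ℝ (Fin n) → V) :
    ∫ x in (fun x => x₀ + s • x) ⁻¹' A, f (x₀ + s • x) = (s ^ n)⁻¹ • ∫ y in A, f y := by
  have := (measurableEmbedding_dilation x₀ hs).integral_map
    (μ := volume.restrict ((fun x => x₀ + s • x) ⁻¹' A)) f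
  rw [← this, map_restrict_dilation hs, integral_smul_measure, ENNReal.toReal_ofReal (by positivity)]

theorem memLp_comp_dilation {V : Type*} [NormedAddCommGroup V] (hs : 0 < s)
    {A : Set (EuclideanSpace ℝ (Fin n))} {f : EuclideanSpace ℝ (Fin n) → V} {p : ℝ≥0∞}
    (hf : MemLp f p (volume.restrict A)) :
    MemLp (fun x => f (x₀ + s • x)) p (volume.restrict ((fun x => x₀ + s • x) ⁻¹' A)) := by
  refine ((measurableEmbedding_dilation x₀ hs).memLp_map_measure_iff (g := f)).1 ?_
  rw [map_restrict_dilation hs]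
  exact hf.smul_measure ENNReal.ofReal_ne_top

theorem IsWeakGradient.mono {Ω D : Set (EuclideanSpace ℝ (Fin n))}
    {w : EuclideanSpace ℝ (Fin n) → ℝ}
    {g : EuclideanSpace ℝ (Fin n) → EuclideanSpace ℝ (Fin n)} (hw : IsWeakGradient Ω w g)
    (hD : D ⊆ Ω) : IsWeakGradient D w g := by
  intro φ hφ v
  have h0 := hw φ ⟨hφ.smooth, hφ.compact, hφ.supp.trans hD⟩ v
  have hs := tsupport_fderiv_apply_subset ℝ (f := φ) v
  have h1 : ∀ A, D ⊆ A → ∀ x ∉ A, w x * fderiv ℝ φ x v = 0 := fun A hA x hx => by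
    rw [image_eq_zero_of_notMem_tsupport (f := fun x => fderiv ℝ φ x v)
      fun h => hx (hA (hφ.supp (hs h))), mul_zero]
  have h2 : ∀ A, D ⊆ A → ∀ x ∉ A, inner ℝ (g x) v * φ x = 0 := fun A hA x hx => by
    rw [image_eq_zero_of_notMem_tsupport fun h => hx (hA (hφ.supp h)), mul_zero]
  rwa [setIntegral_eq_integral_of_forall_compl_eq_zero (h1 D subset_rfl),
    setIntegral_eq_integral_of_forall_compl_eq_zero (h2 D subset_rfl),
    ← setIntegral_eq_integral_of_forall_compl_eq_zero (h1 Ω hD),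
    ← setIntegral_eq_integral_of_forall_compl_eq_zero (h2 Ω hD)]

/-- The weak gradient is tested with `φ` transported by the inverse dilation, whose derivative
produces a factor `s⁻¹`; this accounts for the exponent `1 - β` of the rescaled gradient against
`-β` for the function. -/
theorem MemH1Loc.rescale {Ω : Set (EuclideanSpace ℝ (Fin n))} {w : EuclideanSpace ℝ (Fin n) → ℝ}
    {g : EuclideanSpace ℝ (Fin n) → EuclideanSpace ℝ (Fin n)} (hw : MemH1Loc Ω w g)
    (x₀ : EuclideanSpace ℝ (Fin n)) (β : ℝ) (hs : 0 < s) :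
    MemH1Loc ((fun x => x₀ + s • x) ⁻¹' Ω) (rescale x₀ β s w) (rescaleGrad x₀ β s g) := by
  set T : EuclideanSpace ℝ (Fin n) → EuclideanSpace ℝ (Fin n) := fun x => x₀ + s • x with hT
  let H : EuclideanSpace ℝ (Fin n) ≃ₜ EuclideanSpace ℝ (Fin n) :=
    (Homeomorph.smulOfNeZero s hs.ne').trans (Homeomorph.addLeft x₀)
  have hH : (H : EuclideanSpace ℝ (Fin n) → EuclideanSpace ℝ (Fin n)) = T := rfl
  have hKT : ∀ K, T ⁻¹' (T '' K) = K := fun K => H.injective.preimage_image K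
  refine ⟨fun K hK hKc => ?_, fun K hK hKc => ?_, fun φ hφ v => ?_⟩
  · have := memLp_comp_dilation (x₀ := x₀) hs (hw.memLp (T '' K) (Set.image_subset_iff.2 hK)
      (hKc.image H.continuous))
    rw [hKT] at this
    exact this.const_mul _
  · have := memLp_comp_dilation (x₀ := x₀) hs (hw.memLp_grad (T '' K) (Set.image_subset_iff.2 hK)
      (hKc.image H.continuous))
    rw [hKT] at this
    exact this.const_smul (s ^ (1 - β))
  · let S : EuclideanSpace ℝ (Fin n) → EuclideanSpace ℝ (Fin n) := fun y => s⁻¹ • (y - x₀)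
    have hST : ∀ x, S (T x) = x := fun x => by simp [S, T, smul_smul, hs.ne']
    have hTS : ∀ x, T (S x) = x := fun x => by simp [S, T, smul_smul, hs.ne']
    have hSsm : ContDiff ℝ ∞ S := (contDiff_id.sub contDiff_const).const_smul s⁻¹
    have hsupp : tsupport (φ ∘ S) ⊆ T '' tsupport φ := by
      refine closure_minimal (fun y hy => ?_) (hφ.compact.isCompact.image H.continuous).isClosed
      exact ⟨S y, subset_tsupport _ hy, hTS y⟩
    have htest : IsTestFunction Ω (φ ∘ S) := by
      refine ⟨hφ.smooth.comp hSsm, HasCompactSupport.of_support_subset_isCompact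
        (hφ.compact.isCompact.image H.continuous) (subset_closure.trans hsupp), hsupp.trans ?_⟩
      exact Set.image_subset_iff.2 hφ.supp
    have h0 := hw.weakGrad (φ ∘ S) htest v
    have hfd : ∀ y, fderiv ℝ (φ ∘ S) y v = s⁻¹ * fderiv ℝ φ (S y) v := by
      intro y
      have h1 : HasFDerivAt S (s⁻¹ • ContinuousLinearMap.id ℝ _) y :=
        ((hasFDerivAt_id y).sub_const x₀).const_smul s⁻¹
      rw [((hφ.smooth.differentiable (by simp) (S y)).hasFDerivAt.comp y h1).fderiv]
      simp
    have e1 := setIntegral_comp_dilation (x₀ := x₀) hs Ω (fun y => w y * fderiv ℝ (φ ∘ S) y v)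
    have e2 := setIntegral_comp_dilation (x₀ := x₀) hs Ω (fun y => inner ℝ (g y) v * (φ ∘ S) y)
    rw [h0, smul_neg, ← e2] at e1
    have hST' : ∀ x, S (x₀ + s • x) = x := hST
    simp only [hfd, Function.comp, hST'] at e1
    have e3 : ∫ x in T ⁻¹' Ω, BlowUp.rescale x₀ β s w x * fderiv ℝ φ x v
        = s ^ (1 - β) * ∫ x in T ⁻¹' Ω, w (x₀ + s • x) * (s⁻¹ * fderiv ℝ φ x v) := by
      rw [← integral_const_mul]
      refine integral_congr_ae (ae_of_all _ fun x => ?_)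
      simp only [BlowUp.rescale]
      rw [show (1 - β) = -β + 1 by ring, Real.rpow_add_one hs.ne']
      field_simp
    have e4 : ∫ x in T ⁻¹' Ω, inner ℝ (rescaleGrad x₀ β s g x) v * φ x
        = s ^ (1 - β) * ∫ x in T ⁻¹' Ω, inner ℝ (g (x₀ + s • x)) v * φ x := by
      rw [← integral_const_mul]
      refine integral_congr_ae (ae_of_all _ fun x => ?_)
      simp only [rescaleGrad, real_inner_smul_left]
      ring
    rw [e3, e4, e1]
    ring

theorem preimage_dilation_ball (hs : 0 < s) (R : ℝ) :
    (fun x : EuclideanSpace ℝ (Fin n) => x₀ + s • x) ⁻¹' ball x₀ (s * R) = ball 0 R := by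
  ext x
  simp [dist_eq_norm, norm_smul, abs_of_pos hs, hs]

theorem preimage_dilation_closedBall (hs : 0 < s) (R : ℝ) :
    (fun x : EuclideanSpace ℝ (Fin n) => x₀ + s • x) ⁻¹' closedBall x₀ (s * R) = closedBall 0 R := by
  ext x
  simp [dist_eq_norm, norm_smul, abs_of_pos hs, hs]

end


/-! ### The blow-up sequence: bounds and decay of the defect in Euler's relation. -/

section
variable {n m : ℕ} {Ω : Set (EuclideanSpace ℝ (Fin n))} {F : EuclideanSpace ℝ (Fin m) → ℝ}
  {u : EuclideanSpace ℝ (Fin n) → EuclideanSpace ℝ (Fin m)}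
  {G : Fin m → EuclideanSpace ℝ (Fin n) → EuclideanSpace ℝ (Fin n)}
  {x₀ : EuclideanSpace ℝ (Fin n)} {r₁ r₂ R β δ s : ℝ}

theorem MemH1.mono {D : Set (EuclideanSpace ℝ (Fin n))} {w : EuclideanSpace ℝ (Fin n) → ℝ}
    {g : EuclideanSpace ℝ (Fin n) → EuclideanSpace ℝ (Fin n)} (hw : MemH1 Ω w g) (hD : D ⊆ Ω) :
    MemH1 D w g :=
  ⟨hw.memLp.mono_measure (Measure.restrict_mono hD le_rfl),
    hw.memLp_grad.mono_measure (Measure.restrict_mono hD le_rfl), hw.weakGrad.mono hD⟩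

theorem MemH1Loc.memH1_ball {w : EuclideanSpace ℝ (Fin n) → ℝ}
    {g : EuclideanSpace ℝ (Fin n) → EuclideanSpace ℝ (Fin n)} (hw : MemH1Loc Ω w g)
    (hR : closedBall x₀ R ⊆ Ω) : MemH1 (ball x₀ R) w g :=
  ⟨(hw.memLp_ball hR).1, (hw.memLp_ball hR).2, hw.weakGrad.mono (ball_subset_closedBall.trans hR)⟩

theorem MemH1Loc.rescale_closedBall_subset (hs : 0 < s) (hR : closedBall x₀ (s * R) ⊆ Ω) :
    closedBall 0 R ⊆ (fun x => x₀ + s • x) ⁻¹' Ω := by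
  rw [← preimage_dilation_closedBall (x₀ := x₀) hs]
  exact Set.preimage_mono hR

theorem setIntegral_ball_rescale_sq (hs : 0 < s) (w : EuclideanSpace ℝ (Fin n) → ℝ) :
    ∫ x in ball 0 R, rescale x₀ β s w x ^ 2
      = s ^ (-(n : ℝ) - 2 * β) * ∫ x in ball x₀ (s * R), w x ^ 2 := by
  have h := setIntegral_comp_dilation (x₀ := x₀) hs (ball x₀ (s * R)) (fun y => w y ^ 2)
  rw [preimage_dilation_ball hs, smul_eq_mul] at h
  simp only [rescale, mul_pow]
  rw [integral_const_mul, h, ← mul_assoc, ← Real.rpow_natCast (s ^ (-β)), ← Real.rpow_mul hs.le,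
    ← Real.rpow_natCast s n, ← Real.rpow_neg hs.le, ← Real.rpow_add hs]
  congr 2
  push_cast
  ring

theorem setIntegral_ball_rescaleGrad_sq (hs : 0 < s)
    (g : EuclideanSpace ℝ (Fin n) → EuclideanSpace ℝ (Fin n)) :
    ∫ x in ball 0 R, ‖rescaleGrad x₀ β s g x‖ ^ 2
      = s ^ (-(n : ℝ) - 2 * β + 2) * ∫ x in ball x₀ (s * R), ‖g x‖ ^ 2 := by
  have h := setIntegral_comp_dilation (x₀ := x₀) hs (ball x₀ (s * R)) (fun y => ‖g y‖ ^ 2)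
  rw [preimage_dilation_ball hs, smul_eq_mul] at h
  simp only [rescaleGrad, norm_smul, mul_pow, Real.norm_eq_abs, sq_abs]
  rw [integral_const_mul, h, ← mul_assoc, ← Real.rpow_natCast (s ^ (1 - β)), ← Real.rpow_mul hs.le,
    ← Real.rpow_natCast s n, ← Real.rpow_neg hs.le, ← Real.rpow_add hs]
  congr 2
  push_cast
  ring

/-- The rescaled functions are bounded in `H¹` on every fixed ball. -/
theorem IsVariationalSolution.exists_rescale_bound (hn : 0 < n) (hu : IsVariationalSolution Ω F u G)
    (hδ : 0 < δ) (hball : ball x₀ δ ⊆ Ω)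
    (hβ : ∀ r : ℝ, 0 < r → r < δ →
      0 ≤ ∫ x in ball x₀ r, (2 * (β - 1) * F (u x) - β * inner ℝ (u x) (gradient F (u x))))
    (hg : GrowthCondition F u G x₀ β δ) (hR : 0 < R) :
    ∃ C : ℝ, ∀ s, 0 < s → s * R ≤ δ / 2 → ∀ i,
      MemH1 (ball 0 R) (rescale x₀ β s (fun x => u x i)) (rescaleGrad x₀ β s (G i)) ∧
      (∫ x in ball 0 R, rescale x₀ β s (fun y => u y i) x ^ 2)
        + (∫ x in ball 0 R, ‖rescaleGrad x₀ β s (G i) x‖ ^ 2) ≤ C := by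
  obtain ⟨C, hC⟩ := hu.exists_ball_bound hn hδ hball hβ hg
  refine ⟨C * R ^ ((n : ℝ) + 2 * β) + C * R ^ ((n : ℝ) + 2 * β - 2), fun s hs hsR i => ?_⟩
  have hsR0 : 0 < s * R := mul_pos hs hR
  have hsub : closedBall x₀ (s * R) ⊆ Ω :=
    (closedBall_subset_ball (by linarith)).trans hball
  refine ⟨((hu.memH1Loc i).rescale x₀ β hs).memH1_ball
    (MemH1Loc.rescale_closedBall_subset hs hsub), ?_⟩
  obtain ⟨hC1, hC2⟩ := hC _ hsR0 hsR
  obtain ⟨-, -, iU⟩ := integrableOn_radial_terms hu.memH1Loc hsub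
  have ig := hu.integrableOn_gradSq hsub
  have h1 : ∫ x in ball x₀ (s * R), u x i ^ 2 ≤ C * (s * R) ^ ((n : ℝ) + 2 * β) :=
    (integral_mono_of_nonneg (ae_of_all _ fun x => sq_nonneg _) iU (ae_of_all _ fun x =>
      Finset.single_le_sum (f := fun i => u x i ^ 2) (fun _ _ => sq_nonneg _)
        (Finset.mem_univ i))).trans hC2
  have h2 : ∫ x in ball x₀ (s * R), ‖G i x‖ ^ 2 ≤ C * (s * R) ^ ((n : ℝ) + 2 * β - 2) :=
    (integral_mono_of_nonneg (ae_of_all _ fun x => sq_nonneg _) ig (ae_of_all _ fun x =>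
      Finset.single_le_sum (f := fun i => ‖G i x‖ ^ 2) (fun _ _ => sq_nonneg _)
        (Finset.mem_univ i))).trans hC1
  -- The scaling factor of each norm is exactly reciprocal to its growth rate on balls, so the bound
  -- does not depend on `s`.
  have key : ∀ a b : ℝ, a + b = 0 → ∀ q, q ≤ C * (s * R) ^ b → s ^ a * q ≤ C * R ^ b := by
    intro a b hab q hq
    calc s ^ a * q ≤ s ^ a * (C * (s * R) ^ b) :=
          mul_le_mul_of_nonneg_left hq (Real.rpow_nonneg hs.le _)
      _ = (s ^ a * s ^ b) * (C * R ^ b) := by rw [Real.mul_rpow hs.le hR.le]; ring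
      _ = C * R ^ b := by rw [← Real.rpow_add hs, hab, Real.rpow_zero, one_mul]
  rw [setIntegral_ball_rescale_sq hs, setIntegral_ball_rescaleGrad_sq hs]
  exact add_le_add (key _ _ (by ring) _ h1) (key _ _ (by ring) _ h2)

theorem IsVariationalSolution.eventually_rescale_bound (hn : 0 < n)
    (hu : IsVariationalSolution Ω F u G) (hδ : 0 < δ) (hball : ball x₀ δ ⊆ Ω)
    (hβ : ∀ r : ℝ, 0 < r → r < δ →
      0 ≤ ∫ x in ball x₀ r, (2 * (β - 1) * F (u x) - β * inner ℝ (u x) (gradient F (u x))))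
    (hg : GrowthCondition F u G x₀ β δ) {ρ : ℕ → ℝ} (hρ : ∀ k, 0 < ρ k)
    (hρ0 : Tendsto ρ atTop (𝓝 0)) {D : Set (EuclideanSpace ℝ (Fin n))}
    (hD : Bornology.IsBounded D) :
    ∃ (K : ℕ) (C : ℝ), ∀ k, K ≤ k → ∀ i,
      MemH1 D (rescale x₀ β (ρ k) (fun x => u x i)) (rescaleGrad x₀ β (ρ k) (G i)) ∧
      (∫ x in D, rescale x₀ β (ρ k) (fun y => u y i) x ^ 2)
        + (∫ x in D, ‖rescaleGrad x₀ β (ρ k) (G i) x‖ ^ 2) ≤ C := by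
  obtain ⟨R, hR, hDR⟩ := hD.subset_ball_lt 0 0
  obtain ⟨C, hC⟩ := hu.exists_rescale_bound hn hδ hball hβ hg hR
  have h0 : Tendsto (fun k => ρ k * R) atTop (𝓝 0) := by simpa using hρ0.mul_const R
  obtain ⟨K, hK⟩ := eventually_atTop.1 (h0.eventually (ge_mem_nhds (half_pos hδ)))
  refine ⟨K, C, fun k hk i => ?_⟩
  obtain ⟨h1, h2⟩ := hC (ρ k) (hρ k) (hK k hk) i
  refine ⟨h1.mono hDR, le_trans (add_le_add ?_ ?_) h2⟩
  · exact setIntegral_mono_set h1.memLp.integrable_sq (ae_of_all _ fun _ => sq_nonneg _)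
      hDR.eventuallyLE
  · exact setIntegral_mono_set (h1.memLp_grad.integrable_norm_pow two_ne_zero)
      (ae_of_all _ fun _ => sq_nonneg _) hDR.eventuallyLE

/-- The defect `⟨x, g⟩ - β w` in Euler's relation for functions homogeneous of degree `β`. -/
noncomputable def eulerDefect (x₀ : EuclideanSpace ℝ (Fin n)) (β : ℝ)
    (w : EuclideanSpace ℝ (Fin n) → ℝ)
    (g : EuclideanSpace ℝ (Fin n) → EuclideanSpace ℝ (Fin n)) (x : EuclideanSpace ℝ (Fin n)) : ℝ :=
  inner ℝ (x - x₀) (g x) - β * w x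

theorem MemH1.memLp_eulerDefect {w : EuclideanSpace ℝ (Fin n) → ℝ}
    {g : EuclideanSpace ℝ (Fin n) → EuclideanSpace ℝ (Fin n)} (hw : MemH1 (ball x₀ R) w g) (β : ℝ) :
    MemLp (eulerDefect x₀ β w g) 2 (volume.restrict (ball x₀ R)) := by
  have h1 := memLp_ball_continuous_mul (η := fun x => ‖x - x₀‖) (by fun_prop)
    (MemLp.radialDeriv (x₀ := x₀) hw.memLp_grad)
  simp only [norm_mul_radialDeriv] at h1
  exact h1.sub (hw.memLp.const_mul β)

/-- Multiplying `∂_ν w - β w/|x - x₀|` by `|x - x₀|` gives Euler's defect, which lowers the exponent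
of the weight by two and removes the division by the norm. -/
theorem rpow_mul_radialDeriv_sub_sq {w : EuclideanSpace ℝ (Fin n) → ℝ}
    {g : EuclideanSpace ℝ (Fin n) → EuclideanSpace ℝ (Fin n)} {x : EuclideanSpace ℝ (Fin n)}
    (hx : 0 < ‖x - x₀‖) (a : ℝ) :
    ‖x - x₀‖ ^ a * (radialDeriv x₀ g x - β * w x / ‖x - x₀‖) ^ 2
      = ‖x - x₀‖ ^ (a - 2) * eulerDefect x₀ β w g x ^ 2 := by
  rw [Real.rpow_sub hx, eulerDefect, ← norm_mul_radialDeriv, Real.rpow_two]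
  field_simp

theorem eulerDefect_rescale (hs : 0 < s) (w : EuclideanSpace ℝ (Fin n) → ℝ)
    (g : EuclideanSpace ℝ (Fin n) → EuclideanSpace ℝ (Fin n)) (x : EuclideanSpace ℝ (Fin n)) :
    eulerDefect 0 β (rescale x₀ β s w) (rescaleGrad x₀ β s g) x
      = s ^ (-β) * eulerDefect x₀ β w g (x₀ + s • x) := by
  simp only [eulerDefect, rescale, rescaleGrad, sub_zero, add_sub_cancel_left, inner_smul_left,
    inner_smul_right, show 1 - β = -β + 1 by ring, Real.rpow_add_one hs.ne']
  simp
  ring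

theorem preimage_dilation_annulus (hs : 0 < s) (r₁ r₂ : ℝ) :
    (fun x : EuclideanSpace ℝ (Fin n) => x₀ + s • x) ⁻¹' annulus x₀ (s * r₁) (s * r₂)
      = annulus 0 r₁ r₂ := by
  rw [annulus, Set.preimage_sdiff, preimage_dilation_ball hs, preimage_dilation_ball hs, annulus]

/-- The weighted integral is scale invariant: under the dilation the weight contributes `s^(-n-2β)`,
the squared defect `s^(2β)` and the volume element `sⁿ`. It thus equals the integral for `u` on the
shrunken annulus, one summand of the radial term in the monotonicity formula. -/
theorem IsVariationalSolution.annulus_eulerDefect_le (hn : 0 < n)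
    (hu : IsVariationalSolution Ω F u G) (hball : ball x₀ δ ⊆ Ω)
    (hβ : ∀ r : ℝ, 0 < r → r < δ →
      0 ≤ ∫ x in ball x₀ r, (2 * (β - 1) * F (u x) - β * inner ℝ (u x) (gradient F (u x))))
    (h₁ : 0 < r₁) (h : r₁ ≤ r₂) (hs : 0 < s) (hr : s * r₂ < δ) (i : Fin m) :
    2 * (∫ x in annulus 0 r₁ r₂, ‖x‖ ^ (-(n : ℝ) - 2 * β)
          * eulerDefect 0 β (rescale x₀ β s (fun x => u x i)) (rescaleGrad x₀ β s (G i)) x ^ 2)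
      ≤ Phi F u G x₀ β (s * r₂) - Phi F u G x₀ β (s * r₁) := by
  have hs1 : 0 < s * r₁ := mul_pos hs h₁
  refine le_trans (mul_le_mul_of_nonneg_left ?_ zero_le_two)
    (hu.annulus_le_Phi_sub hn hball hβ hs1 (mul_le_mul_of_nonneg_left h hs.le) hr)
  have hpos : ∀ x ∈ annulus x₀ (s * r₁) (s * r₂), 0 < ‖x - x₀‖ := fun x hx =>
    hs1.trans_le (mem_annulus.1 hx).1
  have hsub : closedBall x₀ (s * r₂) ⊆ Ω := (closedBall_subset_ball hr).trans hball
  have hexp : -(n : ℝ) - 2 * β + 2 - 2 = -(n : ℝ) - 2 * β := by ring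
  have hint : ∀ j, IntegrableOn (fun x => ‖x - x₀‖ ^ (-(n : ℝ) - 2 * β)
      * eulerDefect x₀ β (fun x => u x j) (G j) x ^ 2) (annulus x₀ (s * r₁) (s * r₂)) := fun j =>
    integrableOn_annulus_radial_mul (continuousOn_rpow_Icc hs1 _)
      (IntegrableOn.mono_set
        (((hu.memH1Loc j).memH1_ball hsub).memLp_eulerDefect β).integrable_sq Set.sdiff_subset)
  have e1 : ∫ x in annulus x₀ (s * r₁) (s * r₂), ‖x - x₀‖ ^ (-(n : ℝ) - 2 * β + 2)
          * ∑ i, (radialDeriv x₀ (G i) x - β * u x i / ‖x - x₀‖) ^ 2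
      = ∫ x in annulus x₀ (s * r₁) (s * r₂), ∑ j, ‖x - x₀‖ ^ (-(n : ℝ) - 2 * β)
        * eulerDefect x₀ β (fun x => u x j) (G j) x ^ 2 := by
    refine setIntegral_congr_fun measurableSet_annulus fun x hx => ?_
    simp only [Finset.mul_sum]
    refine Finset.sum_congr rfl fun j _ => ?_
    rw [rpow_mul_radialDeriv_sub_sq (w := fun x => u x j) (hpos x hx), hexp]
  have e2 : ∫ x in annulus 0 r₁ r₂, ‖x‖ ^ (-(n : ℝ) - 2 * β)
          * eulerDefect 0 β (rescale x₀ β s (fun x => u x i)) (rescaleGrad x₀ β s (G i)) x ^ 2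
      = ∫ x in annulus x₀ (s * r₁) (s * r₂), ‖x - x₀‖ ^ (-(n : ℝ) - 2 * β)
        * eulerDefect x₀ β (fun x => u x i) (G i) x ^ 2 := by
    have h0 := setIntegral_comp_dilation (x₀ := x₀) hs (annulus x₀ (s * r₁) (s * r₂))
      (fun x => ‖x - x₀‖ ^ (-(n : ℝ) - 2 * β) * eulerDefect x₀ β (fun x => u x i) (G i) x ^ 2)
    rw [preimage_dilation_annulus hs, smul_eq_mul, eq_inv_mul_iff_mul_eq₀ (by positivity),
      ← integral_const_mul] at h0
    rw [← h0]
    refine integral_congr_ae (ae_of_all _ fun x => ?_)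
    simp only [eulerDefect_rescale hs, add_sub_cancel_left, norm_smul, Real.norm_eq_abs,
      abs_of_pos hs]
    rw [Real.mul_rpow hs.le (norm_nonneg _), sub_eq_add_neg (-(n : ℝ)), Real.rpow_add hs,
      Real.rpow_neg hs.le (n : ℝ), Real.rpow_natCast, show -(2 * β) = -β + -β by ring,
      Real.rpow_add hs]
    field_simp
  rw [e1, e2]
  refine integral_mono_of_nonneg (ae_of_all _ fun x => by positivity)
    (integrable_finsetSum _ fun j _ => hint j) (ae_of_all _ fun x =>
      Finset.single_le_sum (f := fun j => ‖x - x₀‖ ^ (-(n : ℝ) - 2 * β)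
        * eulerDefect x₀ β (fun x => u x j) (G j) x ^ 2) (fun j _ => by positivity)
        (Finset.mem_univ i))

/-- Along a blow-up sequence the defect in Euler's relation tends to zero in mean on annuli. -/
theorem IsVariationalSolution.tendsto_integral_eulerDefect (hn : 0 < n)
    (hu : IsVariationalSolution Ω F u G) (hδ : 0 < δ) (hball : ball x₀ δ ⊆ Ω)
    (hβ : ∀ r : ℝ, 0 < r → r < δ →
      0 ≤ ∫ x in ball x₀ r, (2 * (β - 1) * F (u x) - β * inner ℝ (u x) (gradient F (u x))))
    (hg : GrowthCondition F u G x₀ β δ) {ρ : ℕ → ℝ} (hρ : ∀ k, 0 < ρ k)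
    (hρ0 : Tendsto ρ atTop (𝓝 0)) (h₁ : 0 < r₁) (h : r₁ ≤ r₂) (i : Fin m) :
    Tendsto (fun k => ∫ x in annulus 0 r₁ r₂,
      |eulerDefect 0 β (rescale x₀ β (ρ k) (fun x => u x i)) (rescaleGrad x₀ β (ρ k) (G i)) x|)
      atTop (𝓝 0) := by
  obtain ⟨M, hM⟩ := hu.exists_tendsto_Phi hn hδ hball hβ hg
  set A : Set (EuclideanSpace ℝ (Fin n)) := annulus 0 r₁ r₂ with hA
  set q : ℕ → EuclideanSpace ℝ (Fin n) → ℝ := fun k =>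
    eulerDefect 0 β (rescale x₀ β (ρ k) (fun x => u x i)) (rescaleGrad x₀ β (ρ k) (G i)) with hq
  have h2 : 0 < r₂ := h₁.trans_le h
  have hPhi : ∀ r, 0 < r → Tendsto (fun k => Phi F u G x₀ β (ρ k * r)) atTop (𝓝 M) := by
    intro r hr
    refine hM.comp (tendsto_nhdsWithin_iff.2 ⟨by simpa using hρ0.mul_const r, ?_⟩)
    exact Eventually.of_forall fun k => mul_pos (hρ k) hr
  -- Both radii shrink to zero, so both energies tend to the same limit `M`. Finiteness of that
  -- limit is essential here.
  have hdiff : Tendsto (fun k => Phi F u G x₀ β (ρ k * r₂) - Phi F u G x₀ β (ρ k * r₁)) atTop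
      (𝓝 0) := by simpa using (hPhi r₂ h2).sub (hPhi r₁ h₁)
  have h0 : Tendsto (fun k => ρ k * r₂) atTop (𝓝 0) := by simpa using hρ0.mul_const r₂
  have hev : ∀ᶠ k in atTop, ρ k * r₂ < δ := h0.eventually (gt_mem_nhds hδ)
  -- A bound for the reciprocal of the weight on the annulus, used to pass from the weighted to the
  -- plain `L²` norm.
  obtain ⟨B, hB⟩ := (isCompact_Icc.image_of_continuousOn
    (continuousOn_rpow_Icc (r₂ := r₂) h₁ ((n : ℝ) + 2 * β))).bddAbove
  have hL2 : ∀ k, ρ k * r₂ < δ → MemLp (q k) 2 (volume.restrict A) := fun k hk =>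
    ((((hu.memH1Loc i).rescale x₀ β (hρ k)).memH1_ball (MemH1Loc.rescale_closedBall_subset (hρ k)
      ((closedBall_subset_ball hk).trans hball))).memLp_eulerDefect β).mono_measure
      (Measure.restrict_mono Set.sdiff_subset le_rfl)
  have hsq : ∀ᶠ k in atTop, ∫ x in A, q k x ^ 2
      ≤ |B| * (Phi F u G x₀ β (ρ k * r₂) - Phi F u G x₀ β (ρ k * r₁)) := by
    filter_upwards [hev] with k hk
    have key := hu.annulus_eulerDefect_le hn hball hβ h₁ h (hρ k) hk i
    have hI : IntegrableOn (fun x => ‖x‖ ^ (-(n : ℝ) - 2 * β) * q k x ^ 2) A := by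
      have := integrableOn_annulus_radial_mul (x₀ := (0 : EuclideanSpace ℝ (Fin n)))
        (continuousOn_rpow_Icc (r₂ := r₂) h₁ (-(n : ℝ) - 2 * β)) (hL2 k hk).integrable_sq
      simpa using this
    have hle : ∫ x in A, q k x ^ 2 ≤ |B| * ∫ x in A, ‖x‖ ^ (-(n : ℝ) - 2 * β) * q k x ^ 2 := by
      rw [← integral_const_mul]
      refine setIntegral_mono_on (hL2 k hk).integrable_sq (hI.const_mul _) measurableSet_annulus
        fun x hx => ?_
      have hx' := mem_annulus.1 hx
      rw [sub_zero] at hx'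
      have hx0 : 0 < ‖x‖ := h₁.trans_le hx'.1
      have hb : ‖x‖ ^ ((n : ℝ) + 2 * β) ≤ |B| :=
        (hB (Set.mem_image_of_mem _ ⟨hx'.1, hx'.2.le⟩)).trans (le_abs_self B)
      have hone : ‖x‖ ^ ((n : ℝ) + 2 * β) * ‖x‖ ^ (-(n : ℝ) - 2 * β) = 1 := by
        rw [← Real.rpow_add hx0, show (n : ℝ) + 2 * β + (-(n : ℝ) - 2 * β) = 0 by ring,
          Real.rpow_zero]
      calc q k x ^ 2 = ‖x‖ ^ ((n : ℝ) + 2 * β) * (‖x‖ ^ (-(n : ℝ) - 2 * β) * q k x ^ 2) := by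
            rw [← mul_assoc, hone, one_mul]
        _ ≤ _ := mul_le_mul_of_nonneg_right hb (by positivity)
    have hnn : 0 ≤ ∫ x in A, ‖x‖ ^ (-(n : ℝ) - 2 * β) * q k x ^ 2 :=
      integral_nonneg fun x => by positivity
    refine hle.trans (mul_le_mul_of_nonneg_left ?_ (abs_nonneg B))
    linarith
  have hvol : volume A ≠ ⊤ := ((measure_mono Set.sdiff_subset).trans_lt measure_ball_lt_top).ne
  have hsqrt : Tendsto (fun k => √(volume.real A) *
      √(|B| * (Phi F u G x₀ β (ρ k * r₂) - Phi F u G x₀ β (ρ k * r₁)))) atTop (𝓝 0) := by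
    simpa using ((hdiff.const_mul |B|).sqrt).const_mul √(volume.real A)
  refine squeeze_zero' (Eventually.of_forall fun k => integral_nonneg fun x => abs_nonneg _) ?_ hsqrt
  filter_upwards [hev, hsq] with k hk hk2
  have : IsFiniteMeasure (volume.restrict A) := ⟨by simpa using hvol.lt_top⟩
  -- Cauchy–Schwarz against the constant `1` on a set of finite volume turns `L²` decay into `L¹`
  -- decay.
  have hc := integral_mul_norm_le_Lp_mul_Lq (μ := volume.restrict A) (f := q k)
    (g := fun _ => (1 : ℝ)) Real.HolderConjugate.two_two (by simpa using hL2 k hk)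
    (by simpa using memLp_const (1 : ℝ))
  simp only [norm_one, mul_one, one_pow, Real.rpow_two, Real.norm_eq_abs, sq_abs,
    ← Real.sqrt_eq_rpow, integral_const, smul_eq_mul, measureReal_restrict_apply_univ] at hc
  rw [mul_comm] at hc
  exact hc.trans (mul_le_mul_of_nonneg_left (Real.sqrt_le_sqrt hk2) (Real.sqrt_nonneg _))

end


/-! ### From the vanishing defect to homogeneity of weak limits. -/

section
variable {n : ℕ} {Ω D : Set (EuclideanSpace ℝ (Fin n))} {w : EuclideanSpace ℝ (Fin n) → ℝ}
  {g : EuclideanSpace ℝ (Fin n) → EuclideanSpace ℝ (Fin n)} {ψ : EuclideanSpace ℝ (Fin n) → ℝ}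
  {r r₁ r₂ R β t l : ℝ}

theorem norm_inv_smul_of_pos (ht : 0 < t) (y : EuclideanSpace ℝ (Fin n)) :
    ‖t⁻¹ • y‖ = t⁻¹ * ‖y‖ := by
  rw [norm_smul, Real.norm_of_nonneg (inv_nonneg.2 ht.le)]

theorem tsupport_comp_inv_smul_subset (t : ℝ) :
    tsupport (fun y => ψ (t⁻¹ • y)) ⊆ (fun y => t⁻¹ • y) ⁻¹' tsupport ψ :=
  closure_minimal (fun _ hy => subset_tsupport _ hy)
    ((isClosed_tsupport ψ).preimage (continuous_const_smul _))

theorem hasCompactSupport_comp_inv_smul (hψ : HasCompactSupport ψ) (ht : 0 < t) :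
    HasCompactSupport (fun y => ψ (t⁻¹ • y)) :=
  hψ.comp_homeomorph (Homeomorph.smulOfNeZero t⁻¹ (inv_pos.2 ht).ne')

theorem fderiv_comp_inv_smul (hψ : ContDiff ℝ ∞ ψ) (t : ℝ) (y v : EuclideanSpace ℝ (Fin n)) :
    fderiv ℝ (fun y => ψ (t⁻¹ • y)) y v = t⁻¹ * fderiv ℝ ψ (t⁻¹ • y) v := by
  have h1 : HasFDerivAt (fun y : EuclideanSpace ℝ (Fin n) => t⁻¹ • y)
      (t⁻¹ • ContinuousLinearMap.id ℝ (EuclideanSpace ℝ (Fin n))) y :=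
    (hasFDerivAt_id y).const_smul t⁻¹
  have h2 := ((hψ.differentiable (by simp) (t⁻¹ • y)).hasFDerivAt.comp y h1).fderiv
  rw [show (fun y => ψ (t⁻¹ • y)) = ψ ∘ fun y => t⁻¹ • y from rfl, h2]
  simp

/-- The derivative in `t` is written through the spatial derivative of the dilated function in the
direction `y`, the form in which `MemH1Loc.integral_radial_test` can integrate it by parts. -/
theorem hasDerivAt_rpow_mul_comp_inv_smul (hψ : ContDiff ℝ ∞ ψ) (c : ℝ) (ht : 0 < t)
    (y : EuclideanSpace ℝ (Fin n)) :
    HasDerivAt (fun t : ℝ => t ^ c * ψ (t⁻¹ • y))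
      (t ^ (c - 1) * (c * ψ (t⁻¹ • y) - fderiv ℝ (fun y => ψ (t⁻¹ • y)) y y)) t := by
  have h1 : HasDerivAt (fun t : ℝ => t⁻¹ • y) (-(t ^ 2)⁻¹ • y) t :=
    (hasDerivAt_inv ht.ne').smul_const y
  have h2 := (hψ.differentiable (by simp) (t⁻¹ • y)).hasFDerivAt.comp_hasDerivAt t h1
  have h3 := (Real.hasDerivAt_rpow_const (p := c) (Or.inl ht.ne')).mul h2
  refine h3.congr_deriv ?_
  rw [fderiv_comp_inv_smul hψ, map_smul, smul_eq_mul, Real.rpow_sub_one ht.ne']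
  simp only [Function.comp]
  field_simp
  ring

/-- The derivative of the pairing of a Sobolev function with a dilated test function. -/
theorem MemH1Loc.hasDerivAt_integral_dilation (hw : MemH1Loc Ω w g) (hψ : ContDiff ℝ ∞ ψ)
    (hψc : HasCompactSupport ψ) (hr : 0 < r) (hψr : tsupport ψ ⊆ closedBall 0 r)
    (hR : closedBall 0 R ⊆ Ω) (ht : 0 < t) (htR : t * r < R) (β : ℝ) :
    HasDerivAt (fun t : ℝ => ∫ y, w y * (t ^ (-β - n) * ψ (t⁻¹ • y)))
      (t ^ (-β - n - 1) * ∫ y, eulerDefect 0 β w g y * ψ (t⁻¹ • y)) t := by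
  -- With this exponent the pairing is, after substitution, `∫ t^(-β) w(t x) ψ(x) dx`. Placing the
  -- dilation on `ψ` keeps the integrand smooth in `t`, whatever the regularity of `w`.
  set c : ℝ := -β - n with hc
  set P : ℝ → EuclideanSpace ℝ (Fin n) → ℝ := fun t y =>
    t ^ (c - 1) * (c * ψ (t⁻¹ • y) - fderiv ℝ (fun y => ψ (t⁻¹ • y)) y y) with hP
  have hP' : ∀ t y, P t y
      = t ^ (c - 1) * (c * ψ (t⁻¹ • y) - t⁻¹ * fderiv ℝ ψ (t⁻¹ • y) y) := fun t y => by
    simp only [hP, fderiv_comp_inv_smul hψ]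
  have hfd : Continuous (fderiv ℝ ψ) := hψ.continuous_fderiv (by simp)
  have hPt : ∀ t, Continuous (P t) := fun t => by
    simp only [funext (hP' t)]
    have := hψ.continuous
    fun_prop
  -- the support of the dilated test functions
  have hsupp : ∀ t : ℝ, 0 < t → t * r ≤ R → (fun y => t⁻¹ • y) ⁻¹' tsupport ψ ⊆ closedBall 0 R := by
    intro t ht htr y hy
    have := hψr hy
    rw [mem_closedBall_zero_iff, norm_inv_smul_of_pos ht, inv_mul_le_iff₀ ht] at this
    exact mem_closedBall_zero_iff.2 (this.trans htr)
  have hwK : IntegrableOn w (closedBall 0 R) := (hw.integrableOn (isCompact_closedBall 0 R) hR).1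
  have hcpt : ∀ t : ℝ, 0 < t → HasCompactSupport (fun y => ψ (t⁻¹ • y)) := fun t ht =>
    hasCompactSupport_comp_inv_smul hψc ht
  have hint : ∀ t : ℝ, 0 < t → t * r ≤ R → ∀ q : EuclideanSpace ℝ (Fin n) → ℝ, Continuous q →
      (∀ y, y ∉ (fun y => t⁻¹ • y) ⁻¹' tsupport ψ → q y = 0) → Integrable (fun y => w y * q y) := by
    intro t ht htr q hq h0
    have hsub : tsupport q ⊆ closedBall 0 R :=
      (closure_minimal (Function.support_subset_iff'.2 h0)
        ((isClosed_tsupport ψ).preimage (continuous_const_smul _))).trans (hsupp t ht htr)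
    exact integrable_mul_of_hasCompactSupport hq
      (HasCompactSupport.of_support_subset_isCompact (isCompact_closedBall 0 R)
        (subset_closure.trans hsub)) (hwK.mono_set hsub)
  have hzero : ∀ (t : ℝ) y, y ∉ (fun y : EuclideanSpace ℝ (Fin n) => t⁻¹ • y) ⁻¹' tsupport ψ →
      ψ (t⁻¹ • y) = 0 ∧ fderiv ℝ ψ (t⁻¹ • y) = 0 := fun t y hy =>
    ⟨image_eq_zero_of_notMem_tsupport hy,
      image_eq_zero_of_notMem_tsupport fun h => hy (tsupport_fderiv_subset ℝ h)⟩
  have hPzero : ∀ t y, y ∉ (fun y : EuclideanSpace ℝ (Fin n) => t⁻¹ • y) ⁻¹' tsupport ψ →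
      P t y = 0 := fun t y hy => by
    rw [hP', (hzero t y hy).1, (hzero t y hy).2]
    simp
  -- a uniform bound for the derivative
  have hR0 : t < R / r := (lt_div_iff₀ hr).2 htR
  obtain ⟨B, hB⟩ : ∃ B, ∀ s ∈ Set.Icc (t / 2) (R / r), ∀ y ∈ closedBall 0 R, ‖P s y‖ ≤ B := by
    have hcont : ContinuousOn (fun p : ℝ × EuclideanSpace ℝ (Fin n) => P p.1 p.2)
        (Set.Icc (t / 2) (R / r) ×ˢ closedBall 0 R) := by
      simp only [hP']
      have hne : ∀ p ∈ Set.Icc (t / 2) (R / r) ×ˢ closedBall (0 : EuclideanSpace ℝ (Fin n)) R,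
          p.1 ≠ 0 := fun p hp =>
        ((half_pos ht).trans_le hp.1.1).ne'
      have hinv : ContinuousOn (fun p : ℝ × EuclideanSpace ℝ (Fin n) => p.1⁻¹)
          (Set.Icc (t / 2) (R / r) ×ˢ closedBall 0 R) := continuousOn_fst.inv₀ hne
      have hsm := hinv.smul (continuousOn_snd (s := Set.Icc (t / 2) (R / r) ×ˢ closedBall 0 R))
      refine (continuousOn_fst.rpow_const fun p hp => Or.inl (hne p hp)).mul
        (((hψ.continuous.comp_continuousOn hsm).const_mul c).sub (hinv.mul ?_))
      exact (hfd.comp_continuousOn hsm).clm_apply continuousOn_snd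
    obtain ⟨B, hB⟩ := (isCompact_Icc.prod (isCompact_closedBall 0 R)).exists_bound_of_continuousOn
      hcont
    exact ⟨B, fun s hs y hy => hB (s, y) ⟨hs, hy⟩⟩
  have hs_pos : ∀ s ∈ Set.Ioo (t / 2) (R / r), 0 < s ∧ s * r ≤ R := fun s hs =>
    ⟨(half_pos ht).trans hs.1, ((lt_div_iff₀ hr).1 hs.2).le⟩
  have hnhds : Set.Ioo (t / 2) (R / r) ∈ 𝓝 t := Ioo_mem_nhds (half_lt_self ht) hR0
  have hFint : ∀ s ∈ Set.Ioo (t / 2) (R / r),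
      Integrable (fun y => w y * (s ^ c * ψ (s⁻¹ • y))) := fun s hs => by
    refine hint s (hs_pos s hs).1 (hs_pos s hs).2 _ ?_ fun y hy => ?_
    · have := hψ.continuous
      fun_prop
    · rw [(hzero s y hy).1, mul_zero]
  have hPint : Integrable (fun y => w y * P t y) := hint t ht htR.le _ (hPt t) (hPzero t)
  have key := (hasDerivAt_integral_of_dominated_loc_of_deriv_le (μ := volume)
    (F := fun s y => w y * (s ^ c * ψ (s⁻¹ • y))) (F' := fun s y => w y * P s y)
    (bound := (closedBall 0 R).indicator fun y => ‖w y‖ * B) hnhds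
    (by filter_upwards [hnhds] with s hs using (hFint s hs).1)
    (hFint t (mem_of_mem_nhds hnhds)) hPint.1 (ae_of_all _ fun y s hs => ?_)
    ((integrable_indicator_iff measurableSet_closedBall).2 (hwK.norm.mul_const B))
    (ae_of_all _ fun y s hs =>
      (hasDerivAt_rpow_mul_comp_inv_smul hψ c (hs_pos s hs).1 y).const_mul (w y))).2
  · refine key.congr_deriv ?_
    have htest : IsTestFunction Ω (fun y => ψ (t⁻¹ • y)) :=
      ⟨hψ.comp (contDiff_id.const_smul t⁻¹), hcpt t ht,
        ((tsupport_comp_inv_smul_subset t).trans (hsupp t ht htR.le)).trans hR⟩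
    have hrad := hw.integral_radial_test 0 htest
    simp only [sub_zero] at hrad
    have i1 : Integrable (fun y => w y * ψ (t⁻¹ • y)) := by
      refine hint t ht htR.le _ ?_ fun y hy => (hzero t y hy).1
      have := hψ.continuous
      fun_prop
    have i2 : Integrable (fun y => w y * (fderiv ℝ (fun y => ψ (t⁻¹ • y)) y y
        + n * ψ (t⁻¹ • y))) := by
      simp only [fderiv_comp_inv_smul hψ]
      refine hint t ht htR.le _ ?_ fun y hy => ?_
      · have := hψ.continuous
        fun_prop
      · rw [(hzero t y hy).1, (hzero t y hy).2]
        simp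
    have hsub : tsupport (fun y => ψ (t⁻¹ • y)) ⊆ closedBall 0 R :=
      (tsupport_comp_inv_smul_subset t).trans (hsupp t ht htR.le)
    have hgK : IntegrableOn (fun y => inner ℝ y (g y)) (closedBall 0 R) := by
      have hg0 := (hw.integrableOn (isCompact_closedBall 0 R) hR).2
      refine (hg0.norm.const_mul R).mono
        (continuous_id.aestronglyMeasurable.inner hg0.1) ?_
      refine (ae_restrict_iff' measurableSet_closedBall).2 (ae_of_all _ fun y hy => ?_)
      rw [mem_closedBall_zero_iff] at hy
      refine (abs_real_inner_le_norm _ _).trans ?_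
      rw [Real.norm_eq_abs]
      exact (mul_le_mul_of_nonneg_right hy (norm_nonneg _)).trans (le_abs_self _)
    have i3 : Integrable (fun y => inner ℝ y (g y) * ψ (t⁻¹ • y)) := by
      refine integrable_mul_of_hasCompactSupport ?_ (hcpt t ht) (hgK.mono_set hsub)
      have := hψ.continuous
      fun_prop
    have e1 : ∫ y, w y * P t y = -t ^ (c - 1) * ((∫ y, w y * (fderiv ℝ (fun y => ψ (t⁻¹ • y)) y y
        + n * ψ (t⁻¹ • y))) + β * ∫ y, w y * ψ (t⁻¹ • y)) := by
      rw [← integral_const_mul β, ← integral_add i2 (i1.const_mul β), ← integral_const_mul]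
      refine integral_congr_ae (ae_of_all _ fun y => ?_)
      simp only [hP, hc]
      ring
    have e2 : ∫ y, eulerDefect 0 β w g y * ψ (t⁻¹ • y)
        = (∫ y, inner ℝ y (g y) * ψ (t⁻¹ • y)) - β * ∫ y, w y * ψ (t⁻¹ • y) := by
      rw [← integral_const_mul β, ← integral_sub i3 (i1.const_mul β)]
      refine integral_congr_ae (ae_of_all _ fun y => ?_)
      simp only [eulerDefect, sub_zero]
      ring
    rw [e1, e2, hrad]
    ring
  · by_cases hy : y ∈ closedBall (0 : EuclideanSpace ℝ (Fin n)) R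
    · rw [Set.indicator_of_mem hy, norm_mul]
      exact mul_le_mul_of_nonneg_left (hB s ⟨hs.1.le, hs.2.le⟩ y hy) (norm_nonneg _)
    · rw [Set.indicator_of_notMem hy, hPzero s y fun h => hy (hsupp s (hs_pos s hs).1
        (hs_pos s hs).2 h), mul_zero, norm_zero]

/-- The failure of homogeneity in the distributional sense is controlled by the defect in Euler's
relation. -/
theorem exists_abs_integral_dilation_sub_le (hψ : ContDiff ℝ ∞ ψ) (hψc : HasCompactSupport ψ)
    (h₁ : 0 < r₁) (h : r₁ ≤ r₂) (hψr : tsupport ψ ⊆ annulus 0 r₁ r₂) (hl : 0 < l) (β : ℝ) :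
    ∃ C : ℝ, ∀ (Ω : Set (EuclideanSpace ℝ (Fin n))) (w : EuclideanSpace ℝ (Fin n) → ℝ)
      (g : EuclideanSpace ℝ (Fin n) → EuclideanSpace ℝ (Fin n)), MemH1Loc Ω w g →
      closedBall 0 (max 1 l * r₂ + 1) ⊆ Ω →
      |(∫ y, w y * (l ^ (-β - n) * ψ (l⁻¹ • y))) - ∫ y, w y * ψ y|
        ≤ C * ∫ y in annulus 0 (min 1 l * r₁) (max 1 l * r₂), |eulerDefect 0 β w g y| := by
  have h2 : 0 < r₂ := h₁.trans_le h
  have hmin : 0 < min 1 l := lt_min one_pos hl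
  obtain ⟨B, hB⟩ := hψc.exists_bound_of_continuous hψ.continuous
  obtain ⟨E, hE⟩ := isCompact_Icc.exists_bound_of_continuousOn
    (continuousOn_rpow_Icc (r₂ := max 1 l) hmin (-β - n - 1))
  have hB0 : 0 ≤ B := (norm_nonneg _).trans (hB 0)
  -- The constant is fixed before `w`, so the estimate is uniform along a sequence. It is the mean
  -- value inequality between `1` and `l`, in either order; the additional `1` in the radius
  -- provides the strict inequality required for differentiability at the larger endpoint.
  refine ⟨E * B * |l - 1|, fun Ω w g hw hΩ => ?_⟩
  set A : Set (EuclideanSpace ℝ (Fin n)) := annulus 0 (min 1 l * r₁) (max 1 l * r₂) with hA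
  have hball : closedBall 0 (max 1 l * r₂) ⊆ Ω :=
    (closedBall_subset_closedBall (by linarith)).trans hΩ
  have hfin : IsFiniteMeasure (volume.restrict
      (ball (0 : EuclideanSpace ℝ (Fin n)) (max 1 l * r₂))) := ⟨by simp [measure_ball_lt_top]⟩
  have hq : IntegrableOn (eulerDefect 0 β w g) A :=
    (((hw.memH1_ball hball).memLp_eulerDefect β).integrable one_le_two).mono_measure
      (Measure.restrict_mono Set.sdiff_subset le_rfl)
  have hpos : ∀ t ∈ Set.Icc (min 1 l) (max 1 l), 0 < t := fun t ht => hmin.trans_le ht.1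
  have hder : ∀ t ∈ Set.Icc (min 1 l) (max 1 l), HasDerivWithinAt
      (fun t : ℝ => ∫ y, w y * (t ^ (-β - n) * ψ (t⁻¹ • y)))
      (t ^ (-β - n - 1) * ∫ y, eulerDefect 0 β w g y * ψ (t⁻¹ • y))
      (Set.Icc (min 1 l) (max 1 l)) t := fun t ht => by
    refine (hw.hasDerivAt_integral_dilation hψ hψc h2 ?_ hΩ (hpos t ht) ?_ β).hasDerivWithinAt
    · exact hψr.trans (Set.sdiff_subset.trans ball_subset_closedBall)
    · have := mul_le_mul_of_nonneg_right ht.2 h2.le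
      linarith
  have hbound : ∀ t ∈ Set.Icc (min 1 l) (max 1 l),
      ‖t ^ (-β - n - 1) * ∫ y, eulerDefect 0 β w g y * ψ (t⁻¹ • y)‖
        ≤ E * (B * ∫ y in A, |eulerDefect 0 β w g y|) := fun t ht => by
    rw [norm_mul]
    refine mul_le_mul (hE t ht) ?_ (norm_nonneg _) ((norm_nonneg _).trans (hE t ht))
    have hzero : ∀ y ∉ A, eulerDefect 0 β w g y * ψ (t⁻¹ • y) = 0 := fun y hy => by
      rw [image_eq_zero_of_notMem_tsupport (f := ψ) fun hs => hy ?_, mul_zero]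
      have := mem_annulus.1 (hψr hs)
      rw [sub_zero, norm_inv_smul_of_pos (hpos t ht), le_inv_mul_iff₀ (hpos t ht),
        inv_mul_lt_iff₀ (hpos t ht)] at this
      rw [hA, mem_annulus, sub_zero]
      exact ⟨(mul_le_mul_of_nonneg_right ht.1 h₁.le).trans this.1,
        this.2.trans_le (mul_le_mul_of_nonneg_right ht.2 h2.le)⟩
    rw [← setIntegral_eq_integral_of_forall_compl_eq_zero hzero, ← integral_const_mul]
    refine norm_integral_le_of_norm_le (hq.norm.const_mul B) (ae_of_all _ fun y => ?_)
    rw [norm_mul, mul_comm]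
    exact mul_le_mul_of_nonneg_right (hB _) (norm_nonneg _)
  have := (convex_Icc _ _).norm_image_sub_le_of_norm_hasDerivWithin_le hder hbound
    (x := 1) (y := l) ⟨min_le_left _ _, le_max_left _ _⟩ ⟨min_le_right _ _, le_max_right _ _⟩
  simp only [Real.one_rpow, inv_one, one_smul, one_mul, Real.norm_eq_abs] at this
  refine this.trans (le_of_eq ?_)
  ring

/-- A weak limit of functions whose defect in Euler's relation tends to zero is invariant under
the dilations of degree `β`. -/
theorem ae_eq_of_tendsto_eulerDefect (hD : IsOpen D) (hDb : Bornology.IsBounded D) (hn : 0 < n)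
    {O : ℕ → Set (EuclideanSpace ℝ (Fin n))} {v : ℕ → EuclideanSpace ℝ (Fin n) → ℝ}
    {G : ℕ → EuclideanSpace ℝ (Fin n) → EuclideanSpace ℝ (Fin n)}
    (hv : ∀ k, MemH1Loc (O k) (v k) (G k)) (hO : ∀ R, ∀ᶠ k in atTop, closedBall 0 R ⊆ O k)
    (hdef : ∀ r₁ r₂ : ℝ, 0 < r₁ → r₁ ≤ r₂ →
      Tendsto (fun k => ∫ y in annulus 0 r₁ r₂, |eulerDefect 0 β (v k) (G k) y|) atTop (𝓝 0))
    (hw : MemLp w 2 (volume.restrict D))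
    (hlim : ∀ ψ : EuclideanSpace ℝ (Fin n) → ℝ, MemLp ψ 2 (volume.restrict D) →
      Tendsto (fun k => ∫ x in D, v k x * ψ x) atTop (𝓝 (∫ x in D, w x * ψ x)))
    (hl : 0 < l) : ∀ᵐ x, x ∈ D → l • x ∈ D → w (l • x) = l ^ β * w x := by
  have : Nonempty (Fin n) := ⟨⟨0, hn⟩⟩
  -- Both `x` and `l x` must lie in `D` for the two pairings to be governed by weak convergence on
  -- `D`. The origin, a null set, is removed so that every test function is supported in an annulus.
  set U : Set (EuclideanSpace ℝ (Fin n)) := (D ∩ (fun x => l • x) ⁻¹' D) ∩ {0}ᶜ with hU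
  have hUo : IsOpen U :=
    (hD.inter (hD.preimage (continuous_const_smul l))).inter isOpen_compl_singleton
  have hUD : U ⊆ D := fun x hx => hx.1.1
  have hDfin : IsFiniteMeasure (volume.restrict D) := ⟨by simpa using hDb.measure_lt_top⟩
  have hwi : IntegrableOn w D := hw.integrable one_le_two
  have hwl : IntegrableOn (fun x => w (l • x)) ((fun x => l • x) ⁻¹' D) := by
    have := memLp_comp_dilation (x₀ := (0 : EuclideanSpace ℝ (Fin n))) hl
      (memLp_one_iff_integrable.2 hwi)
    simp only [zero_add, memLp_one_iff_integrable] at this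
    exact this
  have hloc : LocallyIntegrableOn (fun x => l ^ (-β) * w (l • x) - w x) U :=
    IntegrableOn.locallyIntegrableOn (((hwl.mono_set fun x hx => hx.1.2).const_mul _).sub
      (hwi.mono_set hUD))
  have hzero := hUo.ae_eq_zero_of_integral_contDiff_smul_eq_zero hloc fun ψ hψ hψc hψU => ?_
  · have h0 : ∀ᵐ x : EuclideanSpace ℝ (Fin n), x ≠ 0 := by
      simp [ae_iff]
    filter_upwards [hzero, h0] with x hx hx0 hxD hlD
    have := hx ⟨⟨hxD, hlD⟩, hx0⟩
    rw [Real.rpow_neg hl.le, sub_eq_zero, inv_mul_eq_iff_eq_mul₀ (Real.rpow_pos_of_pos hl β).ne']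
      at this
    exact this
  obtain ⟨r₂, hr₂, hDr⟩ := hDb.subset_ball_lt 0 0
  obtain ⟨r₁, hr₁, hr₁'⟩ := Metric.isOpen_iff.1 (isClosed_tsupport ψ).isOpen_compl 0
    fun h => (hψU h).2 rfl
  have hann : tsupport ψ ⊆ annulus 0 (min r₁ r₂) r₂ := fun x hx =>
    ⟨hDr (hUD (hψU hx)), fun h => hr₁' (ball_subset_ball (min_le_left _ _) h) hx⟩
  obtain ⟨C, hC⟩ := exists_abs_integral_dilation_sub_le hψ hψc (lt_min hr₁ hr₂)
    (min_le_right _ _) hann hl β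
  set χ : EuclideanSpace ℝ (Fin n) → ℝ := fun y => l ^ (-β - n) * ψ (l⁻¹ • y) with hχ
  have hχc : Continuous χ := by
    have := hψ.continuous
    fun_prop
  have hMem : ∀ q : EuclideanSpace ℝ (Fin n) → ℝ, Continuous q → MemLp q 2 (volume.restrict D) :=
    fun q hq => (memLp_ball_of_continuous hq 2 0 r₂).mono_measure (Measure.restrict_mono hDr le_rfl)
  have hχD : ∀ y ∉ D, χ y = 0 := fun y hy => by
    rw [hχ]
    simp only
    rw [image_eq_zero_of_notMem_tsupport (f := ψ), mul_zero]
    intro h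
    have := (hψU h).1.2
    rw [Set.mem_preimage, smul_inv_smul₀ hl.ne'] at this
    exact hy this
  have hψD : ∀ y ∉ D, ψ y = 0 := fun y hy =>
    image_eq_zero_of_notMem_tsupport fun h => hy (hUD (hψU h))
  have hglob : ∀ q f : EuclideanSpace ℝ (Fin n) → ℝ, (∀ y ∉ D, q y = 0) →
      ∫ y in D, f y * q y = ∫ y, f y * q y := fun q f hq =>
    setIntegral_eq_integral_of_forall_compl_eq_zero fun y hy => by rw [hq y hy, mul_zero]
  have t1 := (hlim χ (hMem χ hχc)).sub (hlim ψ (hMem ψ hψ.continuous))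
  simp only [hglob _ _ hχD, hglob _ _ hψD] at t1
  -- The dilates of `ψ` between `1` and `l` may leave `D`, so the derivative estimate is applied to
  -- the functions `v k`, which live on large balls, and not to the limit. Only the two end dilates
  -- are supported in `D`.
  have t2 : Tendsto (fun k => (∫ y, v k y * χ y) - ∫ y, v k y * ψ y) atTop (𝓝 0) := by
    have h0 := (hdef (min 1 l * min r₁ r₂) (max 1 l * r₂)
      (mul_pos (lt_min one_pos hl) (lt_min hr₁ hr₂))
      (mul_le_mul ((min_le_left _ _).trans (le_max_left _ _)) (min_le_right _ _)
        (lt_min hr₁ hr₂).le (one_pos.le.trans (le_max_left _ _)))).const_mul C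
    rw [mul_zero] at h0
    refine squeeze_zero_norm' ?_ h0
    filter_upwards [hO (max 1 l * r₂ + 1)] with k hk using hC _ _ _ (hv k) hk
  have heq := tendsto_nhds_unique t1 t2
  have hsubst : ∫ y, w y * χ y = l ^ (-β) * ∫ x, w (l • x) * ψ x := by
    have := Measure.integral_comp_smul (volume : Measure (EuclideanSpace ℝ (Fin n)))
      (fun y => w y * χ y) l
    simp only [hχ, inv_smul_smul₀ hl.ne', finrank_euclideanSpace_fin, smul_eq_mul] at this
    rw [abs_of_pos (by positivity), eq_inv_mul_iff_mul_eq₀ (by positivity)] at this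
    rw [hχ, ← this, ← integral_const_mul, ← integral_const_mul]
    refine integral_congr_ae (ae_of_all _ fun x => ?_)
    simp only
    rw [Real.rpow_sub hl, Real.rpow_natCast]
    field_simp
  have i1 : Integrable (fun x => w x * ψ x) :=
    integrable_mul_of_hasCompactSupport hψ.continuous hψc (hwi.mono_set (hψU.trans hUD))
  have i2 : Integrable (fun x => w (l • x) * ψ x) :=
    integrable_mul_of_hasCompactSupport hψ.continuous hψc
      (hwl.mono_set (hψU.trans fun x hx => hx.1.2))
  rw [hsubst, ← integral_const_mul, ← integral_sub (i2.const_mul _) i1] at heq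
  rw [← heq]
  refine integral_congr_ae (ae_of_all _ fun x => ?_)
  simp only [smul_eq_mul]
  ring

/-- A measurable function on a bounded open set that is invariant under the dilations of degree
`β` agrees almost everywhere with a homogeneous function. -/
theorem exists_isHomogeneous_of_ae_eq (hD : IsOpen D) (hDb : Bornology.IsBounded D) (hn : 0 < n)
    (hw : Measurable w)
    (h : ∀ l : ℝ, 0 < l → ∀ᵐ x, x ∈ D → l • x ∈ D → w (l • x) = l ^ β * w x) :
    ∃ f : EuclideanSpace ℝ (Fin n) → ℝ, IsHomogeneous β f ∧ ∀ᵐ x, x ∈ D → w x = f x := by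
  have : Nonempty (Fin n) := ⟨⟨0, hn⟩⟩
  -- The null set in the hypothesis depends on `l`, so `w` is averaged along rays. A change of
  -- variables gives `N` the degree `β - 1` and `L` the degree `-1`, at every point and without any
  -- integrability because divergent integrals are `0` on both sides. Hence `N / L` is homogeneous
  -- everywhere, the origin included.
  set N : EuclideanSpace ℝ (Fin n) → ℝ := fun x =>
    ∫ s in Set.Ioi (0 : ℝ), s ^ (-β) * D.indicator w (s • x) with hN
  set L : EuclideanSpace ℝ (Fin n) → ℝ := fun x =>
    ∫ s in Set.Ioi (0 : ℝ), D.indicator (fun _ => (1 : ℝ)) (s • x) with hL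
  refine ⟨fun x => N x / L x, fun t ht x => ?_, ?_⟩
  · have h1 : N (t • x) = t⁻¹ * (t ^ β * N x) := by
      have := integral_comp_mul_right_Ioi (fun s => t ^ β * (s ^ (-β) * D.indicator w (s • x))) 0 ht
      rw [zero_mul, smul_eq_mul] at this
      rw [integral_const_mul (t ^ β) (fun s => s ^ (-β) * D.indicator w (s • x))] at this
      simp only [hN]
      rw [← this]
      refine setIntegral_congr_fun measurableSet_Ioi fun s hs => ?_
      rw [smul_smul, Real.mul_rpow (le_of_lt hs) ht.le, Real.rpow_neg ht.le]
      have := (Real.rpow_pos_of_pos ht β).ne'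
      field_simp
    have h2 : L (t • x) = t⁻¹ * L x := by
      have := integral_comp_mul_right_Ioi (fun s => D.indicator (fun _ => (1 : ℝ)) (s • x)) 0 ht
      rw [zero_mul, smul_eq_mul] at this
      simp only [hL, smul_smul]
      exact this
    simp only
    rw [h1, h2, mul_div_mul_left _ _ (inv_pos.2 ht).ne', mul_div_assoc]
  · have hmeas : MeasurableSet {p : ℝ × EuclideanSpace ℝ (Fin n) |
        0 < p.1 → p.2 ∈ D → p.1 • p.2 ∈ D → w (p.1 • p.2) = p.1 ^ β * w p.2} := by
      have m1 : Measurable fun p : ℝ × EuclideanSpace ℝ (Fin n) => p.1 • p.2 := by fun_prop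
      refine (measurableSet_lt measurable_const measurable_fst).imp
        ((hD.measurableSet.preimage measurable_snd).imp ((hD.measurableSet.preimage m1).imp
          (measurableSet_eq_fun (hw.comp m1) ?_)))
      exact (measurable_fst.pow_const β).mul (hw.comp measurable_snd)
    -- Fubini exchanges the quantifiers: for almost every `x` the relation holds for almost every
    -- `s`, which is enough for the ray integral to give `N x = w x * L x`.
    have hae := (Measure.ae_ae_comm (μ := (volume : Measure ℝ))
      (ν := (volume : Measure (EuclideanSpace ℝ (Fin n))))
      (p := fun s x => 0 < s → x ∈ D → s • x ∈ D → w (s • x) = s ^ β * w x) hmeas).1 (ae_of_all _ fun s => by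
        by_cases hs : 0 < s
        · filter_upwards [h s hs] with x hx _ using hx
        · exact ae_of_all _ fun x hs' => absurd hs' hs)
    have h0 : ∀ᵐ x : EuclideanSpace ℝ (Fin n), x ≠ 0 := by
      simp [ae_iff]
    filter_upwards [hae, h0] with x hx hx0 hxD
    have hmx : Measurable fun s : ℝ => s • x := by fun_prop
    set S : Set ℝ := (fun s : ℝ => s • x) ⁻¹' D ∩ Set.Ioi 0 with hS
    have hSo : IsOpen S := (hD.preimage (by fun_prop)).inter isOpen_Ioi
    have hLx : L x = volume.real S := by
      have e : (fun s : ℝ => D.indicator (fun _ => (1 : ℝ)) (s • x))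
          = ((fun s : ℝ => s • x) ⁻¹' D).indicator (fun _ => (1 : ℝ)) := rfl
      rw [hL]
      simp only [e]
      rw [setIntegral_indicator (hD.measurableSet.preimage hmx), Set.inter_comm]
      simp [hS]
    -- The set of `s > 0` with `s x ∈ D` is open and contains `1`, so its length is positive.
    -- Boundedness of `D` and `x ≠ 0` make the length finite.
    have hLpos : L x ≠ 0 := by
      rw [hLx]
      obtain ⟨R, hR, hDR⟩ := hDb.subset_ball_lt 0 0
      have hsub : S ⊆ Set.Ioo 0 (R / ‖x‖) := fun s hs => by
        have h1 := mem_ball_zero_iff.1 (hDR hs.1)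
        have h2 : (0 : ℝ) < s := hs.2
        rw [norm_smul, Real.norm_of_nonneg h2.le] at h1
        exact ⟨h2, (lt_div_iff₀ (norm_pos_iff.2 hx0)).2 h1⟩
      have hpos : 0 < volume S := hSo.measure_pos _ ⟨1, by simpa using hxD, zero_lt_one' ℝ⟩
      have hfin : volume S < ⊤ := (measure_mono hsub).trans_lt measure_Ioo_lt_top
      exact (ENNReal.toReal_pos hpos.ne' hfin.ne).ne'
    have hNx : N x = w x * L x := by
      rw [hN, hL]
      simp only
      rw [← integral_const_mul]
      refine setIntegral_congr_ae measurableSet_Ioi ?_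
      filter_upwards [hx] with s hs hs0
      by_cases hsD : s • x ∈ D
      · rw [Set.indicator_of_mem hsD, Set.indicator_of_mem hsD, hs hs0 hxD hsD, ← mul_assoc,
          Real.rpow_neg (le_of_lt hs0), inv_mul_cancel₀ (Real.rpow_pos_of_pos hs0 β).ne', one_mul,
          mul_one]
      · rw [Set.indicator_of_notMem hsD, Set.indicator_of_notMem hsD, mul_zero, mul_zero]
    rw [hNx, mul_div_cancel_right₀ _ hLpos]

end

/-! ### Homogeneity of blow-up limits and conclusion. -/

section
variable {n m : ℕ} {Ω D : Set (EuclideanSpace ℝ (Fin n))} {F : EuclideanSpace ℝ (Fin m) → ℝ}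
  {u : EuclideanSpace ℝ (Fin n) → EuclideanSpace ℝ (Fin m)}
  {G : Fin m → EuclideanSpace ℝ (Fin n) → EuclideanSpace ℝ (Fin n)}
  {x₀ : EuclideanSpace ℝ (Fin n)} {β δ : ℝ}

/-- Blow-up limits are homogeneous of degree `β`. -/
theorem IsVariationalSolution.exists_isHomogeneous (hn : 0 < n)
    (hu : IsVariationalSolution Ω F u G) (hδ : 0 < δ) (hball : ball x₀ δ ⊆ Ω)
    (hβ : ∀ r : ℝ, 0 < r → r < δ →
      0 ≤ ∫ x in ball x₀ r, (2 * (β - 1) * F (u x) - β * inner ℝ (u x) (gradient F (u x))))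
    (hg : GrowthCondition F u G x₀ β δ) {ρ : ℕ → ℝ} (hρ : ∀ k, 0 < ρ k)
    (hρ0 : Tendsto ρ atTop (𝓝 0)) (hD : IsOpen D) (hDb : Bornology.IsBounded D) (i : Fin m)
    {w₀ : EuclideanSpace ℝ (Fin n) → ℝ}
    {g₀ : EuclideanSpace ℝ (Fin n) → EuclideanSpace ℝ (Fin n)}
    (hw : WeakH1Tendsto D (fun j => rescale x₀ β (ρ j) (fun x => u x i))
      (fun j => rescaleGrad x₀ β (ρ j) (G i)) w₀ g₀) :
    ∃ h : EuclideanSpace ℝ (Fin n) → ℝ, IsHomogeneous β h ∧ w₀ =ᵐ[volume.restrict D] h := by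
  have hwm := hw.limit_mem.memLp.1
  -- A measurable representative is used, since the Fubini argument on the product of radii and
  -- points needs a measurable set.
  set w₁ := hwm.mk w₀ with hw₁
  have hae : w₀ =ᵐ[volume.restrict D] w₁ := hwm.ae_eq_mk
  have hlim : ∀ ψ : EuclideanSpace ℝ (Fin n) → ℝ, MemLp ψ 2 (volume.restrict D) →
      Tendsto (fun k => ∫ x in D, rescale x₀ β (ρ k) (fun x => u x i) x * ψ x) atTop
        (𝓝 (∫ x in D, w₁ x * ψ x)) := fun ψ hψ => by
    have e : ∫ x in D, w₁ x * ψ x = ∫ x in D, w₀ x * ψ x :=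
      integral_congr_ae (by filter_upwards [hae] with x hx; rw [hx])
    rw [e]
    exact hw.tendsto_fun ψ hψ
  have hO : ∀ R, ∀ᶠ k in atTop, closedBall 0 R ⊆ (fun x => x₀ + ρ k • x) ⁻¹' Ω := fun R => by
    have h0 : Tendsto (fun k => ρ k * R) atTop (𝓝 0) := by simpa using hρ0.mul_const R
    filter_upwards [h0.eventually (gt_mem_nhds hδ)] with k hk
    exact MemH1Loc.rescale_closedBall_subset (hρ k) ((closedBall_subset_ball hk).trans hball)
  obtain ⟨h, hh, he⟩ := exists_isHomogeneous_of_ae_eq hD hDb hn hwm.measurable_mk fun l hl =>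
    ae_eq_of_tendsto_eulerDefect (β := β) hD hDb hn (fun k => (hu.memH1Loc i).rescale x₀ β (hρ k))
      hO (fun r₁ r₂ h₁ h => hu.tendsto_integral_eulerDefect hn hδ hball hβ hg hρ hρ0 h₁ h i)
      (hw.limit_mem.memLp.ae_eq hae) hlim hl
  refine ⟨h, hh, hae.trans ?_⟩
  exact (ae_restrict_iff' hD.measurableSet).2 he

end

end BlowUp

theorem theorem2p2 (n m : ℕ) (hn : 0 < n) (hm : 0 < m)
    (F : EuclideanSpace ℝ (Fin m) → ℝ) (hF : ContDiff ℝ ∞ F)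
    (Ω : Set (EuclideanSpace ℝ (Fin n))) (hΩ : IsOpen Ω)
    (x₀ : EuclideanSpace ℝ (Fin n)) (δ : ℝ) (hδ : 0 < δ) (hball : ball x₀ δ ⊆ Ω)
    (u : EuclideanSpace ℝ (Fin n) → EuclideanSpace ℝ (Fin m))
    (G : Fin m → EuclideanSpace ℝ (Fin n) → EuclideanSpace ℝ (Fin n))
    (hu : BlowUp.IsVariationalSolution Ω F u G)
    (β : ℝ)
    (hβ : ∀ r : ℝ, 0 < r → r < δ →
      0 ≤ ∫ x in ball x₀ r, (2 * (β - 1) * F (u x) - β * inner ℝ (u x) (gradient F (u x))))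
    (hgrowth : BlowUp.GrowthCondition F u G x₀ β δ)
    (ρ : ℕ → ℝ) (hρ : ∀ k, 0 < ρ k) (hρ0 : Tendsto ρ atTop (𝓝 0)) :
    -- `Φ` is nondecreasing in `r` and has a finite limit as `r` decreases to `0`
    (MonotoneOn (BlowUp.Phi F u G x₀ β) (Set.Ioo 0 δ) ∧
      ∃ M : ℝ, Tendsto (BlowUp.Phi F u G x₀ β) (𝓝[>] 0) (𝓝 M)) ∧
    ∀ D : Set (EuclideanSpace ℝ (Fin n)), IsOpen D → Bornology.IsBounded D →
      -- from some index on, the scaled sequence lies in `H¹(D)` and is bounded there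
      (∃ (K : ℕ) (C : ℝ), ∀ k, K ≤ k → ∀ i,
        BlowUp.MemH1 D (BlowUp.rescale x₀ β (ρ k) (fun x => u x i))
          (BlowUp.rescaleGrad x₀ β (ρ k) (G i)) ∧
        (∫ x in D, (BlowUp.rescale x₀ β (ρ k) (fun y => u y i) x) ^ 2)
          + (∫ x in D, ‖BlowUp.rescaleGrad x₀ β (ρ k) (G i) x‖ ^ 2) ≤ C) ∧
      -- every weak `H¹(D)` limit of a subsequence agrees a.e. in `D` with a function that is
      -- homogeneous of degree `β`
      (∀ (i : Fin m) (σ : ℕ → ℕ), StrictMono σ →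
        ∀ (w₀ : EuclideanSpace ℝ (Fin n) → ℝ)
          (g₀ : EuclideanSpace ℝ (Fin n) → EuclideanSpace ℝ (Fin n)),
        BlowUp.WeakH1Tendsto D
          (fun j => BlowUp.rescale x₀ β (ρ (σ j)) (fun x => u x i))
          (fun j => BlowUp.rescaleGrad x₀ β (ρ (σ j)) (G i)) w₀ g₀ →
        ∃ h : EuclideanSpace ℝ (Fin n) → ℝ, BlowUp.IsHomogeneous β h ∧
          w₀ =ᵐ[volume.restrict D] h) := by
  refine ⟨⟨hu.monotoneOn_Phi hn hball hβ, hu.exists_tendsto_Phi hn hδ hball hβ hgrowth⟩,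
    fun D hD hDb => ⟨hu.eventually_rescale_bound hn hδ hball hβ hgrowth hρ hρ0 hDb,
      fun i σ hσ w₀ g₀ hw => ?_⟩⟩
  -- Subsequences require no separate argument: `ρ ∘ σ` is again a sequence of positive radii
  -- tending to zero.
  exact hu.exists_isHomogeneous hn hδ hball hβ hgrowth (fun j => hρ (σ j))
    (hρ0.comp hσ.tendsto_atTop) hD hDb i hw
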